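/- **Setting.** Let $\mathcal S,\mathcal A,\mathcal B$ be finite non-empty sets, $H,K\ge 1$ and $\delta\in(0,1)$. Consider an episodic two-player zero-sum Markov game with single-controller transitions $\mathcal P_h(s'\mid s,a)$, mean rewards $r_h(s,a,b)\in[0,1]$ ($h=1,\dots,H$) and fixed initial state $s_1$; $\mathcal P$ and $r$ are unknown to the players. For policies $\mu=\{\mu_h(\cdot\mid s)\}$ and $\nu=\{\nu_h(\cdot\mid s)\}$ let $V_1^{\mu,\nu}(s_1)=\mathbb E\big[\sum_{h=1}^H r_h(s_h,a_h,b_h)\big]$. In episode $k=1,\dots,K$ the players start at $s_1$ and, given the past, draw $a_h^k\sim\mu_h^k(\cdot\mid s_h^k)$ and $b_h^k\sim\nu_h^k(\cdot\mid s_h^k)$ independently; then $s_{h+1}^k\sim\mathcal P_h(\cdot\mid s_h^k,a_h^k)$, and they observe the reward $r_h^k(s_h^k,a_h^k,b_h^k)$, where the random function $r_h^k$ has values in $[0,1]$ and, given the history up to and including the actions at step $h$ of episode $k$, has mean $r_h$. **Estimates.** For $k\ge1$ let $N_h^k(s,a,b)$ and $N_h^k(s,a)$ be the numbers of visits at step $h$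 in episodes $1,\dots,k$, and let $$\hat r_h^k(s,a,b)=\frac{\sum_{\tau\le k}\mathbf 1\{(s_h^\tau,a_h^\tau,b_h^\tau)=(s,a,b)\}\,r_h^\tau(s,a,b)}{\max\{N_h^k(s,a,b),1\}},\qquad \hat{\mathcal P}_h^k(s'\mid s,a)=\frac{\sum_{\tau\le k}\mathbf 1\{(s_h^\tau,a_h^\tau,s_{h+1}^\tau)=(s,a,s')\}}{\max\{N_h^k(s,a),1\}},$$ $$\beta_h^{r,k}(s,a,b)=\sqrt{\frac{4\log(|\mathcal S||\mathcal A||\mathcal B|HK/\delta)}{\max\{N_h^k(s,a,b),1\}}},\qquad \beta_h^{\mathcal P,k}(s,a)=\sqrt{\frac{2H^2|\mathcal S|\log(|\mathcal S||\mathcal A|HK/\delta)}{\max\{N_h^k(s,a),1\}}}.$$ For $k=0$ let $\hat r^0=\beta^{r,0}=\beta^{\mathcal P,0}=0$ and $\hat{\mathcal P}^0=1/|\mathcal S|$. The policies $\mu^0,\nu^0$ are uniform. **Player 1.** For $k=0,\dots,K-1$, set $\overline V_{H+1}^k=0$ and, for $h=H,\dots,1$, $$\overline Q_h^k(s,a,b)=\max\Big\{0,\min\Big\{\hat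 r_h^k(s,a,b)+\sum_{s'}\hat{\mathcal P}_h^k(s'\mid s,a)\overline V_{h+1}^k(s')+\beta_h^{r,k}(s,a,b)+\beta_h^{\mathcal P,k}(s,a),\;H-h+1\Big\}\Big\},$$ $$\overline V_h^k(s)=\sum_{a,b}\mu_h^k(a\mid s)\overline Q_h^k(s,a,b)\nu_h^k(b\mid s),\qquad \mu_h^{k+1}(a\mid s)\propto\mu_h^k(a\mid s)\exp\Big\{\eta\sum_b\overline Q_h^k(s,a,b)\nu_h^k(b\mid s)\Big\}.$$ **Player 2.** For $k=0,\dots,K-1$, let $\tilde r_h^k=\max\{\hat r_h^k-\beta_h^{r,k},0\}$, $d_1^k(s)=\mathbf 1\{s=s_1\}$, $d_{h+1}^k(s')=\sum_{s,a}d_h^k(s)\mu_h^k(a\mid s)\hat{\mathcal P}_h^k(s'\mid s,a)$, and $$\nu_h^{k+1}(b\mid s)\propto\nu_h^k(b\mid s)\exp\Big\{-\gamma\, d_h^k(s)\sum_a\tilde r_h^k(s,a,b)\mu_h^k(a\mid s)\Big\}.$$ **Statement.** Let $\eta=\sqrt{\log|\mathcal A|/(KH^2)}$, $\gamma=\sqrt{|\mathcal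 S|\log|\mathcal B|/K}$, $T=KH$, and $$\mathrm{Gap}(K)=\max_{\mu}\sum_{k=1}^K\big[V_1^{\mu,\nu^k}(s_1)-V_1^{\mu^k,\nu^k}(s_1)\big]+\max_{\nu}\sum_{k=1}^K\big[V_1^{\mu^k,\nu^k}(s_1)-V_1^{\mu^k,\nu}(s_1)\big].$$ There are absolute constants $c>0$ and $p\in\mathbb N$ such that, for every game, every $K\ge1$ and every $\delta\in(0,1)$ as above, if both players run these algorithms simultaneously, then with probability at least $1-5\delta$ $$\mathrm{Gap}(K)\le c\,\Big(\log\frac{|\mathcal S||\mathcal A||\mathcal B|HK}{\delta}\Big)^{p}\Big(\sqrt{|\mathcal S|^2|\mathcal A|H^3}+\sqrt{|\mathcal S||\mathcal A||\mathcal B|H}\Big)\sqrt T .$$ -/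

import Mathlib

open scoped BigOperators

/-! Conventions. Steps of an episode are numbered from `0`: the index `h < H` stands for the step
usually called `h + 1`, and `state k H` is the state reached after the last action. Episodes are
numbered `1, …, K`; the index `0` is the initialization of the learning algorithms. Step-indexed
families are functions on `ℕ`, of which only the values at `h < H` are ever used. -/

/-- An episodic two-player zero-sum Markov game with single-controller transition:
`P h s a s'` is the probability to move from `s` to `s'` at step `h` when Player 1 plays `a`,
`r h s a b` is the mean reward, and every episode starts in `s₁`. -/
structure SCGame (S A B : Type*) [Fintype S] where
  H : ℕ
  H_pos : 0 < H
  P : ℕ → S → A → S → ℝ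
  P_mem : ∀ h s a, P h s a ∈ stdSimplex ℝ S
  r : ℕ → S → A → B → ℝ
  r_mem : ∀ h s a b, r h s a b ∈ Set.Icc (0 : ℝ) 1
  s₁ : S

/-- A (Markov, randomized) policy of a player with action set `X`. -/
def IsPolicy {S X : Type*} [Fintype X] (π : ℕ → S → X → ℝ) : Prop :=
  ∀ h s, π h s ∈ stdSimplex ℝ X

namespace SCGame

variable {S A B : Type*} [Fintype S] [Fintype A] [Fintype B] [DecidableEq S]

/-- Probability that the states of the trajectory up to step `h` continue with the state at
step `h`: the initial state is `s₁`, later ones follow `P`. -/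
def arriveProb (G : SCGame S A B) (x : Fin G.H → S × A × B) : Fin G.H → ℝ
  | ⟨0, h0⟩ => if (x ⟨0, h0⟩).1 = G.s₁ then 1 else 0
  | ⟨j + 1, hj⟩ =>
      G.P j (x ⟨j, Nat.lt_of_succ_lt hj⟩).1 (x ⟨j, Nat.lt_of_succ_lt hj⟩).2.1 (x ⟨j + 1, hj⟩).1

/-- Probability of the trajectory `x = (s_h, a_h, b_h)_h` when the players use `μ` and `ν`. -/
def trajProb (G : SCGame S A B) (μ : ℕ → S → A → ℝ) (ν : ℕ → S → B → ℝ)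
    (x : Fin G.H → S × A × B) : ℝ :=
  ∏ h : Fin G.H, G.arriveProb x h * μ h (x h).1 (x h).2.1 * ν h (x h).1 (x h).2.2

/-- The value `V_1^{μ,ν}(s₁)`: the expected total reward of an episode. -/
def value (G : SCGame S A B) (μ : ℕ → S → A → ℝ) (ν : ℕ → S → B → ℝ) : ℝ :=
  ∑ x : Fin G.H → S × A × B,
    G.trajProb μ ν x * ∑ h : Fin G.H, G.r h (x h).1 (x h).2.1 (x h).2.2

/-- Regret of Player 1 against the best fixed policy in hindsight. -/
noncomputable def regret₁ (G : SCGame S A B) (K : ℕ) (μs : ℕ → ℕ → S → A → ℝ)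
    (νs : ℕ → ℕ → S → B → ℝ) : ℝ :=
  ⨆ μ : {μ : ℕ → S → A → ℝ // IsPolicy μ},
    ∑ k ∈ Finset.Icc 1 K, (G.value μ.1 (νs k) - G.value (μs k) (νs k))

/-- Regret of Player 2 against the best fixed policy in hindsight. -/
noncomputable def regret₂ (G : SCGame S A B) (K : ℕ) (μs : ℕ → ℕ → S → A → ℝ)
    (νs : ℕ → ℕ → S → B → ℝ) : ℝ :=
  ⨆ ν : {ν : ℕ → S → B → ℝ // IsPolicy ν},
    ∑ k ∈ Finset.Icc 1 K, (G.value (μs k) (νs k) - G.value (μs k) ν.1)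

/-- The optimality gap. -/
noncomputable def gap (G : SCGame S A B) (K : ℕ) (μs : ℕ → ℕ → S → A → ℝ)
    (νs : ℕ → ℕ → S → B → ℝ) : ℝ :=
  G.regret₁ K μs νs + G.regret₂ K μs νs

end SCGame

/-! ### Mirror step -/

/-- Relative entropy of two probability vectors. -/
noncomputable def relEnt {X : Type*} [Fintype X] (p q : X → ℝ) : ℝ :=
  ∑ x, p x * Real.log (p x / q x)

/-- The entropic mirror step `w ↦ w exp (η u) / Z`. -/
noncomputable def mirrorStep {X : Type*} [Fintype X] (η : ℝ) (w u : X → ℝ) : X → ℝ :=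
  fun x => w x * Real.exp (η * u x) / ∑ y, w y * Real.exp (η * u y)

/-- For `η > 0` and `w` in the relative interior of the simplex, `mirrorStep η w u` is the unique
maximizer over the simplex of `p ↦ ⟨p - w, u⟩ - η⁻¹ KL(p, w)`. -/
theorem mirrorStep_isUniqueMax {X : Type*} [Fintype X] [Nonempty X] {η : ℝ} (hη : 0 < η)
    {w : X → ℝ} (hw : ∀ x, 0 < w x) (u : X → ℝ) :
    mirrorStep η w u ∈ stdSimplex ℝ X ∧ (∀ x, 0 < mirrorStep η w u x) ∧
    ∀ p ∈ stdSimplex ℝ X, p ≠ mirrorStep η w u →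
      ∑ x, (p x - w x) * u x - η⁻¹ * relEnt p w <
        ∑ x, (mirrorStep η w u x - w x) * u x - η⁻¹ * relEnt (mirrorStep η w u) w := by
  set m := mirrorStep η w u with hm
  set Z := ∑ y, w y * Real.exp (η * u y) with hZ
  have hZpos : 0 < Z :=
    Finset.sum_pos (fun x _ => mul_pos (hw x) (Real.exp_pos _)) Finset.univ_nonempty
  have hmx : ∀ x, m x = w x * Real.exp (η * u x) / Z := fun x => rfl
  have hmpos : ∀ x, 0 < m x := fun x => by
    rw [hmx]; exact div_pos (mul_pos (hw x) (Real.exp_pos _)) hZpos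
  have hmsum : ∑ x, m x = 1 := by
    simp only [hmx]
    rw [← Finset.sum_div, ← hZ, div_self hZpos.ne']
  have key : ∀ p ∈ stdSimplex ℝ X,
      ∑ x, (p x - w x) * u x - η⁻¹ * relEnt p w =
        (η⁻¹ * Real.log Z - ∑ x, w x * u x) - η⁻¹ * relEnt p m := by
    intro p hp
    have hterm : ∀ x, p x * Real.log (p x / w x) =
        p x * Real.log (p x / m x) + η * (p x * u x) - Real.log Z * p x := by
      intro x
      rcases (hp.1 x).eq_or_lt with h0 | h0
      · simp [← h0]
      · rw [Real.log_div h0.ne' (hw x).ne', Real.log_div h0.ne' (hmpos x).ne', hmx,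
          Real.log_div (mul_pos (hw x) (Real.exp_pos _)).ne' hZpos.ne',
          Real.log_mul (hw x).ne' (Real.exp_pos _).ne', Real.log_exp]
        ring
    have hrel : relEnt p w = relEnt p m + η * ∑ x, p x * u x - Real.log Z := by
      simp only [relEnt, hterm]
      rw [Finset.sum_sub_distrib, Finset.sum_add_distrib, ← Finset.mul_sum, ← Finset.mul_sum,
        hp.2, mul_one]
    rw [hrel]
    simp only [sub_mul, Finset.sum_sub_distrib]
    field_simp
    ring
  have hmmem : m ∈ stdSimplex ℝ X := ⟨fun x => (hmpos x).le, hmsum⟩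
  refine ⟨hmmem, hmpos, fun p hp hpm => ?_⟩
  rw [key p hp, key m hmmem]
  have hmm : relEnt m m = 0 := by
    simp [relEnt, fun x => div_self (hmpos x).ne']
  have hlt : ∀ x, p x ≠ m x → p x - m x < p x * Real.log (p x / m x) := by
    intro x hx
    rcases (hp.1 x).eq_or_lt with h0 | h0
    · simp [← h0, hmpos x]
    · have h1 : Real.log (m x / p x) < m x / p x - 1 :=
        Real.log_lt_sub_one_of_pos (div_pos (hmpos x) h0)
          (fun h => hx ((div_eq_one_iff_eq h0.ne').1 h).symm)
      have h2 : Real.log (p x / m x) = - Real.log (m x / p x) := by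
        rw [← Real.log_inv, inv_div]
      have h3 : p x * (m x / p x - 1) = m x - p x := by field_simp
      have h4 := mul_lt_mul_of_pos_left h1 h0
      rw [h2]
      linarith
  have hpos : 0 < relEnt p m := by
    obtain ⟨x, hx⟩ := Function.ne_iff.1 hpm
    have h5 : ∑ x, (p x - m x) < relEnt p m := by
      refine Finset.sum_lt_sum (fun y _ => ?_) ⟨x, Finset.mem_univ x, hlt x hx⟩
      by_cases hy : p y = m y
      · simp [hy, div_self (hmpos y).ne']
      · exact (hlt y hy).le
    rw [Finset.sum_sub_distrib, hp.2, hmsum, sub_self] at h5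
    exact h5
  rw [hmm]
  have := mul_pos (inv_pos.2 hη) hpos
  linarith

/-! ### What the players observe, and their estimates -/

/-- The observations: states, actions of both players and bandit rewards, by episode and step. -/
structure Record (S A B : Type*) where
  state : ℕ → ℕ → S
  act₁ : ℕ → ℕ → A
  act₂ : ℕ → ℕ → B
  rew : ℕ → ℕ → ℝ

namespace Record

variable {S A B : Type*} [Fintype S] [Fintype A] [Fintype B]
  [DecidableEq S] [DecidableEq A] [DecidableEq B]

/-- `N_h^k(s, a, b)`. -/
def count₃ (D : Record S A B) (k h : ℕ) (s : S) (a : A) (b : B) : ℕ :=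
  ((Finset.Icc 1 k).filter
    (fun τ => D.state τ h = s ∧ D.act₁ τ h = a ∧ D.act₂ τ h = b)).card

/-- `N_h^k(s, a)`. -/
def count₂ (D : Record S A B) (k h : ℕ) (s : S) (a : A) : ℕ :=
  ((Finset.Icc 1 k).filter (fun τ => D.state τ h = s ∧ D.act₁ τ h = a)).card

/-- The empirical reward after episode `k` (equal to `0` for `k = 0`). -/
noncomputable def rHat (D : Record S A B) (k h : ℕ) (s : S) (a : A) (b : B) : ℝ :=
  (∑ τ ∈ Finset.Icc 1 k,
    if D.state τ h = s ∧ D.act₁ τ h = a ∧ D.act₂ τ h = b then D.rew τ h else 0) /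
    max (D.count₃ k h s a b : ℝ) 1

/-- The empirical transition model after episode `k`; it is uniform for `k = 0`. -/
noncomputable def PHat (D : Record S A B) (k h : ℕ) (s : S) (a : A) (s' : S) : ℝ :=
  if k = 0 then 1 / (Fintype.card S : ℝ)
  else (((Finset.Icc 1 k).filter
      (fun τ => D.state τ h = s ∧ D.act₁ τ h = a ∧ D.state τ (h + 1) = s')).card : ℝ) /
    max (D.count₂ k h s a : ℝ) 1

/-- The reward bonus `β_h^{r,k}`, for horizon `H`, `K` episodes and confidence `δ`. -/
noncomputable def bonusR (D : Record S A B) (H K : ℕ) (δ : ℝ) (k h : ℕ)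
    (s : S) (a : A) (b : B) : ℝ :=
  if k = 0 then 0
  else √(4 * Real.log ((Fintype.card S : ℝ) * Fintype.card A * Fintype.card B * H * K / δ) /
    max (D.count₃ k h s a b : ℝ) 1)

/-- The transition bonus `β_h^{P,k}`. -/
noncomputable def bonusP (D : Record S A B) (H K : ℕ) (δ : ℝ) (k h : ℕ) (s : S) (a : A) : ℝ :=
  if k = 0 then 0
  else √(2 * (H : ℝ) ^ 2 * Fintype.card S *
    Real.log ((Fintype.card S : ℝ) * Fintype.card A * H * K / δ) /
    max (D.count₂ k h s a : ℝ) 1)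

/-- One step of the optimistic policy evaluation of Player 1, given the estimate `V` of the value
at the next step: `min {rHat + PHat V + β, n + 1}⁺` at step `h`, where `n` steps remain after `h`
(so that `n + 1 = H - h`). -/
noncomputable def qStep (D : Record S A B) (H K : ℕ) (δ : ℝ) (k n h : ℕ) (V : S → ℝ)
    (s : S) (a : A) (b : B) : ℝ :=
  max (min (D.rHat k h s a b + ∑ s', D.PHat k h s a s' * V s' +
    (D.bonusR H K δ k h s a b + D.bonusP H K δ k h s a)) (n + 1)) 0

/-- The optimistic value function of Player 1 at step `h` with `n` steps remaining
(`n = H - h`), for the policies `μ`, `ν` and the data of the first `k` episodes. -/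
noncomputable def vBar (D : Record S A B) (H K : ℕ) (δ : ℝ) (k : ℕ)
    (μ : ℕ → S → A → ℝ) (ν : ℕ → S → B → ℝ) : ℕ → ℕ → S → ℝ
  | 0, _, _ => 0
  | n + 1, h, s => ∑ a, ∑ b, μ h s a *
      D.qStep H K δ k n h (D.vBar H K δ k μ ν n (h + 1)) s a b * ν h s b

/-- The optimistic Q-function of Player 1 at step `h < H`. -/
noncomputable def qBar (D : Record S A B) (H K : ℕ) (δ : ℝ) (k : ℕ)
    (μ : ℕ → S → A → ℝ) (ν : ℕ → S → B → ℝ) (h : ℕ) (s : S) (a : A) (b : B) : ℝ :=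
  D.qStep H K δ k (H - (h + 1)) h (D.vBar H K δ k μ ν (H - (h + 1)) (h + 1)) s a b

/-- Policy improvement of Player 1: from the policies `μ`, `ν` of episode `k` and the data of the
first `k` episodes to the policy of Player 1 in episode `k + 1`. It is the mirror ascent step for
`⟨μ' - μ, Q ν⟩ - η⁻¹ KL(μ', μ)` at every step and state. -/
noncomputable def next₁ (D : Record S A B) (H K : ℕ) (δ η : ℝ) (k : ℕ)
    (μ : ℕ → S → A → ℝ) (ν : ℕ → S → B → ℝ) : ℕ → S → A → ℝ :=
  fun h s => mirrorStep η (μ h s) (fun a => ∑ b, D.qBar H K δ k μ ν h s a b * ν h s b)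

/-- The pessimistic reward estimate of Player 2. -/
noncomputable def rTilde (D : Record S A B) (H K : ℕ) (δ : ℝ) (k h : ℕ)
    (s : S) (a : A) (b : B) : ℝ :=
  max (D.rHat k h s a b - D.bonusR H K δ k h s a b) 0

/-- The estimated probability that Player 2 assigns to reaching a state at step `h`, computed
forward in `h` from the empirical transition model and the policy `μ` of Player 1. -/
noncomputable def reach (D : Record S A B) (s₁ : S) (k : ℕ) (μ : ℕ → S → A → ℝ) : ℕ → S → ℝ
  | 0, s => if s = s₁ then 1 else 0
  | h + 1, s' => ∑ s, ∑ a, D.reach s₁ k μ h s * μ h s a * D.PHat k h s a s'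

/-- Policy improvement of Player 2: the mirror descent step for
`d(s) ⟨μ r̃, ν' - ν⟩ + γ⁻¹ KL(ν', ν)` at every step and state, written as the maximization of the
negative of this expression. -/
noncomputable def next₂ (D : Record S A B) (s₁ : S) (H K : ℕ) (δ γ : ℝ) (k : ℕ)
    (μ : ℕ → S → A → ℝ) (ν : ℕ → S → B → ℝ) : ℕ → S → B → ℝ :=
  fun h s => mirrorStep γ (ν h s)
    (fun b => -(D.reach s₁ k μ h s * ∑ a, D.rTilde H K δ k h s a b * μ h s a))

/-- The policies `(μ^k, ν^k)` when Player 1 and Player 2 run their algorithms simultaneously,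
each observing the policy of the opponent in the previous episode. -/
noncomputable def policies (D : Record S A B) (s₁ : S) (H K : ℕ) (δ η γ : ℝ) :
    ℕ → (ℕ → S → A → ℝ) × (ℕ → S → B → ℝ)
  | 0 => (fun _ _ _ => 1 / (Fintype.card A : ℝ), fun _ _ _ => 1 / (Fintype.card B : ℝ))
  | k + 1 =>
      (D.next₁ H K δ η k (D.policies s₁ H K δ η γ k).1 (D.policies s₁ H K δ η γ k).2,
       D.next₂ s₁ H K δ γ k (D.policies s₁ H K δ η γ k).1 (D.policies s₁ H K δ η γ k).2)

end Record

/-! ### The random play -/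

/-- The random elements of `K` episodes of play: states, actions, and the random reward functions
`R k h : S × A × B → [0, 1]`, of which the players see only the value along the trajectory. -/
structure Play (S A B Ω : Type*) where
  state : ℕ → ℕ → Ω → S
  act₁ : ℕ → ℕ → Ω → A
  act₂ : ℕ → ℕ → Ω → B
  R : ℕ → ℕ → S → A → B → Ω → ℝ

namespace Play

variable {S A B Ω : Type*}

/-- The bandit feedback at step `h` of episode `k`. -/
def obs (X : Play S A B Ω) (k h : ℕ) (ω : Ω) : ℝ :=
  X.R k h (X.state k h ω) (X.act₁ k h ω) (X.act₂ k h ω) ω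

/-- What the players observe on the outcome `ω`. -/
def record (X : Play S A B Ω) (ω : Ω) : Record S A B where
  state k h := X.state k h ω
  act₁ k h := X.act₁ k h ω
  act₂ k h := X.act₂ k h ω
  rew k h := X.obs k h ω

/-- The σ-algebra generated by the observations `s_h, a_h, b_h, r_h, s_{h+1}` of one step. -/
@[reducible]
def stepSigma (X : Play S A B Ω) (k h : ℕ) : MeasurableSpace Ω :=
  MeasurableSpace.comap (X.state k h) ⊤ ⊔ MeasurableSpace.comap (X.act₁ k h) ⊤ ⊔
    MeasurableSpace.comap (X.act₂ k h) ⊤ ⊔ MeasurableSpace.comap (X.obs k h) inferInstance ⊔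
    MeasurableSpace.comap (X.state k (h + 1)) ⊤

/-- The history up to the state of step `h` of episode `k`: all earlier episodes, the earlier
steps of episode `k`, and the current state. -/
@[reducible]
def histState (X : Play S A B Ω) (H k h : ℕ) : MeasurableSpace Ω :=
  (⨆ (τ : ℕ) (j : ℕ) (_ : 1 ≤ τ ∧ (τ < k ∧ j < H ∨ τ = k ∧ j < h)), X.stepSigma τ j) ⊔
    MeasurableSpace.comap (X.state k h) ⊤

/-- The history up to the actions of step `h` of episode `k`. -/
@[reducible]
def histAct (X : Play S A B Ω) (H k h : ℕ) : MeasurableSpace Ω :=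
  X.histState H k h ⊔ MeasurableSpace.comap (X.act₁ k h) ⊤ ⊔ MeasurableSpace.comap (X.act₂ k h) ⊤

/-- The law of the interaction. In episodes `k = 1, …, K` of the game `G`, started in `s₁`, given
the history the players draw their actions independently of each other from `μs k ω`, `νs k ω`
(policies that may depend on the outcome through the past); given the history including the
actions, the next state follows `P_h(· | s_h, a_h)` and the random reward function has mean `r_h`.
Nothing else is assumed about the rewards, which may be non-stationary. -/
structure Follows [Fintype S] [MeasurableSpace Ω] (X : Play S A B Ω) (ℙ : MeasureTheory.Measure Ω)
    (G : SCGame S A B) (K : ℕ)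
    (μs : ℕ → Ω → ℕ → S → A → ℝ) (νs : ℕ → Ω → ℕ → S → B → ℝ) : Prop where
  measurable_state : ∀ k h (s : S), MeasurableSet {ω | X.state k h ω = s}
  measurable_act₁ : ∀ k h (a : A), MeasurableSet {ω | X.act₁ k h ω = a}
  measurable_act₂ : ∀ k h (b : B), MeasurableSet {ω | X.act₂ k h ω = b}
  measurable_R : ∀ k h s a b, Measurable (X.R k h s a b)
  R_mem : ∀ k h s a b ω, X.R k h s a b ω ∈ Set.Icc (0 : ℝ) 1
  state_zero : ∀ k ω, X.state k 0 ω = G.s₁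
  actions : ∀ k ∈ Finset.Icc 1 K, ∀ h < G.H, ∀ a b,
    MeasureTheory.condExp (X.histState G.H k h) ℙ
      (Set.indicator {ω | X.act₁ k h ω = a ∧ X.act₂ k h ω = b} (fun _ => (1 : ℝ)))
      =ᵐ[ℙ] fun ω => μs k ω h (X.state k h ω) a * νs k ω h (X.state k h ω) b
  transition : ∀ k ∈ Finset.Icc 1 K, ∀ h < G.H, ∀ s',
    MeasureTheory.condExp (X.histAct G.H k h) ℙ
      (Set.indicator {ω | X.state k (h + 1) ω = s'} (fun _ => (1 : ℝ)))
      =ᵐ[ℙ] fun ω => G.P h (X.state k h ω) (X.act₁ k h ω) s'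
  reward : ∀ k ∈ Finset.Icc 1 K, ∀ h < G.H, ∀ s a b,
    MeasureTheory.condExp (X.histAct G.H k h) ℙ (X.R k h s a b)
      =ᵐ[ℙ] fun _ => G.r h s a b

end Play

/-!
The gap is bounded by elementary means; three ingredients are combined.

*Decomposition.* Both regrets are split by performance-difference identities, which become algebra
once the value is written as a sum over the state distributions `SCGame.occ`
(`SCGame.value_eq_total`, `SCGame.telescope`). For Player 1 the optimistic Q-function lies between
the Bellman update and the Bellman update plus twice the bonuses (`Record.qBar_bounds`). The regret
is therefore at most that of mirror ascent with the optimistic Q-functions, run at every step and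
state, plus twice the expected bonuses (`Record.value_sub_value_le`). For Player 2 the state
distribution does not depend on the policy compared with, because Player 1 alone controls the
transitions. So the regret is that of mirror descent with losses weighted by the estimated
distribution `Record.reach`, plus the error of that distribution, which accumulates the errors of
the transition model along the play and is again bounded by expected bonuses
(`Record.sum_abs_occ_sub_reach`, `Record.value_sub_value_le_right`). Mirror descent is handled by
the potential `∑ x, p x * log (w x)` (`mirror_regret_tuned`).

*Accuracy.* Rewards and transitions are within their bonuses with probability at least `1 - 2 δ`
each (`Play.Follows.rewardsAccurate`, `Play.Follows.transitionsAccurate`). The number of visits is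
random and depends on the outcomes, so Hoeffding's inequality is proved for the process stopped
after the `n`-th visit, followed by a union over `n` (`visits_concentration`). Transitions are
controlled on all sets of states at once, which gives both the total variation error needed for
`Record.reach` and the error against arbitrary value functions.

*Bonuses.* The bonuses after episode `k` depend on that episode, but they are dominated by the
bonuses with the counts before it (`Record.priorBonus`), which the past determines. Hence their
expectation under the policies of episode `k` is a conditional mean of what is met in that episode
(`Play.Follows.integral_mul_visit₃_of_state`), and with probability at least `1 - δ` the sum of
these means is at most twice the realized sum up to a logarithmic term
(`Play.Follows.sum_total_priorBonus`). The realized sum is `O(√K)` by counting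
(`Record.sum_priorBonus_le`).

A game in which each player has a single action has gap `0` and is treated separately. In all other
games the logarithm is at least `log 2`, so a reward bonus is at least `1` where nothing has been
observed, and powers of the logarithm can be absorbed into its square.
-/

set_option linter.unusedSectionVars false

/-! ### Regret of the entropic mirror step -/

section Mirror

variable {X : Type*} [Fintype X]

theorem exp_neg_le_quadratic {x : ℝ} (hx : 0 ≤ x) : Real.exp (-x) ≤ 1 - x + x ^ 2 / 2 := by
  have h1 := Real.quadratic_le_exp_of_nonneg hx
  have h2 : 0 < 1 + x + x ^ 2 / 2 := by positivity
  have h3 : Real.exp (-x) * Real.exp x = 1 := by rw [← Real.exp_add]; simp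
  have h4 : Real.exp (-x) * (1 + x + x ^ 2 / 2) ≤ 1 :=
    (mul_le_mul_of_nonneg_left h1 (Real.exp_pos _).le).trans h3.le
  have h5 : (1 - x + x ^ 2 / 2) * (1 + x + x ^ 2 / 2) = 1 + x ^ 4 / 4 := by ring
  have h6 : 0 ≤ x ^ 4 := by positivity
  exact le_of_mul_le_mul_right (by linarith) h2

theorem mirrorStep_mem [Nonempty X] (η : ℝ) {w : X → ℝ} (hw : ∀ x, 0 < w x) (u : X → ℝ) :
    mirrorStep η w u ∈ stdSimplex ℝ X ∧ ∀ x, 0 < mirrorStep η w u x := by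
  have hZ : 0 < ∑ y, w y * Real.exp (η * u y) :=
    Finset.sum_pos (fun x _ => mul_pos (hw x) (Real.exp_pos _)) Finset.univ_nonempty
  have hp : ∀ x, 0 < mirrorStep η w u x := fun x =>
    div_pos (mul_pos (hw x) (Real.exp_pos _)) hZ
  refine ⟨⟨fun x => (hp x).le, ?_⟩, hp⟩
  simp only [mirrorStep]
  rw [← Finset.sum_div, div_self hZ.ne']

theorem mirrorStep_zero {w : X → ℝ} (hw : ∑ x, w x = 1) (η : ℝ) :
    mirrorStep η w (fun _ => 0) = w := by
  funext x
  simp [mirrorStep, hw]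

/-- One mirror step raises the potential `∑ x, p x * log (w x)` by at least `η ⟨p - w, u⟩`, up to a
second-order term. It is enough that `u` is bounded above by `c`: shifting `u` by `c` leaves the
step unchanged, and `exp (-x) ≤ 1 - x + x² / 2` holds for all `x ≥ 0`, however large `η` is. -/
theorem mirrorStep_potential [Nonempty X] {η c : ℝ} (hη : 0 ≤ η) {w u p : X → ℝ}
    (hw : ∀ x, 0 < w x) (hw1 : ∑ x, w x = 1) (hu : ∀ x, u x ≤ c) (hp : p ∈ stdSimplex ℝ X) :
    η * ∑ x, (p x - w x) * u x ≤
      ∑ x, p x * Real.log (mirrorStep η w u x) - ∑ x, p x * Real.log (w x) +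
        η ^ 2 / 2 * ∑ x, w x * (c - u x) ^ 2 := by
  set Z := ∑ y, w y * Real.exp (η * u y) with hZ
  have hZpos : 0 < Z :=
    Finset.sum_pos (fun x _ => mul_pos (hw x) (Real.exp_pos _)) Finset.univ_nonempty
  have h1 : ∀ x, p x * Real.log (mirrorStep η w u x) =
      p x * Real.log (w x) + η * (p x * u x) - p x * Real.log Z := by
    intro x
    rw [mirrorStep, ← hZ, Real.log_div (mul_pos (hw x) (Real.exp_pos _)).ne' hZpos.ne',
      Real.log_mul (hw x).ne' (Real.exp_pos _).ne', Real.log_exp]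
    ring
  set T := -(η * (c - ∑ x, w x * u x)) + η ^ 2 / 2 * ∑ x, w x * (c - u x) ^ 2 with hT
  have h2 : Z ≤ Real.exp (η * c) * (1 + T) := by
    have h3 : ∀ x, w x * Real.exp (η * u x) ≤ Real.exp (η * c) *
        (w x - η * (c * w x - w x * u x) + η ^ 2 / 2 * (w x * (c - u x) ^ 2)) := by
      intro x
      have e := exp_neg_le_quadratic (mul_nonneg hη (sub_nonneg.2 (hu x)))
      have e2 : Real.exp (η * u x) = Real.exp (η * c) * Real.exp (-(η * (c - u x))) := by
        rw [← Real.exp_add]; congr 1; ring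
      rw [e2]
      have := mul_le_mul_of_nonneg_left e (mul_pos (hw x) (Real.exp_pos (η * c))).le
      nlinarith [this]
    have h4 := Finset.sum_le_sum (fun x (_ : x ∈ Finset.univ) => h3 x)
    rw [← Finset.mul_sum, Finset.sum_add_distrib, Finset.sum_sub_distrib, ← Finset.mul_sum,
      ← Finset.mul_sum, Finset.sum_sub_distrib, ← Finset.mul_sum, hw1] at h4
    refine h4.trans (le_of_eq ?_)
    rw [hT]; ring
  have h5 : Real.log Z ≤ η * c + T := by
    rw [← Real.log_exp (η * c + T)]
    refine Real.log_le_log hZpos (h2.trans ?_)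
    rw [Real.exp_add]
    refine mul_le_mul_of_nonneg_left ?_ (Real.exp_pos _).le
    linarith [Real.add_one_le_exp T]
  simp only [h1, sub_mul, Finset.sum_sub_distrib, Finset.sum_add_distrib]
  rw [← Finset.sum_mul, hp.2, ← Finset.mul_sum]
  rw [hT] at h5
  linarith

/-- Regret bound for iterated mirror steps started at the uniform distribution. -/
theorem mirror_regret [Nonempty X] {η c : ℝ} (hη : 0 ≤ η) {w u : ℕ → X → ℝ}
    (hw1 : w 1 = fun _ => 1 / (Fintype.card X : ℝ))
    (hstep : ∀ k, 1 ≤ k → w (k + 1) = mirrorStep η (w k) (u k)) (hu : ∀ k, 1 ≤ k → ∀ x, u k x ≤ c)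
    {p : X → ℝ} (hp : p ∈ stdSimplex ℝ X) (K : ℕ) :
    η * ∑ k ∈ Finset.Icc 1 K, ∑ x, (p x - w k x) * u k x ≤
      Real.log (Fintype.card X) +
        η ^ 2 / 2 * ∑ k ∈ Finset.Icc 1 K, ∑ x, w k x * (c - u k x) ^ 2 := by
  have hmem : ∀ k, 1 ≤ k → w k ∈ stdSimplex ℝ X ∧ ∀ x, 0 < w k x := by
    intro k hk
    induction k, hk using Nat.le_induction with
    | base =>
      have hc : (0 : ℝ) < Fintype.card X := by exact_mod_cast Fintype.card_pos
      rw [hw1]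
      exact ⟨⟨fun x => by positivity, by simp⟩, fun x => by positivity⟩
    | succ k hk ih => rw [hstep k hk]; exact mirrorStep_mem η ih.2 _
  have key : η * ∑ k ∈ Finset.Icc 1 K, ∑ x, (p x - w k x) * u k x ≤
      ∑ x, p x * Real.log (w (K + 1) x) + Real.log (Fintype.card X) +
        η ^ 2 / 2 * ∑ k ∈ Finset.Icc 1 K, ∑ x, w k x * (c - u k x) ^ 2 := by
    induction K with
    | zero => simp [hw1, ← Finset.sum_mul, hp.2]
    | succ K ih =>
      have h1 : 1 ≤ K + 1 := by omega
      rw [Finset.sum_Icc_succ_top h1, Finset.sum_Icc_succ_top h1]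
      have := mirrorStep_potential hη (hmem _ h1).2 (hmem _ h1).1.2 (hu _ h1) hp
      rw [← hstep _ h1] at this
      linarith
  have h0 : ∑ x, p x * Real.log (w (K + 1) x) ≤ 0 := by
    refine Finset.sum_nonpos fun x _ => mul_nonpos_of_nonneg_of_nonpos (hp.1 x) ?_
    have hm := hmem (K + 1) (by omega)
    refine Real.log_nonpos (hm.2 x).le ?_
    rw [← hm.1.2]
    exact Finset.single_le_sum (fun y _ => (hm.2 y).le) (Finset.mem_univ x)
  linarith

/-- The regret bound with the tuned step size `η = √(log |X| / N)`, where `N` bounds the sum of the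
second-order terms. It includes `|X| = 1`, where `η = 0` and the regret vanishes. -/
theorem mirror_regret_tuned [Nonempty X] {η c N : ℝ} (hN : 0 < N)
    (hη : η = √(Real.log (Fintype.card X) / N)) {w u : ℕ → X → ℝ}
    (hw1 : w 1 = fun _ => 1 / (Fintype.card X : ℝ))
    (hstep : ∀ k, 1 ≤ k → w (k + 1) = mirrorStep η (w k) (u k)) (hu : ∀ k, 1 ≤ k → ∀ x, u k x ≤ c)
    {p : X → ℝ} (hp : p ∈ stdSimplex ℝ X) (K : ℕ) :
    ∑ k ∈ Finset.Icc 1 K, ∑ x, (p x - w k x) * u k x ≤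
      √(N * Real.log (Fintype.card X)) +
        η / 2 * ∑ k ∈ Finset.Icc 1 K, ∑ x, w k x * (c - u k x) ^ 2 := by
  have hlog : 0 ≤ Real.log (Fintype.card X) := Real.log_natCast_nonneg _
  rcases hlog.eq_or_lt with h0 | h0
  · have hcard : Fintype.card X = 1 := by
      have hpos : 0 < Fintype.card X := Fintype.card_pos
      by_contra hne
      have : (1 : ℝ) < Fintype.card X := by exact_mod_cast (by omega : 1 < Fintype.card X)
      exact absurd (Real.log_pos this) (by rw [← h0]; exact lt_irrefl _)
    obtain ⟨x0, hx0⟩ := Fintype.card_eq_one_iff.1 hcard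
    have huniv : (Finset.univ : Finset X) = {x0} := by ext x; simp [hx0 x]
    have hη0 : η = 0 := by rw [hη, ← h0]; simp
    have hmem : ∀ k, 1 ≤ k → w k x0 = 1 := by
      intro k hk
      induction k, hk using Nat.le_induction with
      | base => rw [hw1, hcard]; simp
      | succ k hk ih => rw [hstep k hk]; simp [mirrorStep, huniv, ih]
    have hp1 : p x0 = 1 := by have := hp.2; rwa [huniv, Finset.sum_singleton] at this
    rw [Finset.sum_eq_zero]
    · rw [hη0]; simp
    · intro k hk
      rw [huniv, Finset.sum_singleton, hp1, hmem k (Finset.mem_Icc.1 hk).1]; simp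
  · have hη0 : 0 < η := by rw [hη]; exact Real.sqrt_pos.2 (div_pos h0 hN)
    have h := mirror_regret hη0.le hw1 hstep hu hp K
    have hs : η * √(N * Real.log (Fintype.card X)) = Real.log (Fintype.card X) := by
      rw [hη, ← Real.sqrt_mul (by positivity)]
      rw [show Real.log (Fintype.card X) / N * (N * Real.log (Fintype.card X)) =
        Real.log (Fintype.card X) ^ 2 by field_simp]
      exact Real.sqrt_sq h0.le
    refine le_of_mul_le_mul_left (h.trans (le_of_eq ?_)) hη0
    rw [mul_add, hs]; ring

end Mirror

/-! ### Occupancy measures and values -/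

section Chain

variable {X : Type*} [Fintype X]

/-- The factor of the step `i` in the weight of the path `x` of a Markov chain with initial law `p`
and transitions `κ`. -/
def pathFactor (p : X → ℝ) (κ : ℕ → X → X → ℝ) {n : ℕ} (x : Fin n → X) : Fin n → ℝ
  | ⟨0, h0⟩ => p (x ⟨0, h0⟩)
  | ⟨j + 1, hj⟩ => κ j (x ⟨j, Nat.lt_of_succ_lt hj⟩) (x ⟨j + 1, hj⟩)

/-- The law at time `n` of the Markov chain with initial law `p` and transitions `κ`. -/
def chainLaw (p : X → ℝ) (κ : ℕ → X → X → ℝ) : ℕ → X → ℝ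
  | 0, y => p y
  | n + 1, y => ∑ x, chainLaw p κ n x * κ n x y

theorem sum_path_succ (p : X → ℝ) (κ : ℕ → X → X → ℝ) (n : ℕ) (F : (Fin (n + 2) → X) → ℝ) :
    ∑ x : Fin (n + 2) → X, (∏ i, pathFactor p κ x i) * F x =
      ∑ x : Fin (n + 1) → X, (∏ i, pathFactor p κ x i) *
        ∑ y, κ n (x (Fin.last n)) y * F (Fin.snoc x y) := by
  rw [← (Fin.snocEquiv (fun _ : Fin (n + 2) => X)).sum_comp, Fintype.sum_prod_type_right]
  refine Finset.sum_congr rfl fun x _ => ?_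
  rw [Finset.mul_sum]
  refine Finset.sum_congr rfl fun y _ => ?_
  have hF : (Fin.snocEquiv (fun _ : Fin (n + 2) => X)) (y, x) = Fin.snoc x y := rfl
  rw [hF, Fin.prod_univ_castSucc]
  have h1 : ∀ i : Fin (n + 1), pathFactor p κ (Fin.snoc x y : Fin (n + 2) → X) i.castSucc =
      pathFactor p κ x i := by
    have hs : ∀ (j : ℕ) (hj : j < n + 1) (hj' : j < n + 2),
        (Fin.snoc x y : Fin (n + 2) → X) ⟨j, hj'⟩ = x ⟨j, hj⟩ := fun j hj hj' =>
      Fin.snoc_castSucc (α := fun _ => X) y x ⟨j, hj⟩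
    rintro ⟨_ | j, hj⟩
    · exact congrArg p (hs 0 hj _)
    · exact congrArg₂ (κ j) (hs j (by omega) _) (hs (j + 1) hj _)
  have h2 : pathFactor p κ (Fin.snoc x y : Fin (n + 2) → X) (Fin.last (n + 1)) =
      κ n (x (Fin.last n)) y :=
    congrArg₂ (κ n) (Fin.snoc_castSucc (α := fun _ => X) y x (Fin.last n))
      (Fin.snoc_last (α := fun _ => X) y x)
  rw [h2, Finset.prod_congr rfl fun i _ => h1 i]
  ring

theorem sum_path_last (p : X → ℝ) (κ : ℕ → X → X → ℝ) (n : ℕ) (F : X → ℝ) :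
    ∑ x : Fin (n + 1) → X, (∏ i, pathFactor p κ x i) * F (x (Fin.last n)) =
      ∑ y, chainLaw p κ n y * F y := by
  induction n generalizing F with
  | zero =>
    rw [← (Equiv.funUnique (Fin 1) X).symm.sum_comp]
    simp [pathFactor, chainLaw]
  | succ n ih =>
    rw [sum_path_succ p κ n (fun x => F (x (Fin.last (n + 1))))]
    simp only [Fin.snoc_last]
    rw [ih (fun z => ∑ y, κ n z y * F y)]
    simp only [chainLaw, Finset.sum_mul, Finset.mul_sum]
    rw [Finset.sum_comm]
    simp only [mul_assoc]

theorem sum_path_eval (p : X → ℝ) {κ : ℕ → X → X → ℝ} (hκ : ∀ j x, ∑ y, κ j x y = 1)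
    {n j : ℕ} (hj : j < n) (F : X → ℝ) :
    ∑ x : Fin n → X, (∏ i, pathFactor p κ x i) * F (x ⟨j, hj⟩) =
      ∑ y, chainLaw p κ j y * F y := by
  induction n, hj using Nat.le_induction with
  | base => exact sum_path_last p κ j F
  | succ n hn ih =>
    obtain ⟨m, rfl⟩ : ∃ m, n = m + 1 := ⟨n - 1, by omega⟩
    rw [sum_path_succ p κ m (fun x => F (x ⟨j, by omega⟩)), ← ih]
    refine Finset.sum_congr rfl fun x _ => ?_
    congr 1
    have hs : ∀ y, (Fin.snoc x y : Fin (m + 2) → X) ⟨j, by omega⟩ = x ⟨j, hn⟩ := fun y =>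
      Fin.snoc_castSucc (α := fun _ => X) y x ⟨j, hn⟩
    simp only [hs]
    rw [← Finset.sum_mul, hκ, one_mul]

end Chain

namespace SCGame

variable {S A B : Type*} [Fintype S] [Fintype A] [Fintype B] [DecidableEq S]

/-- The law of the state at step `h`. It depends on the policy of Player 1 only. -/
def occ (G : SCGame S A B) (μ : ℕ → S → A → ℝ) : ℕ → S → ℝ
  | 0, s => if s = G.s₁ then 1 else 0
  | h + 1, s' => ∑ s, ∑ a, G.occ μ h s * μ h s a * G.P h s a s'

/-- The expected total of `f` over an episode, for a step-, state- and action-dependent `f`. -/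
def total (G : SCGame S A B) (μ : ℕ → S → A → ℝ) (ν : ℕ → S → B → ℝ)
    (f : ℕ → S → A → B → ℝ) : ℝ :=
  ∑ h ∈ Finset.range G.H, ∑ s, ∑ a, ∑ b, G.occ μ h s * μ h s a * ν h s b * f h s a b

variable (G : SCGame S A B) {μ : ℕ → S → A → ℝ} {ν : ℕ → S → B → ℝ}

theorem value_eq_total (hμ : IsPolicy μ) (hν : IsPolicy ν) : G.value μ ν = G.total μ ν G.r := by
  set p : S × A × B → ℝ := fun y => (if y.1 = G.s₁ then 1 else 0) * μ 0 y.1 y.2.1 * ν 0 y.1 y.2.2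
    with hp
  set κ : ℕ → S × A × B → S × A × B → ℝ := fun j x y =>
    G.P j x.1 x.2.1 y.1 * μ (j + 1) y.1 y.2.1 * ν (j + 1) y.1 y.2.2 with hκ
  have hκ1 : ∀ j x, ∑ y, κ j x y = 1 := by
    intro j x
    simp only [hκ, Fintype.sum_prod_type, ← Finset.mul_sum, (hν _ _).2, (hμ _ _).2, mul_one,
      (G.P_mem _ _ _).2]
  have hpath : ∀ x : Fin G.H → S × A × B, G.trajProb μ ν x = ∏ i, pathFactor p κ x i := by
    intro x
    refine Finset.prod_congr rfl ?_
    rintro ⟨_ | j, hj⟩ _ <;> rfl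
  have hlaw : ∀ h s a b, chainLaw p κ h (s, a, b) = G.occ μ h s * μ h s a * ν h s b := by
    intro h
    induction h with
    | zero => intro s a b; rfl
    | succ h ih =>
      intro s a b
      simp only [chainLaw, Fintype.sum_prod_type, ih]
      simp only [hκ, occ, Finset.sum_mul]
      refine Finset.sum_congr rfl fun s' _ => Finset.sum_congr rfl fun a' _ => ?_
      have : ∀ b', G.occ μ h s' * μ h s' a' * ν h s' b' *
          (G.P h s' a' s * μ (h + 1) s a * ν (h + 1) s b) =
          ν h s' b' * (G.occ μ h s' * μ h s' a' * G.P h s' a' s * μ (h + 1) s a * ν (h + 1) s b) :=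
        fun b' => by ring
      simp only [this, ← Finset.sum_mul, (hν _ _).2, one_mul]
  rw [value, total, ← Fin.sum_univ_eq_sum_range
    (fun h => ∑ s, ∑ a, ∑ b, G.occ μ h s * μ h s a * ν h s b * G.r h s a b)]
  simp only [hpath, Finset.mul_sum]
  rw [Finset.sum_comm]
  refine Finset.sum_congr rfl fun h _ => ?_
  rw [sum_path_eval p hκ1 h.2 (fun y => G.r h y.1 y.2.1 y.2.2)]
  simp only [Fintype.sum_prod_type, hlaw]

theorem occ_mem (hμ : IsPolicy μ) (h : ℕ) : G.occ μ h ∈ stdSimplex ℝ S := by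
  induction h with
  | zero => exact ⟨fun s => by simp only [occ]; split_ifs <;> norm_num, by simp [occ]⟩
  | succ h ih =>
    refine ⟨fun s' => Finset.sum_nonneg fun s _ => Finset.sum_nonneg fun a _ =>
      mul_nonneg (mul_nonneg (ih.1 s) ((hμ h s).1 a)) ((G.P_mem h s a).1 s'), ?_⟩
    simp only [occ]
    rw [Finset.sum_comm]
    have : ∀ s, ∑ s', ∑ a, G.occ μ h s * μ h s a * G.P h s a s' = G.occ μ h s := by
      intro s
      rw [Finset.sum_comm]
      simp only [← Finset.mul_sum, (G.P_mem _ _ _).2, (hμ _ _).2, mul_one]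
    simp only [this, ih.2]

theorem total_mono (hμ : IsPolicy μ) (hν : IsPolicy ν) {f g : ℕ → S → A → B → ℝ}
    (hfg : ∀ h < G.H, ∀ s a b, f h s a b ≤ g h s a b) : G.total μ ν f ≤ G.total μ ν g := by
  refine Finset.sum_le_sum fun h hh => Finset.sum_le_sum fun s _ => Finset.sum_le_sum fun a _ =>
    Finset.sum_le_sum fun b _ => ?_
  exact mul_le_mul_of_nonneg_left (hfg h (Finset.mem_range.1 hh) s a b)
    (mul_nonneg (mul_nonneg ((G.occ_mem hμ h).1 s) ((hμ h s).1 a)) ((hν h s).1 b))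

theorem total_add (f g : ℕ → S → A → B → ℝ) :
    G.total μ ν (fun h s a b => f h s a b + g h s a b) = G.total μ ν f + G.total μ ν g := by
  simp only [total, mul_add, Finset.sum_add_distrib]

theorem total_smul (c : ℝ) (f : ℕ → S → A → B → ℝ) :
    G.total μ ν (fun h s a b => c * f h s a b) = c * G.total μ ν f := by
  simp only [total, Finset.mul_sum]
  refine Finset.sum_congr rfl fun h _ => Finset.sum_congr rfl fun s _ =>
    Finset.sum_congr rfl fun a _ => Finset.sum_congr rfl fun b _ => by ring

theorem total_eq_of_right_const (hν : IsPolicy ν) (f : ℕ → S → A → ℝ) :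
    G.total μ ν (fun h s a _ => f h s a) =
      ∑ h ∈ Finset.range G.H, ∑ s, ∑ a, G.occ μ h s * μ h s a * f h s a := by
  refine Finset.sum_congr rfl fun h _ => Finset.sum_congr rfl fun s _ =>
    Finset.sum_congr rfl fun a _ => ?_
  rw [← Finset.sum_mul, ← Finset.mul_sum, (hν h s).2, mul_one]

theorem total_nonneg (hμ : IsPolicy μ) (hν : IsPolicy ν) {f : ℕ → S → A → B → ℝ}
    (hf : ∀ h < G.H, ∀ s a b, 0 ≤ f h s a b) : 0 ≤ G.total μ ν f := by
  have h := G.total_mono hμ hν (f := fun _ _ _ _ => 0) (g := f) hf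
  simpa [total] using h

/-- Telescoping along the state distribution: a function of the step and the state that vanishes
after the last step is, in expectation, the sum of its decrements. -/
theorem telescope (hν : IsPolicy ν) {V : ℕ → S → ℝ} (hV : ∀ s, V G.H s = 0) :
    V 0 G.s₁ = ∑ h ∈ Finset.range G.H, ∑ s, G.occ μ h s * V h s -
      G.total μ ν (fun h s a _ => ∑ s', G.P h s a s' * V (h + 1) s') := by
  rw [G.total_eq_of_right_const hν (fun h s a => ∑ s', G.P h s a s' * V (h + 1) s'),
    ← Finset.sum_sub_distrib]
  have h1 : ∀ h, ∑ s, ∑ a, G.occ μ h s * μ h s a * ∑ s', G.P h s a s' * V (h + 1) s' =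
      ∑ s, G.occ μ (h + 1) s * V (h + 1) s := by
    intro h
    simp only [occ, Finset.sum_mul, Finset.mul_sum]
    rw [Finset.sum_comm' (t' := Finset.univ) (s' := fun _ => Finset.univ) (by simp)]
    refine (Finset.sum_congr rfl fun a _ => Finset.sum_comm).trans ?_
    rw [Finset.sum_comm]
    refine Finset.sum_congr rfl fun s' _ => ?_
    rw [Finset.sum_comm]
    refine Finset.sum_congr rfl fun s _ => Finset.sum_congr rfl fun a _ => by ring
  simp only [h1]
  rw [Finset.sum_range_sub']
  simp [hV, occ]

end SCGame

/-! ### Elementary facts on the estimates and the policies -/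

namespace Record

variable {S A B : Type*} [Fintype S] [Fintype A] [Fintype B]
  [DecidableEq S] [DecidableEq A] [DecidableEq B]

variable (D : Record S A B) (H K : ℕ) (δ : ℝ)

theorem qStep_nonneg (k n h : ℕ) (V : S → ℝ) (s : S) (a : A) (b : B) :
    0 ≤ D.qStep H K δ k n h V s a b := le_max_right _ _

theorem qStep_le (k n h : ℕ) (V : S → ℝ) (s : S) (a : A) (b : B) :
    D.qStep H K δ k n h V s a b ≤ n + 1 := by
  refine max_le (min_le_right _ _) (by positivity)

theorem sum_policy_le {Y Z : Type*} [Fintype Y] [Fintype Z] {p : Y → ℝ} {q : Z → ℝ}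
    (hp : p ∈ stdSimplex ℝ Y) (hq : q ∈ stdSimplex ℝ Z) {f : Y → Z → ℝ} {c : ℝ}
    (hf : ∀ y z, f y z ≤ c) : ∑ y, ∑ z, p y * f y z * q z ≤ c := by
  calc ∑ y, ∑ z, p y * f y z * q z ≤ ∑ y, ∑ z, p y * c * q z := by
        refine Finset.sum_le_sum fun y _ => Finset.sum_le_sum fun z _ => ?_
        exact mul_le_mul_of_nonneg_right (mul_le_mul_of_nonneg_left (hf y z) (hp.1 y)) (hq.1 z)
    _ = c := by
        simp only [← Finset.mul_sum, ← Finset.sum_mul, hp.2, hq.2]; ring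

theorem vBar_mem (k : ℕ) {μ : ℕ → S → A → ℝ} {ν : ℕ → S → B → ℝ} (hμ : IsPolicy μ)
    (hν : IsPolicy ν) (n h : ℕ) (s : S) :
    0 ≤ D.vBar H K δ k μ ν n h s ∧ D.vBar H K δ k μ ν n h s ≤ n := by
  cases n with
  | zero => simp [vBar]
  | succ n =>
    constructor
    · exact Finset.sum_nonneg fun a _ => Finset.sum_nonneg fun b _ =>
        mul_nonneg (mul_nonneg ((hμ h s).1 a) (D.qStep_nonneg H K δ _ _ _ _ _ _ _)) ((hν h s).1 b)
    · rw [vBar]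
      push_cast
      exact sum_policy_le (hμ h s) (hν h s) fun a b => D.qStep_le H K δ _ _ _ _ _ _ _

theorem rHat_zero (h : ℕ) (s : S) (a : A) (b : B) : D.rHat 0 h s a b = 0 := by simp [rHat]

theorem vBar_zero (μ : ℕ → S → A → ℝ) (ν : ℕ → S → B → ℝ) (n h : ℕ) (s : S) :
    D.vBar H K δ 0 μ ν n h s = 0 := by
  induction n generalizing h s with
  | zero => rfl
  | succ n ih =>
    have : ∀ n : ℕ, min (0 : ℝ) (n + 1) = 0 := fun n => min_eq_left (by positivity)
    simp [vBar, qStep, rHat_zero, ih, bonusR, bonusP, this]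

theorem qBar_zero (μ : ℕ → S → A → ℝ) (ν : ℕ → S → B → ℝ) (h : ℕ) (s : S) (a : A) (b : B) :
    D.qBar H K δ 0 μ ν h s a b = 0 := by
  have : ∀ n : ℕ, min (0 : ℝ) (n + 1) = 0 := fun n => min_eq_left (by positivity)
  simp [qBar, qStep, rHat_zero, vBar_zero, bonusR, bonusP, this]

theorem rTilde_zero (h : ℕ) (s : S) (a : A) (b : B) : D.rTilde H K δ 0 h s a b = 0 := by
  simp [rTilde, rHat_zero, bonusR]

theorem rTilde_nonneg (k h : ℕ) (s : S) (a : A) (b : B) : 0 ≤ D.rTilde H K δ k h s a b :=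
  le_max_right _ _

theorem bonusR_nonneg (k h : ℕ) (s : S) (a : A) (b : B) : 0 ≤ D.bonusR H K δ k h s a b := by
  unfold bonusR; split_ifs <;> positivity

theorem bonusP_nonneg (k h : ℕ) (s : S) (a : A) : 0 ≤ D.bonusP H K δ k h s a := by
  unfold bonusP; split_ifs <;> positivity

theorem PHat_nonneg (k h : ℕ) (s : S) (a : A) (s' : S) : 0 ≤ D.PHat k h s a s' := by
  unfold PHat; split_ifs <;> positivity

/-- For `k ≥ 1` the empirical transition probabilities have the sum `1` at visited pairs and are
`0` otherwise. -/
theorem sum_PHat {k : ℕ} (hk : 1 ≤ k) (h : ℕ) (s : S) (a : A) :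
    ∑ s', D.PHat k h s a s' = if D.count₂ k h s a = 0 then 0 else 1 := by
  have hk0 : k ≠ 0 := by omega
  have hcard : ∑ s', (((Finset.Icc 1 k).filter
      (fun τ => D.state τ h = s ∧ D.act₁ τ h = a ∧ D.state τ (h + 1) = s')).card) =
      D.count₂ k h s a := by
    rw [count₂, Finset.card_eq_sum_card_fiberwise (f := fun τ => D.state τ (h + 1))
      (t := Finset.univ) (fun _ _ => by simp)]
    refine Finset.sum_congr rfl fun s' _ => ?_
    rw [Finset.filter_filter]
    simp only [and_assoc]
  simp only [PHat, if_neg hk0]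
  rw [← Finset.sum_div, ← Nat.cast_sum, hcard]
  split_ifs with h0
  · simp [h0]
  · have h1 : (1 : ℝ) ≤ D.count₂ k h s a := by exact_mod_cast Nat.one_le_iff_ne_zero.2 h0
    rw [max_eq_left h1, div_self (by positivity)]

theorem sum_PHat_le {k : ℕ} (hk : 1 ≤ k) (h : ℕ) (s : S) (a : A) :
    ∑ s', D.PHat k h s a s' ≤ 1 := by
  rw [D.sum_PHat hk]; split_ifs <;> norm_num

theorem reach_mem (s₁ : S) {k : ℕ} (hk : 1 ≤ k) {μ : ℕ → S → A → ℝ} (hμ : IsPolicy μ) (h : ℕ) :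
    (∀ s, 0 ≤ D.reach s₁ k μ h s) ∧ ∑ s, D.reach s₁ k μ h s ≤ 1 := by
  induction h with
  | zero => exact ⟨fun s => by simp only [reach]; split_ifs <;> norm_num, by simp [reach]⟩
  | succ h ih =>
    refine ⟨fun s' => Finset.sum_nonneg fun s _ => Finset.sum_nonneg fun a _ =>
      mul_nonneg (mul_nonneg (ih.1 s) ((hμ h s).1 a)) (D.PHat_nonneg _ _ _ _ _), ?_⟩
    simp only [reach]
    rw [Finset.sum_comm]
    refine le_trans (Finset.sum_le_sum fun s _ => ?_) ih.2
    rw [Finset.sum_comm]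
    calc ∑ a, ∑ s', D.reach s₁ k μ h s * μ h s a * D.PHat k h s a s'
        ≤ ∑ a, D.reach s₁ k μ h s * μ h s a := by
          refine Finset.sum_le_sum fun a _ => ?_
          rw [← Finset.mul_sum]
          exact mul_le_of_le_one_right (mul_nonneg (ih.1 s) ((hμ h s).1 a))
            (D.sum_PHat_le hk h s a)
      _ = D.reach s₁ k μ h s := by rw [← Finset.mul_sum, (hμ h s).2, mul_one]

variable (s₁ : S) (η γ : ℝ)

theorem policies_mem [Nonempty A] [Nonempty B] (k : ℕ) :
    (IsPolicy (D.policies s₁ H K δ η γ k).1 ∧ ∀ h s a, 0 < (D.policies s₁ H K δ η γ k).1 h s a) ∧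
    (IsPolicy (D.policies s₁ H K δ η γ k).2 ∧
      ∀ h s b, 0 < (D.policies s₁ H K δ η γ k).2 h s b) := by
  induction k with
  | zero =>
    have hA : (0 : ℝ) < Fintype.card A := by exact_mod_cast Fintype.card_pos
    have hB : (0 : ℝ) < Fintype.card B := by exact_mod_cast Fintype.card_pos
    refine ⟨⟨fun h s => ⟨fun a => ?_, ?_⟩, fun h s a => ?_⟩,
      ⟨fun h s => ⟨fun b => ?_, ?_⟩, fun h s b => ?_⟩⟩ <;> simp [policies, Fintype.card_pos]
  | succ k ih =>
    exact ⟨⟨fun h s => (mirrorStep_mem η (ih.1.2 h s) _).1,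
      fun h s => (mirrorStep_mem η (ih.1.2 h s) _).2⟩,
      ⟨fun h s => (mirrorStep_mem γ (ih.2.2 h s) _).1,
      fun h s => (mirrorStep_mem γ (ih.2.2 h s) _).2⟩⟩

/-- All estimates of index `0` vanish, so the policies of the first episode are still uniform. -/
theorem policies_one [Nonempty A] [Nonempty B] :
    D.policies s₁ H K δ η γ 1 =
      (fun _ _ _ => 1 / (Fintype.card A : ℝ), fun _ _ _ => 1 / (Fintype.card B : ℝ)) := by
  have h0 := D.policies_mem H K δ s₁ η γ 0
  refine Prod.ext ?_ ?_
  · funext h s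
    change mirrorStep η _ (fun a => ∑ b, D.qBar H K δ 0 _ _ h s a b * _) = _
    simp only [qBar_zero, zero_mul, Finset.sum_const_zero]
    exact mirrorStep_zero (h0.1.1 h s).2 η
  · funext h s
    change mirrorStep γ _ (fun b => -(_ * ∑ a, D.rTilde H K δ 0 h s a b * _)) = _
    simp only [rTilde_zero, zero_mul, Finset.sum_const_zero, mul_zero, neg_zero]
    exact mirrorStep_zero (h0.2.1 h s).2 γ

/-! ### The regret when the estimates are accurate -/

/-- The sum of the two bonuses with the counts available before episode `k`. It dominates the
bonuses computed after episode `k` and, unlike these, does not depend on that episode. -/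
noncomputable def priorBonus (k h : ℕ) (s : S) (a : A) (b : B) : ℝ :=
  √(4 * Real.log ((Fintype.card S : ℝ) * Fintype.card A * Fintype.card B * H * K / δ) /
    max (D.count₃ (k - 1) h s a b : ℝ) 1) +
  √(2 * (H : ℝ) ^ 2 * Fintype.card S *
    Real.log ((Fintype.card S : ℝ) * Fintype.card A * H * K / δ) /
    max (D.count₂ (k - 1) h s a : ℝ) 1)

theorem priorBonus_nonneg (k h : ℕ) (s : S) (a : A) (b : B) :
    0 ≤ D.priorBonus H K δ k h s a b := by unfold priorBonus; positivity

theorem sqrt_div_max_anti {x m n : ℝ} (hmn : m ≤ n) : √(x / max n 1) ≤ √(x / max m 1) := by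
  have hm : 0 < max m 1 := by positivity
  rcases le_or_gt 0 x with hx | hx
  · exact Real.sqrt_le_sqrt (div_le_div_of_nonneg_left hx hm (max_le_max_right 1 hmn))
  · rw [Real.sqrt_eq_zero_of_nonpos (div_nonpos_of_nonpos_of_nonneg hx.le (by positivity))]
    positivity

theorem bonus_le_priorBonus (k h : ℕ) (s : S) (a : A) (b : B) :
    D.bonusR H K δ k h s a b + D.bonusP H K δ k h s a ≤ D.priorBonus H K δ k h s a b := by
  by_cases hk : k = 0
  · simp only [bonusR, bonusP, if_pos hk, add_zero]
    exact D.priorBonus_nonneg H K δ k h s a b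
  · simp only [bonusR, bonusP, if_neg hk, priorBonus]
    have hsub : Finset.Icc 1 (k - 1) ⊆ Finset.Icc 1 k := Finset.Icc_subset_Icc_right (by omega)
    refine add_le_add (sqrt_div_max_anti ?_) (sqrt_div_max_anti ?_)
    · exact_mod_cast Finset.card_le_card (Finset.filter_subset_filter _ hsub)
    · exact_mod_cast Finset.card_le_card (Finset.filter_subset_filter _ hsub)

/-- The empirical rewards are within their bonuses of the mean rewards. -/
def RewardsAccurate (D : Record S A B) (G : SCGame S A B) (K : ℕ) (δ : ℝ) : Prop :=
  ∀ k ∈ Finset.Icc 1 K, ∀ h < G.H, ∀ s a b,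
    |D.rHat k h s a b - G.r h s a b| ≤ D.bonusR G.H K δ k h s a b

/-- The empirical transition model is within `bonusP / H` of the true one on every set of states.
The last step is excluded, as no algorithm uses the transition out of it. -/
def TransitionsAccurate (D : Record S A B) (G : SCGame S A B) (K : ℕ) (δ : ℝ) : Prop :=
  ∀ k ∈ Finset.Icc 1 K, ∀ h, h + 1 < G.H → ∀ s a, ∀ U : Finset S,
    |∑ s' ∈ U, (D.PHat k h s a s' - G.P h s a s')| ≤ D.bonusP G.H K δ k h s a / G.H

end Record

section SignedMass

variable {X : Type*} [Fintype X]

theorem sum_abs_le_of_subset_sums {x : X → ℝ} {ε : ℝ} (hx : ∀ U : Finset X, |∑ i ∈ U, x i| ≤ ε) :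
    ∑ i, |x i| ≤ 2 * ε := by
  classical
  rw [← Finset.sum_filter_add_sum_filter_not Finset.univ (fun i => 0 ≤ x i)]
  have h1 := (abs_le.1 (hx (Finset.univ.filter fun i => 0 ≤ x i))).2
  have h2 := (abs_le.1 (hx (Finset.univ.filter fun i => ¬ 0 ≤ x i))).1
  rw [Finset.sum_congr rfl fun i hi => abs_of_nonneg (Finset.mem_filter.1 hi).2,
    Finset.sum_congr (g := fun i => - x i) rfl
      fun i hi => abs_of_neg (not_le.1 (Finset.mem_filter.1 hi).2), Finset.sum_neg_distrib]
  linarith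

theorem abs_sum_mul_le_of_subset_sums {x v : X → ℝ} {ε c : ℝ}
    (hx : ∀ U : Finset X, |∑ i ∈ U, x i| ≤ ε) (hv : ∀ i, 0 ≤ v i ∧ v i ≤ c) (hc : 0 ≤ c) :
    |∑ i, x i * v i| ≤ c * ε := by
  classical
  have h1 := (abs_le.1 (hx (Finset.univ.filter fun i => 0 ≤ x i))).2
  have h2 := (abs_le.1 (hx (Finset.univ.filter fun i => ¬ 0 ≤ x i))).1
  rw [Finset.sum_filter] at h1 h2
  refine abs_le.2 ⟨?_, ?_⟩
  · have := mul_le_mul_of_nonneg_left h2 hc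
    rw [Finset.mul_sum] at this
    refine le_trans (by linarith) (this.trans (Finset.sum_le_sum fun i _ => ?_))
    split_ifs with hi
    · nlinarith [mul_nonneg hi (hv i).1]
    · nlinarith [mul_le_mul_of_nonneg_left (hv i).2 (by linarith : 0 ≤ - x i)]
  · have := mul_le_mul_of_nonneg_left h1 hc
    rw [Finset.mul_sum] at this
    refine le_trans (Finset.sum_le_sum fun i _ => ?_) this
    split_ifs with hi
    · nlinarith [mul_le_mul_of_nonneg_left (hv i).2 hi]
    · nlinarith [mul_nonneg (by linarith : 0 ≤ - x i) (hv i).1]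

end SignedMass

namespace Record

variable {S A B : Type*} [Fintype S] [Fintype A] [Fintype B]
  [DecidableEq S] [DecidableEq A] [DecidableEq B]
  (D : Record S A B) (G : SCGame S A B) (K : ℕ) (δ : ℝ)

/-- The optimistic Q-function overestimates the Bellman update, by at most twice the bonuses. -/
theorem qBar_bounds (hR : D.RewardsAccurate G K δ) (hP : D.TransitionsAccurate G K δ)
    {μ : ℕ → S → A → ℝ} {ν : ℕ → S → B → ℝ} (hμ : IsPolicy μ) (hν : IsPolicy ν)
    {k : ℕ} (hk : k ∈ Finset.Icc 1 K) {h : ℕ} (hh : h < G.H) (s : S) (a : A) (b : B) :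
    G.r h s a b + ∑ s', G.P h s a s' * D.vBar G.H K δ k μ ν (G.H - (h + 1)) (h + 1) s' ≤
      D.qBar G.H K δ k μ ν h s a b ∧
    D.qBar G.H K δ k μ ν h s a b ≤
      G.r h s a b + ∑ s', G.P h s a s' * D.vBar G.H K δ k μ ν (G.H - (h + 1)) (h + 1) s' +
        2 * (D.bonusR G.H K δ k h s a b + D.bonusP G.H K δ k h s a) := by
  set n := G.H - (h + 1) with hn
  set V := D.vBar G.H K δ k μ ν n (h + 1) with hV
  have hVm : ∀ s', 0 ≤ V s' ∧ V s' ≤ n := D.vBar_mem G.H K δ k hμ hν n (h + 1)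
  have hr := abs_le.1 (hR k hk h hh s a b)
  have hPV : |∑ s', (D.PHat k h s a s' - G.P h s a s') * V s'| ≤ D.bonusP G.H K δ k h s a := by
    by_cases hlast : h + 1 < G.H
    · have hHpos : (0 : ℝ) < G.H := by exact_mod_cast G.H_pos
      have hnH : (n : ℝ) ≤ G.H := by exact_mod_cast (by omega : n ≤ G.H)
      have := abs_sum_mul_le_of_subset_sums (hP k hk h hlast s a)
        (fun s' => ⟨(hVm s').1, (hVm s').2.trans hnH⟩) hHpos.le
      rwa [mul_div_cancel₀ _ hHpos.ne'] at this
    · -- at the last step the next value function is `0`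
      have hn0 : n = 0 := by omega
      have hV0 : ∀ s', V s' = 0 := fun s' =>
        le_antisymm (by have := (hVm s').2; rwa [hn0, Nat.cast_zero] at this) (hVm s').1
      simp only [hV0, mul_zero, Finset.sum_const_zero, abs_zero]
      exact D.bonusP_nonneg _ _ _ _ _ _ _
  simp only [sub_mul, Finset.sum_sub_distrib] at hPV
  have hPV' := abs_le.1 hPV
  have hPn : ∑ s', G.P h s a s' * V s' ≤ n := by
    calc ∑ s', G.P h s a s' * V s' ≤ ∑ s', G.P h s a s' * n := Finset.sum_le_sum fun s' _ =>
          mul_le_mul_of_nonneg_left (hVm s').2 ((G.P_mem h s a).1 s')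
      _ = n := by rw [← Finset.sum_mul, (G.P_mem h s a).2, one_mul]
  have hP0 : 0 ≤ ∑ s', G.P h s a s' * V s' := Finset.sum_nonneg fun s' _ =>
    mul_nonneg ((G.P_mem h s a).1 s') (hVm s').1
  have hβR := D.bonusR_nonneg G.H K δ k h s a b
  have hβP := D.bonusP_nonneg G.H K δ k h s a
  have hrm := G.r_mem h s a b
  rw [qBar, qStep]
  constructor
  · refine le_max_of_le_left (le_min ?_ ?_)
    · linarith
    · linarith [hrm.2]
  · refine max_le (min_le_of_left_le ?_) ?_
    · linarith
    · linarith [hrm.1]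

theorem rTilde_bounds (hR : D.RewardsAccurate G K δ) {k : ℕ} (hk : k ∈ Finset.Icc 1 K) {h : ℕ}
    (hh : h < G.H) (s : S) (a : A) (b : B) :
    D.rTilde G.H K δ k h s a b ≤ G.r h s a b ∧
      G.r h s a b ≤ D.rTilde G.H K δ k h s a b + 2 * D.bonusR G.H K δ k h s a b := by
  have hr := abs_le.1 (hR k hk h hh s a b)
  refine ⟨max_le (by linarith) (G.r_mem h s a b).1, ?_⟩
  have : D.rHat k h s a b - D.bonusR G.H K δ k h s a b ≤ D.rTilde G.H K δ k h s a b :=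
    le_max_left _ _
  linarith

/-- The estimated state distribution is off by the errors of the transition model accumulated
along the true distribution. -/
theorem sum_abs_occ_sub_reach (hP : D.TransitionsAccurate G K δ)
    {μ : ℕ → S → A → ℝ} (hμ : IsPolicy μ) {k : ℕ} (hk : k ∈ Finset.Icc 1 K) (h : ℕ)
    (hh : h < G.H) :
    ∑ s, |G.occ μ h s - D.reach G.s₁ k μ h s| ≤
      ∑ j ∈ Finset.range h, ∑ s, ∑ a, G.occ μ j s * μ j s a *
        (2 * (D.bonusP G.H K δ k j s a / G.H)) := by
  induction h with
  | zero => simp [SCGame.occ, reach]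
  | succ h ih =>
    rw [Finset.sum_range_succ]
    have hstep : ∀ s', |G.occ μ (h + 1) s' - D.reach G.s₁ k μ (h + 1) s'| ≤
        ∑ s, ∑ a, (G.occ μ h s * μ h s a * |D.PHat k h s a s' - G.P h s a s'| +
          |G.occ μ h s - D.reach G.s₁ k μ h s| * μ h s a * D.PHat k h s a s') := by
      intro s'
      simp only [SCGame.occ, reach, ← Finset.sum_sub_distrib]
      refine (Finset.abs_sum_le_sum_abs _ _).trans (Finset.sum_le_sum fun s _ => ?_)
      refine (Finset.abs_sum_le_sum_abs _ _).trans (Finset.sum_le_sum fun a _ => ?_)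
      have ho := (G.occ_mem hμ h).1 s
      have hm := (hμ h s).1 a
      have hp := D.PHat_nonneg k h s a s'
      calc |G.occ μ h s * μ h s a * G.P h s a s' -
            D.reach G.s₁ k μ h s * μ h s a * D.PHat k h s a s'|
          = |-(G.occ μ h s * μ h s a * (D.PHat k h s a s' - G.P h s a s')) +
            (G.occ μ h s - D.reach G.s₁ k μ h s) * μ h s a * D.PHat k h s a s'| := by
            congr 1; ring
        _ ≤ _ := by
            refine (abs_add_le _ _).trans (le_of_eq ?_)
            rw [abs_neg, abs_mul, abs_mul, abs_mul, abs_mul, abs_of_nonneg ho, abs_of_nonneg hm,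
              abs_of_nonneg hp]
    refine (Finset.sum_le_sum fun s' _ => hstep s').trans ?_
    rw [Finset.sum_comm]
    simp only [Finset.sum_add_distrib]
    rw [add_comm]
    refine add_le_add (le_trans (Finset.sum_le_sum fun s _ => ?_) (ih (by omega))) ?_
    · rw [Finset.sum_comm]
      calc ∑ a, ∑ s', |G.occ μ h s - D.reach G.s₁ k μ h s| * μ h s a * D.PHat k h s a s'
          ≤ ∑ a, |G.occ μ h s - D.reach G.s₁ k μ h s| * μ h s a := by
            refine Finset.sum_le_sum fun a _ => ?_
            rw [← Finset.mul_sum]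
            exact mul_le_of_le_one_right (mul_nonneg (abs_nonneg _) ((hμ h s).1 a))
              (D.sum_PHat_le (Finset.mem_Icc.1 hk).1 h s a)
        _ = _ := by rw [← Finset.mul_sum, (hμ h s).2, mul_one]
    · refine Finset.sum_le_sum fun s _ => ?_
      rw [Finset.sum_comm]
      refine Finset.sum_le_sum fun a _ => ?_
      rw [← Finset.mul_sum]
      exact mul_le_mul_of_nonneg_left (sum_abs_le_of_subset_sums (hP k hk h hh s a))
        (mul_nonneg ((G.occ_mem hμ h).1 s) ((hμ h s).1 a))

/-- The difference of values of two policies of Player 1 splits into the gain measured by the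
optimistic Q-function and the expected bonuses. -/
theorem value_sub_value_le (hR : D.RewardsAccurate G K δ) (hP : D.TransitionsAccurate G K δ)
    {μ μ' : ℕ → S → A → ℝ} {ν : ℕ → S → B → ℝ} (hμ : IsPolicy μ) (hμ' : IsPolicy μ')
    (hν : IsPolicy ν) {k : ℕ} (hk : k ∈ Finset.Icc 1 K) :
    G.value μ' ν - G.value μ ν ≤
      ∑ h ∈ Finset.range G.H, ∑ s, G.occ μ' h s *
        ∑ a, (μ' h s a - μ h s a) * ∑ b, D.qBar G.H K δ k μ ν h s a b * ν h s b +
      2 * G.total μ ν (D.priorBonus G.H K δ k) := by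
  set V : ℕ → S → ℝ := fun h => D.vBar G.H K δ k μ ν (G.H - h) h with hV
  set Q := D.qBar G.H K δ k μ ν with hQ
  have hVH : ∀ s, V G.H s = 0 := fun s => by simp [hV, vBar]
  have hVQ : ∀ h < G.H, ∀ s, V h s = ∑ a, ∑ b, μ h s a * Q h s a b * ν h s b := by
    intro h hh s
    have : G.H - h = (G.H - (h + 1)) + 1 := by omega
    simp only [hV, this, vBar]
    rfl
  have hb := fun h (hh : h < G.H) s a b =>
    D.qBar_bounds G K δ hR hP hμ hν hk hh s a b
  have t1 := G.telescope (μ := μ') hν hVH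
  have t2 := G.telescope (μ := μ) hν hVH
  have e1 : ∑ h ∈ Finset.range G.H, ∑ s, G.occ μ h s * V h s = G.total μ ν Q := by
    refine Finset.sum_congr rfl fun h hh => Finset.sum_congr rfl fun s _ => ?_
    rw [hVQ h (Finset.mem_range.1 hh), Finset.mul_sum]
    simp only [Finset.mul_sum]
    exact Finset.sum_congr rfl fun a _ => Finset.sum_congr rfl fun b _ => by ring
  have e2 : ∑ h ∈ Finset.range G.H, ∑ s, G.occ μ' h s *
        ∑ a, (μ' h s a - μ h s a) * ∑ b, Q h s a b * ν h s b =
      G.total μ' ν Q - ∑ h ∈ Finset.range G.H, ∑ s, G.occ μ' h s * V h s := by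
    rw [SCGame.total, ← Finset.sum_sub_distrib]
    refine Finset.sum_congr rfl fun h hh => ?_
    rw [← Finset.sum_sub_distrib]
    refine Finset.sum_congr rfl fun s _ => ?_
    rw [hVQ h (Finset.mem_range.1 hh)]
    simp only [Finset.mul_sum, ← Finset.sum_sub_distrib]
    exact Finset.sum_congr rfl fun a _ => Finset.sum_congr rfl fun b _ => by ring
  have m1 : G.total μ' ν G.r + G.total μ' ν (fun h s a _ => ∑ s', G.P h s a s' * V (h + 1) s') ≤
      G.total μ' ν Q := by
    rw [← G.total_add]
    exact G.total_mono hμ' hν fun h hh s a b => (hb h hh s a b).1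
  have m2 : G.total μ ν Q ≤ G.total μ ν G.r +
      G.total μ ν (fun h s a _ => ∑ s', G.P h s a s' * V (h + 1) s') +
      2 * G.total μ ν (D.priorBonus G.H K δ k) := by
    rw [← G.total_add, ← G.total_smul, ← G.total_add]
    refine G.total_mono hμ hν fun h hh s a b => ((hb h hh s a b).2).trans ?_
    have := D.bonus_le_priorBonus G.H K δ k h s a b
    simp only [hV]
    linarith
  rw [G.value_eq_total hμ' hν, G.value_eq_total hμ hν, e2]
  linarith

/-- The difference of values of two policies of Player 2 splits into the loss measured by the
estimated state distribution and pessimistic rewards and the expected bonuses. -/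
theorem value_sub_value_le_right (hR : D.RewardsAccurate G K δ) (hP : D.TransitionsAccurate G K δ)
    {μ : ℕ → S → A → ℝ} {ν ν' : ℕ → S → B → ℝ} (hμ : IsPolicy μ) (hν : IsPolicy ν)
    (hν' : IsPolicy ν') {k : ℕ} (hk : k ∈ Finset.Icc 1 K) :
    G.value μ ν - G.value μ ν' ≤
      ∑ h ∈ Finset.range G.H, ∑ s, ∑ b, (ν' h s b - ν h s b) *
        (-(D.reach G.s₁ k μ h s * ∑ a, D.rTilde G.H K δ k h s a b * μ h s a)) +
      2 * G.total μ ν (D.priorBonus G.H K δ k) := by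
  set q := G.occ μ with hq
  set d := D.reach G.s₁ k μ with hd
  set r' := D.rTilde G.H K δ k with hr'
  set x : ℕ → S → ℝ := fun h s => ∑ b, (ν h s b - ν' h s b) * ∑ a, r' h s a b * μ h s a with hx
  have hb := fun h (hh : h < G.H) s a b => D.rTilde_bounds G K δ hR hk hh s a b
  have m1 : G.total μ ν G.r ≤ G.total μ ν r' + 2 * G.total μ ν (D.bonusR G.H K δ k) := by
    rw [← G.total_smul, ← G.total_add]
    exact G.total_mono hμ hν fun h hh s a b => (hb h hh s a b).2
  have m2 : G.total μ ν' r' ≤ G.total μ ν' G.r :=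
    G.total_mono hμ hν' fun h hh s a b => (hb h hh s a b).1
  have m3 : G.total μ ν (D.bonusR G.H K δ k) +
      G.total μ ν (fun h s a _ => D.bonusP G.H K δ k h s a) ≤
      G.total μ ν (D.priorBonus G.H K δ k) := by
    rw [← G.total_add]
    exact G.total_mono hμ hν fun h hh s a b => D.bonus_le_priorBonus G.H K δ k h s a b
  have e1 : G.total μ ν r' - G.total μ ν' r' = ∑ h ∈ Finset.range G.H, ∑ s, q h s * x h s := by
    rw [SCGame.total, SCGame.total, ← Finset.sum_sub_distrib]
    refine Finset.sum_congr rfl fun h hh => ?_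
    rw [← Finset.sum_sub_distrib]
    refine Finset.sum_congr rfl fun s _ => ?_
    simp only [hx, Finset.mul_sum, ← Finset.sum_sub_distrib]
    rw [Finset.sum_comm]
    exact Finset.sum_congr rfl fun b _ => Finset.sum_congr rfl fun a _ => by ring
  have e2 : ∑ h ∈ Finset.range G.H, ∑ s, ∑ b, (ν' h s b - ν h s b) *
        (-(d h s * ∑ a, r' h s a b * μ h s a)) =
      ∑ h ∈ Finset.range G.H, ∑ s, d h s * x h s := by
    refine Finset.sum_congr rfl fun h hh => Finset.sum_congr rfl fun s _ => ?_
    rw [hx, Finset.mul_sum]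
    refine Finset.sum_congr rfl fun b _ => by ring
  have hx1 : ∀ h < G.H, ∀ s, |x h s| ≤ 1 := by
    intro h hh s
    have hv : ∀ ν₀ : ℕ → S → B → ℝ, IsPolicy ν₀ →
        0 ≤ ∑ b, ∑ a, ν₀ h s b * r' h s a b * μ h s a ∧
        ∑ b, ∑ a, ν₀ h s b * r' h s a b * μ h s a ≤ 1 := fun ν₀ h₀ =>
      ⟨Finset.sum_nonneg fun b _ => Finset.sum_nonneg fun a _ => mul_nonneg (mul_nonneg
        ((h₀ h s).1 b) (D.rTilde_nonneg _ _ _ _ _ _ _ _)) ((hμ h s).1 a),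
      sum_policy_le (h₀ h s) (hμ h s) fun b a =>
        (hb h hh s a b).1.trans (G.r_mem h s a b).2⟩
    have : x h s = ∑ b, ∑ a, ν h s b * r' h s a b * μ h s a -
        ∑ b, ∑ a, ν' h s b * r' h s a b * μ h s a := by
      simp only [hx, Finset.mul_sum, ← Finset.sum_sub_distrib]
      exact Finset.sum_congr rfl fun b _ => Finset.sum_congr rfl fun a _ => by ring
    rw [this, abs_le]
    constructor <;> linarith [hv ν hν, hv ν' hν', (hv ν hν).1, (hv ν hν).2, (hv ν' hν').1,
      (hv ν' hν').2]
  have e3 : ∑ h ∈ Finset.range G.H, ∑ s, q h s * x h s ≤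
      ∑ h ∈ Finset.range G.H, ∑ s, d h s * x h s +
        ∑ h ∈ Finset.range G.H, ∑ s, |q h s - d h s| := by
    rw [← Finset.sum_add_distrib]
    refine Finset.sum_le_sum fun h hh => ?_
    rw [← Finset.sum_add_distrib]
    refine Finset.sum_le_sum fun s _ => ?_
    have h1 := hx1 h (Finset.mem_range.1 hh) s
    have h2 : (q h s - d h s) * x h s ≤ |q h s - d h s| * 1 :=
      (le_abs_self _).trans (by rw [abs_mul]; exact mul_le_mul_of_nonneg_left h1 (abs_nonneg _))
    linarith
  -- each of the `H` steps contributes at most the total transition error, which is `O(bonusP / H)`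
  have e4 : ∑ h ∈ Finset.range G.H, ∑ s, |q h s - d h s| ≤
      2 * G.total μ ν (fun h s a _ => D.bonusP G.H K δ k h s a) := by
    have hHpos : (0 : ℝ) < G.H := by exact_mod_cast G.H_pos
    set Y := ∑ j ∈ Finset.range G.H, ∑ s, ∑ a, G.occ μ j s * μ j s a *
        (2 * (D.bonusP G.H K δ k j s a / G.H)) with hY
    have hYt : G.H * Y = 2 * G.total μ ν (fun h s a _ => D.bonusP G.H K δ k h s a) := by
      rw [G.total_eq_of_right_const hν (fun h s a => D.bonusP G.H K δ k h s a), hY]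
      simp only [Finset.mul_sum]
      refine Finset.sum_congr rfl fun h _ => Finset.sum_congr rfl fun s _ =>
        Finset.sum_congr rfl fun a _ => ?_
      field_simp
    rw [← hYt]
    calc ∑ h ∈ Finset.range G.H, ∑ s, |q h s - d h s| ≤ ∑ h ∈ Finset.range G.H, Y := by
          refine Finset.sum_le_sum fun h hh => ?_
          refine (D.sum_abs_occ_sub_reach G K δ hP hμ hk h (Finset.mem_range.1 hh)).trans ?_
          refine Finset.sum_le_sum_of_subset_of_nonneg
            (Finset.range_subset_range.2 (Finset.mem_range.1 hh).le) fun j _ _ => ?_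
          refine Finset.sum_nonneg fun s _ => Finset.sum_nonneg fun a _ => ?_
          have h1 := (G.occ_mem hμ j).1 s
          have h2 := (hμ j s).1 a
          have h3 := D.bonusP_nonneg G.H K δ k j s a
          positivity
      _ = G.H * Y := by simp
  rw [G.value_eq_total hμ hν, G.value_eq_total hμ hν', e2]
  linarith

end Record

namespace Record

variable {S A B : Type*} [Fintype S] [Fintype A] [Fintype B]
  [DecidableEq S] [DecidableEq A] [DecidableEq B]
  (D : Record S A B) (G : SCGame S A B) {K : ℕ} {δ : ℝ}

/-- Mirror ascent of Player 1 at one step and state. -/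
theorem mirror_regret₁ [Nonempty A] [Nonempty B] (hK : 1 ≤ K) {η γ : ℝ}
    (hη : η = √(Real.log (Fintype.card A) / ((K : ℝ) * (G.H : ℝ) ^ 2)))
    {h : ℕ} (hh : h < G.H) (s : S) {p : A → ℝ} (hp : p ∈ stdSimplex ℝ A) :
    ∑ k ∈ Finset.Icc 1 K, ∑ a, (p a - (D.policies G.s₁ G.H K δ η γ k).1 h s a) *
        ∑ b, D.qBar G.H K δ k (D.policies G.s₁ G.H K δ η γ k).1
          (D.policies G.s₁ G.H K δ η γ k).2 h s a b * (D.policies G.s₁ G.H K δ η γ k).2 h s b ≤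
      3 / 2 * √((K : ℝ) * (G.H : ℝ) ^ 2 * Real.log (Fintype.card A)) := by
  have hHpos : (0 : ℝ) < G.H := by exact_mod_cast G.H_pos
  have hKpos : (0 : ℝ) < K := by exact_mod_cast hK
  have hN : 0 < (K : ℝ) * (G.H : ℝ) ^ 2 := by positivity
  set pol := D.policies G.s₁ G.H K δ η γ with hpol
  have hpm := D.policies_mem G.H K δ G.s₁ η γ
  set u : ℕ → A → ℝ := fun k a =>
    ∑ b, D.qBar G.H K δ k (pol k).1 (pol k).2 h s a b * (pol k).2 h s b with hu
  have hQH : ∀ k a b, D.qBar G.H K δ k (pol k).1 (pol k).2 h s a b ≤ G.H := by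
    intro k a b
    have h1 := D.qStep_le G.H K δ k (G.H - (h + 1)) h
      (D.vBar G.H K δ k (pol k).1 (pol k).2 (G.H - (h + 1)) (h + 1)) s a b
    refine h1.trans ?_
    exact_mod_cast (by omega : G.H - (h + 1) + 1 ≤ G.H)
  have hu0 : ∀ k a, 0 ≤ u k a := fun k a => Finset.sum_nonneg fun b _ =>
    mul_nonneg (D.qStep_nonneg _ _ _ _ _ _ _ _ _ _) (((hpm k).2.1 h s).1 b)
  have huH : ∀ k a, u k a ≤ G.H := by
    intro k a
    calc u k a ≤ ∑ b, (G.H : ℝ) * (pol k).2 h s b := Finset.sum_le_sum fun b _ =>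
          mul_le_mul_of_nonneg_right (hQH k a b) (((hpm k).2.1 h s).1 b)
      _ = G.H := by rw [← Finset.mul_sum, ((hpm k).2.1 h s).2, mul_one]
  have main := mirror_regret_tuned hN hη (w := fun k => (pol k).1 h s) (u := u)
    (by simp only [hpol, D.policies_one]) (fun k _ => rfl) (fun k _ => huH k) hp K
  refine main.trans ?_
  have hη0 : 0 ≤ η := by rw [hη]; positivity
  have h2 : ∑ k ∈ Finset.Icc 1 K, ∑ a, (pol k).1 h s a * ((G.H : ℝ) - u k a) ^ 2 ≤
      K * (G.H : ℝ) ^ 2 := by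
    calc _ ≤ ∑ k ∈ Finset.Icc 1 K, ((G.H : ℝ)) ^ 2 := by
          refine Finset.sum_le_sum fun k _ => ?_
          calc ∑ a, (pol k).1 h s a * ((G.H : ℝ) - u k a) ^ 2
              ≤ ∑ a, (pol k).1 h s a * (G.H : ℝ) ^ 2 := Finset.sum_le_sum fun a _ =>
                mul_le_mul_of_nonneg_left
                  (pow_le_pow_left₀ (by linarith [huH k a]) (by linarith [hu0 k a]) 2)
                  (((hpm k).1.1 h s).1 a)
            _ = _ := by rw [← Finset.sum_mul, ((hpm k).1.1 h s).2, one_mul]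
      _ = _ := by simp
  have h3 : η * (K * (G.H : ℝ) ^ 2) = √((K : ℝ) * (G.H : ℝ) ^ 2 * Real.log (Fintype.card A)) := by
    have hl : 0 ≤ Real.log (Fintype.card A) := Real.log_natCast_nonneg _
    rw [hη, ← Real.sqrt_sq hN.le, ← Real.sqrt_mul (by positivity), Real.sqrt_sq hN.le]
    congr 1
    field_simp
  nlinarith [mul_le_mul_of_nonneg_left h2 hη0]

/-- Mirror descent of Player 2 at one step, summed over the states. The squared losses are weighted
by the squared reaching probabilities, whose sum over the states is at most `1`. -/
theorem mirror_regret₂ [Nonempty A] [Nonempty B] (hK : 1 ≤ K) {η γ : ℝ}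
    (hγ : γ = √((Fintype.card S : ℝ) * Real.log (Fintype.card B) / (K : ℝ)))
    (hR : D.RewardsAccurate G K δ)
    {h : ℕ} (hh : h < G.H) {p : S → B → ℝ} (hp : ∀ s, p s ∈ stdSimplex ℝ B) :
    ∑ s, ∑ k ∈ Finset.Icc 1 K, ∑ b, (p s b - (D.policies G.s₁ G.H K δ η γ k).2 h s b) *
        (-(D.reach G.s₁ k (D.policies G.s₁ G.H K δ η γ k).1 h s *
          ∑ a, D.rTilde G.H K δ k h s a b * (D.policies G.s₁ G.H K δ η γ k).1 h s a)) ≤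
      3 / 2 * √((Fintype.card S : ℝ) * K * Real.log (Fintype.card B)) := by
  have hKpos : (0 : ℝ) < K := by exact_mod_cast hK
  have hSpos : (0 : ℝ) < Fintype.card S := by
    exact_mod_cast Fintype.card_pos_iff.2 ⟨G.s₁⟩
  have hl : 0 ≤ Real.log (Fintype.card B) := Real.log_natCast_nonneg _
  have hN : 0 < (K : ℝ) / Fintype.card S := by positivity
  set pol := D.policies G.s₁ G.H K δ η γ with hpol
  have hpm := D.policies_mem G.H K δ G.s₁ η γ
  -- at every state, `γ` is the step size tuned to a second-order sum of `K / |S|`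
  have hγ' : γ = √(Real.log (Fintype.card B) / ((K : ℝ) / Fintype.card S)) := by
    rw [hγ]; congr 1; field_simp
  have hγ0 : 0 ≤ γ := by rw [hγ]; positivity
  set d : ℕ → S → ℝ := fun k s => D.reach G.s₁ k (pol k).1 h s with hd
  set ℓ : S → ℕ → B → ℝ := fun s k b =>
    ∑ a, D.rTilde G.H K δ k h s a b * (pol k).1 h s a with hℓ
  have hℓ0 : ∀ s k b, 0 ≤ ℓ s k b := fun s k b => Finset.sum_nonneg fun a _ =>
    mul_nonneg (D.rTilde_nonneg _ _ _ _ _ _ _ _) (((hpm k).1.1 h s).1 a)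
  have hℓ1 : ∀ s, ∀ k ∈ Finset.Icc 1 K, ∀ b, ℓ s k b ≤ 1 := by
    intro s k hk b
    calc ℓ s k b ≤ ∑ a, 1 * (pol k).1 h s a := Finset.sum_le_sum fun a _ =>
          mul_le_mul_of_nonneg_right ((D.rTilde_bounds G K δ hR hk hh s a b).1.trans
            (G.r_mem h s a b).2) (((hpm k).1.1 h s).1 a)
      _ = 1 := by rw [← Finset.mul_sum, ((hpm k).1.1 h s).2, mul_one]
  have hd0 : ∀ k, 1 ≤ k → (∀ s, 0 ≤ d k s) ∧ ∑ s, d k s ≤ 1 := fun k hk =>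
    D.reach_mem G.s₁ hk (hpm k).1.1 h
  have main : ∀ s, ∑ k ∈ Finset.Icc 1 K, ∑ b, (p s b - (pol k).2 h s b) * (-(d k s * ℓ s k b)) ≤
      √((K : ℝ) / Fintype.card S * Real.log (Fintype.card B)) +
        γ / 2 * ∑ k ∈ Finset.Icc 1 K, d k s := by
    intro s
    have := mirror_regret_tuned (c := 0) hN hγ' (w := fun k => (pol k).2 h s)
      (u := fun k b => -(d k s * ℓ s k b))
      (by simp only [hpol, D.policies_one]) (fun k _ => rfl)
      (fun k hk b => neg_nonpos.2 (mul_nonneg ((hd0 k hk).1 s) (hℓ0 s k b))) (hp s) K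
    refine this.trans (add_le_add le_rfl (mul_le_mul_of_nonneg_left ?_ (by positivity)))
    refine Finset.sum_le_sum fun k hk => ?_
    have hk1 := (Finset.mem_Icc.1 hk).1
    have hdk := (hd0 k hk1).1 s
    have hdk1 : d k s ≤ 1 :=
      (Finset.single_le_sum (fun s _ => (hd0 k hk1).1 s) (Finset.mem_univ s)).trans (hd0 k hk1).2
    calc ∑ b, (pol k).2 h s b * (0 - -(d k s * ℓ s k b)) ^ 2
        ≤ ∑ b, (pol k).2 h s b * d k s := by
          refine Finset.sum_le_sum fun b _ =>
            mul_le_mul_of_nonneg_left ?_ (((hpm k).2.1 h s).1 b)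
          have e1 : d k s * ℓ s k b ≤ d k s := mul_le_of_le_one_right hdk (hℓ1 s k hk b)
          have e2 : 0 ≤ d k s * ℓ s k b := mul_nonneg hdk (hℓ0 s k b)
          nlinarith
      _ = d k s := by rw [← Finset.sum_mul, ((hpm k).2.1 h s).2, one_mul]
  refine (Finset.sum_le_sum fun s _ => main s).trans ?_
  rw [Finset.sum_add_distrib, ← Finset.mul_sum, Finset.sum_comm]
  have h1 : ∑ k ∈ Finset.Icc 1 K, ∑ s, d k s ≤ K := by
    calc _ ≤ ∑ k ∈ Finset.Icc 1 K, (1 : ℝ) :=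
          Finset.sum_le_sum fun k hk => (hd0 k (Finset.mem_Icc.1 hk).1).2
      _ = K := by simp
  have h2 : ∑ _s : S, √((K : ℝ) / Fintype.card S * Real.log (Fintype.card B)) =
      √((Fintype.card S : ℝ) * K * Real.log (Fintype.card B)) := by
    rw [Finset.sum_const, Finset.card_univ, nsmul_eq_mul]
    conv_lhs => rw [← Real.sqrt_sq hSpos.le]
    rw [← Real.sqrt_mul (by positivity), Real.sqrt_sq hSpos.le]
    congr 1
    field_simp
  have h3 : γ * K = √((Fintype.card S : ℝ) * K * Real.log (Fintype.card B)) := by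
    rw [hγ]
    conv_lhs => rw [← Real.sqrt_sq hKpos.le]
    rw [← Real.sqrt_mul (by positivity), Real.sqrt_sq hKpos.le]
    congr 1
    field_simp
  rw [h2]
  nlinarith [mul_le_mul_of_nonneg_left h1 hγ0]

/-- When the estimates are accurate, the gap is the sum of the mirror descent regrets and a multiple
of the expected bonuses under the policies played. -/
theorem gap_le_of_accurate [Nonempty A] [Nonempty B] (hK : 1 ≤ K) {η γ : ℝ}
    (hη : η = √(Real.log (Fintype.card A) / ((K : ℝ) * (G.H : ℝ) ^ 2)))
    (hγ : γ = √((Fintype.card S : ℝ) * Real.log (Fintype.card B) / (K : ℝ)))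
    (hR : D.RewardsAccurate G K δ) (hP : D.TransitionsAccurate G K δ) :
    G.gap K (fun k => (D.policies G.s₁ G.H K δ η γ k).1)
        (fun k => (D.policies G.s₁ G.H K δ η γ k).2) ≤
      G.H * (3 / 2 * √((K : ℝ) * (G.H : ℝ) ^ 2 * Real.log (Fintype.card A))) +
      G.H * (3 / 2 * √((Fintype.card S : ℝ) * K * Real.log (Fintype.card B))) +
      4 * ∑ k ∈ Finset.Icc 1 K, G.total (D.policies G.s₁ G.H K δ η γ k).1
        (D.policies G.s₁ G.H K δ η γ k).2 (D.priorBonus G.H K δ k) := by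
  set pol := D.policies G.s₁ G.H K δ η γ with hpol
  have hpm := D.policies_mem G.H K δ G.s₁ η γ
  have hne1 : Nonempty {μ : ℕ → S → A → ℝ // IsPolicy μ} := ⟨⟨_, (hpm 0).1.1⟩⟩
  have hne2 : Nonempty {ν : ℕ → S → B → ℝ // IsPolicy ν} := ⟨⟨_, (hpm 0).2.1⟩⟩
  set Y := ∑ k ∈ Finset.Icc 1 K, G.total (pol k).1 (pol k).2 (D.priorBonus G.H K δ k) with hY
  have r1 : G.regret₁ K (fun k => (pol k).1) (fun k => (pol k).2) ≤
      G.H * (3 / 2 * √((K : ℝ) * (G.H : ℝ) ^ 2 * Real.log (Fintype.card A))) + 2 * Y := by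
    refine ciSup_le fun ⟨μ, hμ⟩ => ?_
    refine (Finset.sum_le_sum fun k hk => D.value_sub_value_le G K δ hR hP (hpm k).1.1 hμ
      (hpm k).2.1 hk).trans ?_
    rw [Finset.sum_add_distrib, ← Finset.mul_sum, ← hY]
    refine add_le_add ?_ le_rfl
    rw [Finset.sum_comm]
    refine (Finset.sum_le_sum fun h hh => ?_).trans (le_of_eq (a := ∑ h ∈ Finset.range G.H,
      3 / 2 * √((K : ℝ) * (G.H : ℝ) ^ 2 * Real.log (Fintype.card A))) (by simp))
    rw [Finset.sum_comm]
    simp only [← Finset.mul_sum]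
    calc _ ≤ ∑ s, G.occ μ h s *
          (3 / 2 * √((K : ℝ) * (G.H : ℝ) ^ 2 * Real.log (Fintype.card A))) := by
          refine Finset.sum_le_sum fun s _ =>
            mul_le_mul_of_nonneg_left ?_ ((G.occ_mem hμ h).1 s)
          exact D.mirror_regret₁ G hK hη (Finset.mem_range.1 hh) s (hμ h s)
      _ = _ := by rw [← Finset.sum_mul, (G.occ_mem hμ h).2, one_mul]
  have r2 : G.regret₂ K (fun k => (pol k).1) (fun k => (pol k).2) ≤
      G.H * (3 / 2 * √((Fintype.card S : ℝ) * K * Real.log (Fintype.card B))) + 2 * Y := by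
    refine ciSup_le fun ⟨ν, hν⟩ => ?_
    refine (Finset.sum_le_sum fun k hk => D.value_sub_value_le_right G K δ hR hP (hpm k).1.1
      (hpm k).2.1 hν hk).trans ?_
    rw [Finset.sum_add_distrib, ← Finset.mul_sum, ← hY]
    refine add_le_add ?_ le_rfl
    rw [Finset.sum_comm]
    refine (Finset.sum_le_sum fun h hh => ?_).trans (le_of_eq (a := ∑ h ∈ Finset.range G.H,
      3 / 2 * √((Fintype.card S : ℝ) * K * Real.log (Fintype.card B))) (by simp))
    rw [Finset.sum_comm]
    exact D.mirror_regret₂ G hK hγ hR (Finset.mem_range.1 hh) (hν h)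
  rw [SCGame.gap]
  linarith

end Record

/-! ### The sum of the bonuses along the play -/

/-- A sum of inverse square roots of running visit counts, started with the count before the
visit, is bounded by the square roots of the final counts. -/
theorem sum_inv_sqrt_count_le {X : Type*} [Fintype X] [DecidableEq X] (x : ℕ → X) (K : ℕ) :
    ∑ k ∈ Finset.Icc 1 K,
        1 / √(max ((((Finset.Icc 1 (k - 1)).filter fun τ => x τ = x k).card : ℕ) : ℝ) 1) ≤
      3 * √((Fintype.card X : ℝ) * K) := by
  set N : ℕ → X → ℕ := fun k y => ((Finset.Icc 1 k).filter fun τ => x τ = y).card with hN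
  have hsucc : ∀ k y, N (k + 1) y = N k y + if x (k + 1) = y then 1 else 0 := by
    intro k y
    simp only [hN, Finset.card_filter]
    rw [Finset.sum_Icc_succ_top (by omega)]
  have hsqrt : ∀ n : ℕ, 3 * √(n : ℝ) + 1 / √(max (n : ℝ) 1) ≤ 3 * √((n + 1 : ℕ) : ℝ) := by
    intro n
    rcases Nat.eq_zero_or_pos n with rfl | hn
    · norm_num
    · have hn1 : (1 : ℝ) ≤ n := by exact_mod_cast hn
      rw [max_eq_left hn1]
      push_cast
      have hs : 0 < √(n : ℝ) := Real.sqrt_pos.2 (by linarith)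
      have h1 : √(n : ℝ) ^ 2 = n := Real.sq_sqrt (by linarith)
      have h2 : √((n : ℝ) + 1) ^ 2 = n + 1 := Real.sq_sqrt (by linarith)
      have h3 : √((n : ℝ) + 1) ≤ 2 * √(n : ℝ) := by
        rw [Real.sqrt_le_left (by positivity)]
        nlinarith
      have h4 : √(n : ℝ) ≤ √((n : ℝ) + 1) := Real.sqrt_le_sqrt (by linarith)
      rw [← sub_nonneg]
      have : 3 * √((n : ℝ) + 1) - (3 * √(n : ℝ) + 1 / √(n : ℝ)) =
          (3 * √(n : ℝ) * (√((n : ℝ) + 1) - √(n : ℝ)) - 1) / √(n : ℝ) := by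
        field_simp
        ring
      rw [this]
      refine div_nonneg ?_ hs.le
      nlinarith
  have h1 : ∀ K, ∑ k ∈ Finset.Icc 1 K, 1 / √(max ((N (k - 1) (x k) : ℕ) : ℝ) 1) ≤
      ∑ y, 3 * √((N K y : ℕ) : ℝ) := by
    intro K
    induction K with
    | zero => simp [hN]
    | succ K ih =>
      rw [Finset.sum_Icc_succ_top (by omega), Nat.add_sub_cancel]
      have hother : ∀ y ∈ Finset.univ.erase (x (K + 1)),
          3 * √((N (K + 1) y : ℕ) : ℝ) = 3 * √((N K y : ℕ) : ℝ) := by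
        intro y hy
        rw [hsucc, if_neg (Finset.ne_of_mem_erase hy).symm, add_zero]
      rw [← Finset.add_sum_erase _ _ (Finset.mem_univ (x (K + 1))), Finset.sum_congr rfl hother,
        hsucc, if_pos rfl]
      rw [← Finset.add_sum_erase _ _ (Finset.mem_univ (x (K + 1)))] at ih
      have := hsqrt (N K (x (K + 1)))
      linarith
  have h2 : ∑ y, N K y = K := by
    have := Finset.card_eq_sum_card_fiberwise (s := Finset.Icc 1 K) (f := x)
      (t := Finset.univ) (fun _ _ => by simp)
    rw [Nat.card_Icc, Nat.add_sub_cancel] at this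
    exact this.symm
  refine (h1 K).trans ?_
  rw [← Finset.mul_sum]
  refine mul_le_mul_of_nonneg_left (Real.le_sqrt_of_sq_le ?_) (by norm_num)
  have h3 := sq_sum_le_card_mul_sum_sq (s := (Finset.univ : Finset X))
    (f := fun y => √((N K y : ℕ) : ℝ))
  refine h3.trans (le_of_eq ?_)
  simp only [Real.sq_sqrt (Nat.cast_nonneg _)]
  rw [← Nat.cast_sum, h2, Finset.card_univ]

namespace Record

variable {S A B : Type*} [Fintype S] [Fintype A] [Fintype B]
  [DecidableEq S] [DecidableEq A] [DecidableEq B]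
  (D : Record S A B)

theorem sum_priorBonus_le (H K : ℕ) (δ : ℝ)
    (hL : 0 ≤ Real.log ((Fintype.card S : ℝ) * Fintype.card A * Fintype.card B * H * K / δ))
    (hL' : 0 ≤ Real.log ((Fintype.card S : ℝ) * Fintype.card A * H * K / δ)) :
    ∑ k ∈ Finset.Icc 1 K, ∑ h ∈ Finset.range H,
        D.priorBonus H K δ k h (D.state k h) (D.act₁ k h) (D.act₂ k h) ≤
      H * (√(4 * Real.log ((Fintype.card S : ℝ) * Fintype.card A * Fintype.card B * H * K / δ)) *
          (3 * √((Fintype.card S : ℝ) * Fintype.card A * Fintype.card B * K)) +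
        √(2 * (H : ℝ) ^ 2 * Fintype.card S *
          Real.log ((Fintype.card S : ℝ) * Fintype.card A * H * K / δ)) *
          (3 * √((Fintype.card S : ℝ) * Fintype.card A * K))) := by
  rw [Finset.sum_comm]
  refine (Finset.sum_le_sum fun h _ => ?_).trans (le_of_eq (by
    rw [Finset.sum_const, Finset.card_range, nsmul_eq_mul]))
  simp only [priorBonus]
  rw [Finset.sum_add_distrib]
  have e1 := sum_inv_sqrt_count_le (fun k => (D.state k h, D.act₁ k h, D.act₂ k h)) K
  have e2 := sum_inv_sqrt_count_le (fun k => (D.state k h, D.act₁ k h)) K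
  simp only [Prod.mk.injEq, Fintype.card_prod, Nat.cast_mul, ← mul_assoc] at e1 e2
  refine add_le_add ?_ ?_
  · simp only [Real.sqrt_div (by positivity :
      0 ≤ 4 * Real.log ((Fintype.card S : ℝ) * Fintype.card A * Fintype.card B * H * K / δ))]
    refine le_trans (le_of_eq ?_) (mul_le_mul_of_nonneg_left e1 (Real.sqrt_nonneg _))
    rw [Finset.mul_sum]
    exact Finset.sum_congr rfl fun k _ => (mul_one_div _ _).symm
  · simp only [Real.sqrt_div (by positivity : 0 ≤ 2 * (H : ℝ) ^ 2 * Fintype.card S *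
          Real.log ((Fintype.card S : ℝ) * Fintype.card A * H * K / δ))]
    refine le_trans (le_of_eq ?_) (mul_le_mul_of_nonneg_left e2 (Real.sqrt_nonneg _))
    rw [Finset.mul_sum]
    exact Finset.sum_congr rfl fun k _ => (mul_one_div _ _).symm

end Record

/-! ### Exponential supermartingales -/

section Concentration

open MeasureTheory

theorem measurable_indicator_one {Ω : Type*} {m : MeasurableSpace Ω} {E : Set Ω}
    (hE : MeasurableSet E) : Measurable fun ω => E.indicator (1 : Ω → ℝ) ω :=
  measurable_one.indicator hE

theorem measurableSet_lt_of_measurable {Ω : Type*} {m : MeasurableSpace Ω} {f : Ω → ℝ}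
    (hf : Measurable f) (c : ℝ) : MeasurableSet {ω | f ω < c} :=
  measurableSet_lt hf measurable_const

theorem indicator_one_eq_zero_or_one {Ω : Type*} (E : Set Ω) (ω : Ω) :
    E.indicator (1 : Ω → ℝ) ω = 0 ∨ E.indicator (1 : Ω → ℝ) ω = 1 := by
  by_cases h : ω ∈ E
  · exact Or.inr (Set.indicator_of_mem h _)
  · exact Or.inl (Set.indicator_of_notMem h _)

theorem abs_indicator_one_le {Ω : Type*} (E : Set Ω) (ω : Ω) :
    |E.indicator (1 : Ω → ℝ) ω| ≤ 1 := by
  rcases indicator_one_eq_zero_or_one E ω with h | h <;> simp [h]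

variable {Ω : Type*} {mΩ : MeasurableSpace Ω} {ℙ : Measure Ω} [IsProbabilityMeasure ℙ]

theorem integrable_of_abs_le {f : Ω → ℝ} (hf : Measurable f) {C : ℝ} (hC : ∀ ω, |f ω| ≤ C) :
    Integrable f ℙ :=
  Integrable.of_bound hf.aestronglyMeasurable C (Filter.Eventually.of_forall hC)

/-- The defining property of the conditional expectation, tested against bounded functions. -/
theorem integral_mul_of_condExp {𝒢 : MeasurableSpace Ω} (h𝒢 : 𝒢 ≤ mΩ) {f f' g : Ω → ℝ}
    (hf : Integrable f ℙ) (hff' : condExp 𝒢 ℙ f =ᵐ[ℙ] f') (hg : Measurable[𝒢] g) {C : ℝ}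
    (hC : ∀ ω, |g ω| ≤ C) : ∫ ω, g ω * f ω ∂ℙ = ∫ ω, g ω * f' ω ∂ℙ := by
  have hgf : Integrable (g * f) ℙ :=
    hf.bdd_mul (hg.mono h𝒢 le_rfl).aestronglyMeasurable (Filter.Eventually.of_forall hC)
  have h1 := condExp_mul_of_stronglyMeasurable_left (m := 𝒢) hg.stronglyMeasurable hgf hf
  calc ∫ ω, g ω * f ω ∂ℙ = ∫ ω, (condExp 𝒢 ℙ (g * f)) ω ∂ℙ := (integral_condExp h𝒢).symm
    _ = ∫ ω, g ω * f' ω ∂ℙ := by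
      refine integral_congr_ae ?_
      filter_upwards [h1, hff'] with ω h2 h3
      rw [h2, Pi.mul_apply, h3]

/-- The chord of the exponential function on `[-t, t]`. -/
theorem exp_mul_le_of_abs_le_one (t : ℝ) {z : ℝ} (hz : |z| ≤ 1) :
    Real.exp (t * z) ≤ Real.cosh t + Real.sinh t * z := by
  have hz' := abs_le.1 hz
  have h := convexOn_exp.2 (Set.mem_univ t) (Set.mem_univ (-t))
    (by linarith : (0 : ℝ) ≤ (1 + z) / 2) (by linarith : (0 : ℝ) ≤ (1 - z) / 2) (by ring)
  simp only [smul_eq_mul] at h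
  have e1 : (1 + z) / 2 * t + (1 - z) / 2 * -t = t * z := by ring
  rw [e1] at h
  rw [Real.cosh_eq, Real.sinh_eq]
  linarith

theorem measureReal_exp_markov {T : Ω → ℝ} (hT : Integrable (fun ω => Real.exp (T ω)) ℙ)
    (h1 : ∫ ω, Real.exp (T ω) ∂ℙ ≤ 1) (x : ℝ) : ℙ.real {ω | x ≤ T ω} ≤ Real.exp (-x) := by
  have h := mul_meas_ge_le_integral_of_nonneg
    (Filter.Eventually.of_forall fun ω => (Real.exp_pos (T ω)).le) hT (Real.exp x)
  have h2 : {ω | Real.exp x ≤ Real.exp (T ω)} = {ω | x ≤ T ω} := by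
    ext ω; simp
  rw [h2] at h
  rw [Real.exp_neg, ← one_div, le_div_iff₀ (Real.exp_pos x)]
  linarith

/-- Hoeffding's inequality for a random number of visits: `E k` is the event that the visit takes
place at time `k`, with a centred outcome `Z k ∈ [-1, 1]` given `𝒢 k`. The visits after the `n`-th
are discarded, which makes the deviation at any time with exactly `n` visits a deviation at the
final time `K`; no maximal inequality is needed. -/
theorem visits_concentration (K : ℕ) (n : ℝ) {ε : ℝ} (hε : 0 ≤ ε) (E : ℕ → Set Ω) (Z : ℕ → Ω → ℝ)
    (𝒢 : ℕ → MeasurableSpace Ω) (h𝒢 : ∀ k, 𝒢 k ≤ mΩ)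
    (hE : ∀ j k, 1 ≤ j → j ≤ k → k ≤ K → MeasurableSet[𝒢 k] (E j))
    (hZ : ∀ j k, 1 ≤ j → j < k → k ≤ K → Measurable[𝒢 k] (Z j))
    (hZm : ∀ k, 1 ≤ k → k ≤ K → Measurable (Z k)) (hZ1 : ∀ k ω, |Z k ω| ≤ 1)
    (hmean : ∀ k, 1 ≤ k → k ≤ K → ∀ g : Ω → ℝ, Measurable[𝒢 k] g → ∀ C, (∀ ω, |g ω| ≤ C) →
      ∫ ω, (g ω * (E k).indicator 1 ω) * Z k ω ∂ℙ = 0) :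
    ℙ.real {ω | ∃ k ∈ Finset.Icc 1 K, ∑ j ∈ Finset.Icc 1 k, (E j).indicator (1 : Ω → ℝ) ω = n ∧
      n * ε ≤ ∑ j ∈ Finset.Icc 1 k, (E j).indicator (1 : Ω → ℝ) ω * Z j ω} ≤
      Real.exp (-(n * ε ^ 2 / 2)) := by
  set N : ℕ → Ω → ℝ := fun k ω => ∑ j ∈ Finset.Icc 1 k, (E j).indicator (1 : Ω → ℝ) ω with hN
  have hNsucc : ∀ k ω, N (k + 1) ω = N k ω + (E (k + 1)).indicator (1 : Ω → ℝ) ω := fun k ω => by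
    simp only [hN]; rw [Finset.sum_Icc_succ_top (by omega)]
  have hind : ∀ k ω, 0 ≤ (E k).indicator (1 : Ω → ℝ) ω := fun k ω =>
    Set.indicator_nonneg (fun _ _ => zero_le_one) ω
  have hNmono : ∀ ω, Monotone fun k => N k ω := fun ω => monotone_nat_of_le_succ fun k => by
    rw [hNsucc]; linarith [hind (k + 1) ω]
  -- `W k` indicates a visit at time `k` that is among the first `n` ones
  set W : ℕ → Ω → ℝ := fun k ω => {ω | N (k - 1) ω < n}.indicator (1 : Ω → ℝ) ω *
    (E k).indicator (1 : Ω → ℝ) ω with hW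
  have hW01 : ∀ k ω, W k ω = 0 ∨ W k ω = 1 := by
    intro k ω
    simp only [hW]
    rcases indicator_one_eq_zero_or_one {ω | N (k - 1) ω < n} ω with h | h <;>
      rcases indicator_one_eq_zero_or_one (E k) ω with h' | h' <;> simp only [h, h'] <;> simp
  set T : ℕ → Ω → ℝ := fun k ω =>
    ∑ j ∈ Finset.Icc 1 k, W j ω * (ε * Z j ω - ε ^ 2 / 2) with hT
  have hTsucc : ∀ k ω, T (k + 1) ω = T k ω + W (k + 1) ω * (ε * Z (k + 1) ω - ε ^ 2 / 2) :=
    fun k ω => by simp only [hT]; rw [Finset.sum_Icc_succ_top (by omega)]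
  have hNmeas : ∀ k m, k ≤ m → m ≤ K → Measurable[𝒢 m] (N k) := by
    intro k m hkm hm
    refine Finset.measurable_fun_sum _ fun j hj => ?_
    have hj' := Finset.mem_Icc.1 hj
    exact measurable_indicator_one (hE j m hj'.1 (by omega) hm)
  have hWmeas : ∀ k m, 1 ≤ k → k ≤ m → m ≤ K → Measurable[𝒢 m] (W k) := by
    intro k m hk hkm hm
    exact Measurable.mul (measurable_indicator_one
      (measurableSet_lt_of_measurable (hNmeas (k - 1) m (by omega) hm) n))
      (measurable_indicator_one (hE k m hk hkm hm))
  have hTmeas : ∀ k m, k < m → m ≤ K → Measurable[𝒢 m] (T k) := by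
    intro k m hkm hm
    refine Finset.measurable_fun_sum _ fun j hj => ?_
    have hj' := Finset.mem_Icc.1 hj
    exact (hWmeas j m hj'.1 (by omega) hm).mul
      (((hZ j m hj'.1 (by omega) hm).const_mul ε).sub_const _)
  have hTmeas' : ∀ k, k ≤ K → Measurable (T k) := by
    intro k hk
    refine Finset.measurable_fun_sum _ fun j hj => ?_
    have hj' := Finset.mem_Icc.1 hj
    exact ((hWmeas j j hj'.1 le_rfl (by omega)).mono (h𝒢 j) le_rfl).mul
      (((hZm j hj'.1 (by omega)).const_mul ε).sub_const _)
  have hTb : ∀ k ω, T k ω ≤ k * ε := by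
    intro k ω
    induction k with
    | zero => simp [hT]
    | succ k ih =>
      rw [hTsucc]
      push_cast
      have hz := (abs_le.1 (hZ1 (k + 1) ω)).2
      rcases hW01 (k + 1) ω with h | h <;> rw [h] <;> nlinarith [mul_le_mul_of_nonneg_left hz hε]
  have hexpb : ∀ k ω, |Real.exp (T k ω)| ≤ Real.exp (k * ε) := fun k ω => by
    rw [abs_of_pos (Real.exp_pos _)]; exact Real.exp_le_exp.2 (hTb k ω)
  have hint : ∀ k, k ≤ K → Integrable (fun ω => Real.exp (T k ω)) ℙ := fun k hk =>
    integrable_of_abs_le (hTmeas' k hk).exp (hexpb k)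
  have hsuper : ∀ k, k ≤ K → ∫ ω, Real.exp (T k ω) ∂ℙ ≤ 1 := by
    intro k
    induction k with
    | zero => intro _; simp [hT]
    | succ k ih =>
      intro hk
      -- the factor of `Z (k + 1)` in the first-order bound of the increment, without the event
      -- `E (k + 1)`, which `hmean` supplies
      set g : Ω → ℝ := fun ω => Real.exp (-(ε ^ 2 / 2)) * Real.sinh ε *
        (Real.exp (T k ω) * {ω | N k ω < n}.indicator (1 : Ω → ℝ) ω) with hg
      have hgm : Measurable[𝒢 (k + 1)] g := by
        exact Measurable.const_mul (Measurable.mul (hTmeas k (k + 1) (by omega) hk).exp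
          (measurable_indicator_one
            (measurableSet_lt_of_measurable (hNmeas k (k + 1) (by omega) hk) n))) _
      have hgb : ∀ ω, |g ω| ≤ |Real.exp (-(ε ^ 2 / 2)) * Real.sinh ε| * Real.exp (k * ε) := by
        intro ω
        rw [hg, abs_mul]
        refine mul_le_mul_of_nonneg_left ?_ (abs_nonneg _)
        rw [abs_mul]
        exact (mul_le_of_le_one_right (abs_nonneg _) (abs_indicator_one_le _ ω)).trans (hexpb k ω)
      have h0 := hmean (k + 1) (by omega) hk g hgm _ hgb
      have hgi : Integrable (fun ω => (g ω * (E (k + 1)).indicator 1 ω) * Z (k + 1) ω) ℙ := by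
        refine integrable_of_abs_le (C := |Real.exp (-(ε ^ 2 / 2)) * Real.sinh ε| *
          Real.exp (k * ε)) ?_ fun ω => ?_
        · exact ((hgm.mono (h𝒢 _) le_rfl).mul (measurable_indicator_one
            (h𝒢 _ _ (hE (k + 1) (k + 1) (by omega) le_rfl hk)))).mul (hZm _ (by omega) hk)
        · rw [abs_mul, abs_mul]
          calc _ ≤ |g ω| * 1 * 1 := mul_le_mul
                (mul_le_mul_of_nonneg_left (abs_indicator_one_le _ ω) (abs_nonneg _))
                (hZ1 _ _) (abs_nonneg _) (by positivity)
            _ ≤ _ := by rw [mul_one, mul_one]; exact hgb ω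
      have hpt : ∀ ω, Real.exp (T (k + 1) ω) ≤
          Real.exp (T k ω) + (g ω * (E (k + 1)).indicator 1 ω) * Z (k + 1) ω := by
        intro ω
        have hgW : g ω * (E (k + 1)).indicator 1 ω =
            Real.exp (T k ω) * (Real.exp (-(ε ^ 2 / 2)) * Real.sinh ε * W (k + 1) ω) := by
          simp only [hg, hW, Nat.add_sub_cancel]; ring
        rw [hgW, hTsucc, Real.exp_add, mul_assoc (Real.exp (T k ω)), ← mul_one_add]
        refine mul_le_mul_of_nonneg_left ?_ (Real.exp_pos _).le
        rcases hW01 (k + 1) ω with h | h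
        · simp [h]
        · rw [h, one_mul, mul_one, sub_eq_add_neg, Real.exp_add]
          have e1 := mul_le_mul_of_nonneg_right (exp_mul_le_of_abs_le_one ε (hZ1 (k + 1) ω))
            (Real.exp_pos (-(ε ^ 2 / 2))).le
          have e2 := mul_le_mul_of_nonneg_right (Real.cosh_le_exp_half_sq ε)
            (Real.exp_pos (-(ε ^ 2 / 2))).le
          rw [← Real.exp_add, add_neg_cancel, Real.exp_zero] at e2
          linarith
      calc ∫ ω, Real.exp (T (k + 1) ω) ∂ℙ
          ≤ ∫ ω, (Real.exp (T k ω) + (g ω * (E (k + 1)).indicator 1 ω) * Z (k + 1) ω) ∂ℙ :=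
            integral_mono (hint _ hk) ((hint k (by omega)).add hgi) hpt
        _ = ∫ ω, Real.exp (T k ω) ∂ℙ := by
            rw [integral_add (hint k (by omega)) hgi, h0, add_zero]
        _ ≤ 1 := ih (by omega)
  refine le_trans (measureReal_mono ?_) (measureReal_exp_markov (hint K le_rfl) (hsuper K le_rfl)
    (n * ε ^ 2 / 2))
  rintro ω ⟨k, hk, hkn, hdev⟩
  have hk' := Finset.mem_Icc.1 hk
  change N k ω = n at hkn
  have hbefore : ∀ j ∈ Finset.Icc 1 k, W j ω = (E j).indicator (1 : Ω → ℝ) ω := by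
    intro j hj
    have hj' := Finset.mem_Icc.1 hj
    simp only [hW]
    by_cases hjE : ω ∈ E j
    · have h1 := hNsucc (j - 1) ω
      rw [Nat.sub_add_cancel hj'.1, Set.indicator_of_mem hjE] at h1
      have h2 : N j ω ≤ N k ω := hNmono ω hj'.2
      rw [Set.indicator_of_mem (show ω ∈ {ω | N (j - 1) ω < n} by
        simp only [Set.mem_ofPred_eq, Pi.one_apply] at h1 ⊢; linarith)]
      simp
    · rw [Set.indicator_of_notMem hjE, mul_zero]
  have hafter : ∀ j ∈ Finset.Icc 1 K, j ∉ Finset.Icc 1 k → W j ω = 0 := by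
    intro j hj hjk
    have hj' := Finset.mem_Icc.1 hj
    have : k ≤ j - 1 := by
      by_contra hcon; exact hjk (Finset.mem_Icc.2 ⟨hj'.1, by omega⟩)
    have h2 : N k ω ≤ N (j - 1) ω := hNmono ω this
    simp only [hW]
    rw [Set.indicator_of_notMem (show ω ∉ {ω | N (j - 1) ω < n} by
      simp only [Set.mem_ofPred_eq]; linarith), zero_mul]
  have hTK : T K ω = ∑ j ∈ Finset.Icc 1 k,
      (E j).indicator (1 : Ω → ℝ) ω * (ε * Z j ω - ε ^ 2 / 2) := by
    simp only [hT]
    rw [← Finset.sum_subset (Finset.Icc_subset_Icc_right hk'.2)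
      (fun j hj hjk => by rw [hafter j hj hjk, zero_mul])]
    exact Finset.sum_congr rfl fun j hj => by rw [hbefore j hj]
  have hTK2 : T K ω = ε * ∑ j ∈ Finset.Icc 1 k, (E j).indicator (1 : Ω → ℝ) ω * Z j ω -
      ε ^ 2 / 2 * N k ω := by
    rw [hTK, hN, Finset.mul_sum, Finset.mul_sum, ← Finset.sum_sub_distrib]
    exact Finset.sum_congr rfl fun j _ => by ring
  change n * ε ^ 2 / 2 ≤ T K ω
  rw [hTK2, hkn]
  nlinarith [mul_le_mul_of_nonneg_left hdev hε]

/-- The sum of the conditional means `m k` of variables `Y k ∈ [0, 1]` is, with probability at least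
`1 - δ`, at most twice the sum of the variables, up to `2 log (1 / δ)`. The estimate
`exp (-y) ≤ 1 - y / 2` on `[0, 1]` makes `exp (∑ (m k / 2 - Y k))` a supermartingale. -/
theorem sum_mean_concentration (K : ℕ) {δ : ℝ} (hδ : 0 < δ) (m Y : ℕ → Ω → ℝ)
    (𝒢 : ℕ → MeasurableSpace Ω) (h𝒢 : ∀ k, 𝒢 k ≤ mΩ)
    (hm : ∀ j k, 1 ≤ j → j ≤ k → k ≤ K → Measurable[𝒢 k] (m j))
    (hY : ∀ j k, 1 ≤ j → j < k → k ≤ K → Measurable[𝒢 k] (Y j))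
    (hYm : ∀ k, 1 ≤ k → k ≤ K → Measurable (Y k)) (hY1 : ∀ k ω, 0 ≤ Y k ω ∧ Y k ω ≤ 1)
    {C : ℝ} (hm0 : ∀ k ω, 0 ≤ m k ω) (hmC : ∀ k ω, m k ω ≤ C)
    (hmean : ∀ k, 1 ≤ k → k ≤ K → ∀ g : Ω → ℝ, Measurable[𝒢 k] g → ∀ C, (∀ ω, |g ω| ≤ C) →
      ∫ ω, g ω * Y k ω ∂ℙ = ∫ ω, g ω * m k ω ∂ℙ) :
    ℙ.real {ω | 2 * ∑ k ∈ Finset.Icc 1 K, Y k ω + 2 * Real.log (1 / δ) ≤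
      ∑ k ∈ Finset.Icc 1 K, m k ω} ≤ δ := by
  set T : ℕ → Ω → ℝ := fun k ω => ∑ j ∈ Finset.Icc 1 k, (m j ω / 2 - Y j ω) with hT
  have hTsucc : ∀ k ω, T (k + 1) ω = T k ω + (m (k + 1) ω / 2 - Y (k + 1) ω) :=
    fun k ω => by simp only [hT]; rw [Finset.sum_Icc_succ_top (by omega)]
  have hTmeas : ∀ k l, k < l → l ≤ K → Measurable[𝒢 l] (T k) := by
    intro k l hkl hl
    refine Finset.measurable_fun_sum _ fun j hj => ?_
    have hj' := Finset.mem_Icc.1 hj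
    exact ((hm j l hj'.1 (by omega) hl).div_const 2).sub (hY j l hj'.1 (by omega) hl)
  have hTmeas' : ∀ k, k ≤ K → Measurable (T k) := by
    intro k hk
    refine Finset.measurable_fun_sum _ fun j hj => ?_
    have hj' := Finset.mem_Icc.1 hj
    exact (((hm j j hj'.1 le_rfl (by omega)).mono (h𝒢 j) le_rfl).div_const 2).sub
      (hYm j hj'.1 (by omega))
  have hTb : ∀ k ω, T k ω ≤ k * (C / 2) := by
    intro k ω
    induction k with
    | zero => simp [hT]
    | succ k ih =>
      rw [hTsucc]
      push_cast
      linarith [(hY1 (k + 1) ω).1, hmC (k + 1) ω]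
  have hexpb : ∀ k ω, |Real.exp (T k ω)| ≤ Real.exp (k * (C / 2)) := fun k ω => by
    rw [abs_of_pos (Real.exp_pos _)]; exact Real.exp_le_exp.2 (hTb k ω)
  have hint : ∀ k, k ≤ K → Integrable (fun ω => Real.exp (T k ω)) ℙ := fun k hk =>
    integrable_of_abs_le (hTmeas' k hk).exp (hexpb k)
  have hsuper : ∀ k, k ≤ K → ∫ ω, Real.exp (T k ω) ∂ℙ ≤ 1 := by
    intro k
    induction k with
    | zero => intro _; simp [hT]
    | succ k ih =>
      intro hk
      set g : Ω → ℝ := fun ω => Real.exp (T k ω) * Real.exp (m (k + 1) ω / 2) with hg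
      have hmm := hm (k + 1) (k + 1) (by omega) le_rfl hk
      have hgm : Measurable[𝒢 (k + 1)] g :=
        (hTmeas k (k + 1) (by omega) hk).exp.mul (hmm.div_const 2).exp
      have hgb : ∀ ω, |g ω| ≤ Real.exp (k * (C / 2)) * Real.exp (C / 2) := by
        intro ω
        rw [hg, abs_mul]
        refine mul_le_mul (hexpb k ω) ?_ (abs_nonneg _) (Real.exp_pos _).le
        rw [abs_of_pos (Real.exp_pos _)]
        exact Real.exp_le_exp.2 (by linarith [hmC (k + 1) ω])
      have h0 := hmean (k + 1) (by omega) hk g hgm _ hgb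
      have hgmeas : Measurable g := hgm.mono (h𝒢 _) le_rfl
      have hgi : Integrable g ℙ := integrable_of_abs_le hgmeas hgb
      have hgYi : Integrable (fun ω => g ω * Y (k + 1) ω) ℙ := by
        refine integrable_of_abs_le (C := Real.exp (k * (C / 2)) * Real.exp (C / 2))
          (hgmeas.mul (hYm _ (by omega) hk)) fun ω => ?_
        rw [abs_mul]
        refine (mul_le_of_le_one_right (abs_nonneg _) ?_).trans (hgb ω)
        rw [abs_of_nonneg (hY1 _ _).1]; exact (hY1 _ _).2
      have hgmi : Integrable (fun ω => g ω * m (k + 1) ω) ℙ := by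
        refine integrable_of_abs_le (C := Real.exp (k * (C / 2)) * Real.exp (C / 2) * C)
          (hgmeas.mul (hmm.mono (h𝒢 _) le_rfl)) fun ω => ?_
        rw [abs_mul]
        refine mul_le_mul (hgb ω) ?_ (abs_nonneg _) (by positivity)
        rw [abs_of_nonneg (hm0 _ _)]; exact hmC _ _
      have hpt : ∀ ω, Real.exp (T (k + 1) ω) ≤ g ω - g ω * Y (k + 1) ω / 2 := by
        intro ω
        have e1 : Real.exp (T (k + 1) ω) = g ω * Real.exp (-Y (k + 1) ω) := by
          simp only [hTsucc, hg, ← Real.exp_add]; congr 1; ring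
        have hy := hY1 (k + 1) ω
        have e2 := exp_neg_le_quadratic hy.1
        have e3 : Real.exp (-Y (k + 1) ω) ≤ 1 - Y (k + 1) ω / 2 := by nlinarith
        have hg0 : 0 ≤ g ω := by rw [hg]; positivity
        rw [e1]
        nlinarith [mul_le_mul_of_nonneg_left e3 hg0]
      have hpt2 : ∀ ω, g ω - g ω * m (k + 1) ω / 2 ≤ Real.exp (T k ω) := by
        intro ω
        have e2 := Real.add_one_le_exp (-(m (k + 1) ω / 2))
        have e3 : g ω * Real.exp (-(m (k + 1) ω / 2)) = Real.exp (T k ω) := by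
          simp only [hg, ← Real.exp_add]; congr 1; ring
        have hg0 : 0 ≤ g ω := by rw [hg]; positivity
        rw [← e3]
        nlinarith [mul_le_mul_of_nonneg_left e2 hg0]
      calc ∫ ω, Real.exp (T (k + 1) ω) ∂ℙ ≤ ∫ ω, (g ω - g ω * Y (k + 1) ω / 2) ∂ℙ :=
            integral_mono (hint _ hk) (hgi.sub (hgYi.div_const 2)) hpt
        _ = ∫ ω, (g ω - g ω * m (k + 1) ω / 2) ∂ℙ := by
            rw [integral_sub hgi (hgYi.div_const 2), integral_sub hgi (hgmi.div_const 2),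
              integral_div, integral_div, h0]
        _ ≤ ∫ ω, Real.exp (T k ω) ∂ℙ :=
            integral_mono (hgi.sub (hgmi.div_const 2)) (hint k (by omega)) hpt2
        _ ≤ 1 := ih (by omega)
  have h1 := measureReal_exp_markov (hint K le_rfl) (hsuper K le_rfl) (Real.log (1 / δ))
  rw [← Real.log_inv, one_div, inv_inv, Real.exp_log hδ] at h1
  refine le_trans (measureReal_mono ?_) h1
  intro ω hω
  simp only [Set.mem_ofPred_eq, hT, Finset.sum_sub_distrib, ← Finset.sum_div] at hω ⊢
  rw [one_div] at hω
  linarith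

end Concentration

/-! ### Measurability with respect to the history -/

namespace Play

open MeasureTheory

section Measurability

variable {S A B Ω : Type*} [Fintype S] [Fintype A] [Fintype B]
  [DecidableEq S] [DecidableEq A] [DecidableEq B] {m : MeasurableSpace Ω} (X : Play S A B Ω)

theorem measurableSet_of_comap_le {Y : Type*} {f : Ω → Y} (h : MeasurableSpace.comap f ⊤ ≤ m)
    (U : Set Y) : MeasurableSet {ω | f ω ∈ U} := h _ ⟨U, trivial, rfl⟩

theorem measurableSet_visit₂ {τ h : ℕ} (hX : X.stepSigma τ h ≤ m) (s : S) (a : A) :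
    MeasurableSet {ω | X.state τ h ω = s ∧ X.act₁ τ h ω = a} := by
  simp only [stepSigma, sup_le_iff] at hX
  obtain ⟨⟨⟨⟨h1, h2⟩, h3⟩, h4⟩, h5⟩ := hX
  exact (measurableSet_of_comap_le h1 {s}).inter (measurableSet_of_comap_le h2 {a})

theorem measurableSet_visit₃ {τ h : ℕ} (hX : X.stepSigma τ h ≤ m) (s : S) (a : A) (b : B) :
    MeasurableSet {ω | X.state τ h ω = s ∧ X.act₁ τ h ω = a ∧ X.act₂ τ h ω = b} := by
  simp only [stepSigma, sup_le_iff] at hX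
  obtain ⟨⟨⟨⟨h1, h2⟩, h3⟩, h4⟩, h5⟩ := hX
  exact (measurableSet_of_comap_le h1 {s}).inter
    ((measurableSet_of_comap_le h2 {a}).inter (measurableSet_of_comap_le h3 {b}))

theorem measurableSet_next {τ h : ℕ} (hX : X.stepSigma τ h ≤ m) (U : Set S) :
    MeasurableSet {ω | X.state τ (h + 1) ω ∈ U} := by
  simp only [stepSigma, sup_le_iff] at hX
  exact measurableSet_of_comap_le hX.2 U

theorem measurable_obs {τ h : ℕ} (hX : X.stepSigma τ h ≤ m) : Measurable (X.obs τ h) := by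
  simp only [stepSigma, sup_le_iff] at hX
  exact Measurable.of_comap_le hX.1.2

variable {n h : ℕ} (hX : ∀ τ, 1 ≤ τ → τ ≤ n → X.stepSigma τ h ≤ m)

include hX in
theorem measurable_count₃ {k : ℕ} (hk : k ≤ n) (s : S) (a : A) (b : B) :
    Measurable fun ω => ((X.record ω).count₃ k h s a b : ℝ) := by
  simp only [Record.count₃, Finset.card_filter, Nat.cast_sum, Nat.cast_ite]
  refine Finset.measurable_fun_sum _ fun τ hτ => ?_
  have hτ' := Finset.mem_Icc.1 hτ
  exact Measurable.ite (X.measurableSet_visit₃ (hX τ hτ'.1 (by omega)) s a b)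
    measurable_const measurable_const

include hX in
theorem measurable_count₂ {k : ℕ} (hk : k ≤ n) (s : S) (a : A) :
    Measurable fun ω => ((X.record ω).count₂ k h s a : ℝ) := by
  simp only [Record.count₂, Finset.card_filter, Nat.cast_sum, Nat.cast_ite]
  refine Finset.measurable_fun_sum _ fun τ hτ => ?_
  have hτ' := Finset.mem_Icc.1 hτ
  exact Measurable.ite (X.measurableSet_visit₂ (hX τ hτ'.1 (by omega)) s a)
    measurable_const measurable_const

include hX in
theorem measurable_rHat {k : ℕ} (hk : k ≤ n) (s : S) (a : A) (b : B) :
    Measurable fun ω => (X.record ω).rHat k h s a b := by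
  refine Measurable.div ?_ ((X.measurable_count₃ hX hk s a b).max measurable_const)
  refine Finset.measurable_fun_sum _ fun τ hτ => ?_
  have hτ' := Finset.mem_Icc.1 hτ
  have hs := hX τ hτ'.1 (by omega)
  exact Measurable.ite (X.measurableSet_visit₃ hs s a b) (X.measurable_obs hs) measurable_const

include hX in
theorem measurable_PHat {k : ℕ} (hk : k ≤ n) (s : S) (a : A) (s' : S) :
    Measurable fun ω => (X.record ω).PHat k h s a s' := by
  unfold Record.PHat
  split_ifs
  · exact measurable_const
  refine Measurable.div ?_ ((X.measurable_count₂ hX hk s a).max measurable_const)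
  simp only [Finset.card_filter, Nat.cast_sum, Nat.cast_ite, ← and_assoc]
  refine Finset.measurable_fun_sum _ fun τ hτ => ?_
  have hτ' := Finset.mem_Icc.1 hτ
  have hs := hX τ hτ'.1 (by omega)
  exact Measurable.ite ((X.measurableSet_visit₂ hs s a).inter (X.measurableSet_next hs {s'}))
    measurable_const measurable_const

include hX in
theorem measurable_bonusR (H K : ℕ) (δ : ℝ) {k : ℕ} (hk : k ≤ n) (s : S) (a : A) (b : B) :
    Measurable fun ω => (X.record ω).bonusR H K δ k h s a b := by
  unfold Record.bonusR
  split_ifs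
  · exact measurable_const
  · exact (measurable_const.div ((X.measurable_count₃ hX hk s a b).max measurable_const)).sqrt

include hX in
theorem measurable_bonusP (H K : ℕ) (δ : ℝ) {k : ℕ} (hk : k ≤ n) (s : S) (a : A) :
    Measurable fun ω => (X.record ω).bonusP H K δ k h s a := by
  unfold Record.bonusP
  split_ifs
  · exact measurable_const
  · exact (measurable_const.div ((X.measurable_count₂ hX hk s a).max measurable_const)).sqrt

include hX in
theorem measurable_priorBonus (H K : ℕ) (δ : ℝ) {k : ℕ} (hk : k - 1 ≤ n) (s : S) (a : A) (b : B) :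
    Measurable fun ω => (X.record ω).priorBonus H K δ k h s a b := by
  unfold Record.priorBonus
  exact (measurable_const.div ((X.measurable_count₃ hX hk s a b).max measurable_const)).sqrt.add
    (measurable_const.div ((X.measurable_count₂ hX hk s a).max measurable_const)).sqrt

end Measurability

section MeasurabilityPolicies

variable {S A B Ω : Type*} [Fintype S] [Fintype A] [Fintype B]
  [DecidableEq S] [DecidableEq A] [DecidableEq B] {m : MeasurableSpace Ω} (X : Play S A B Ω)
  {n H : ℕ} (hX : ∀ τ j, 1 ≤ τ → τ ≤ n → j < H → X.stepSigma τ j ≤ m)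

theorem measurable_mirrorStep {Y : Type*} [Fintype Y] (η : ℝ) {w u : Ω → Y → ℝ}
    (hw : ∀ y, Measurable fun ω => w ω y) (hu : ∀ y, Measurable fun ω => u ω y) (y : Y) :
    Measurable fun ω => mirrorStep η (w ω) (u ω) y := by
  unfold mirrorStep
  exact ((hw y).mul ((hu y).const_mul η).exp).div
    (Finset.measurable_fun_sum _ fun y _ => (hw y).mul ((hu y).const_mul η).exp)

include hX in
theorem measurable_qStep (K : ℕ) (δ : ℝ) {k : ℕ} (hk : k ≤ n) (l : ℕ) {h : ℕ} (hh : h < H)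
    {V : Ω → S → ℝ} (hV : ∀ s, Measurable fun ω => V ω s) (s : S) (a : A) (b : B) :
    Measurable fun ω => (X.record ω).qStep H K δ k l h (V ω) s a b := by
  have hX' : ∀ τ, 1 ≤ τ → τ ≤ n → X.stepSigma τ h ≤ m := fun τ h1 h2 => hX τ h h1 h2 hh
  unfold Record.qStep
  refine Measurable.max (Measurable.min ?_ measurable_const) measurable_const
  refine ((X.measurable_rHat hX' hk s a b).add (Finset.measurable_fun_sum _ fun s' _ =>
    (X.measurable_PHat hX' hk s a s').mul (hV s'))).add ?_
  exact (X.measurable_bonusR hX' H K δ hk s a b).add (X.measurable_bonusP hX' H K δ hk s a)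

include hX in
theorem measurable_vBar (K : ℕ) (δ : ℝ) {k : ℕ} (hk : k ≤ n)
    {μ : Ω → ℕ → S → A → ℝ} {ν : Ω → ℕ → S → B → ℝ}
    (hμ : ∀ h < H, ∀ s a, Measurable fun ω => μ ω h s a)
    (hν : ∀ h < H, ∀ s b, Measurable fun ω => ν ω h s b) (l h : ℕ) (hh : l + h ≤ H) (s : S) :
    Measurable fun ω => (X.record ω).vBar H K δ k (μ ω) (ν ω) l h s := by
  induction l generalizing h s with
  | zero => exact measurable_const
  | succ l ih =>
    simp only [Record.vBar]
    refine Finset.measurable_fun_sum _ fun a _ => Finset.measurable_fun_sum _ fun b _ => ?_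
    exact ((hμ h (by omega) s a).mul (X.measurable_qStep hX K δ hk l (by omega)
      (fun s' => ih (h + 1) (by omega) s') s a b)).mul (hν h (by omega) s b)

include hX in
theorem measurable_reach (s₁ : S) {k : ℕ} (hk : k ≤ n) {μ : Ω → ℕ → S → A → ℝ}
    (hμ : ∀ h < H, ∀ s a, Measurable fun ω => μ ω h s a) (h : ℕ) (hh : h ≤ H) (s : S) :
    Measurable fun ω => (X.record ω).reach s₁ k (μ ω) h s := by
  induction h generalizing s with
  | zero => exact measurable_const
  | succ h ih =>
    simp only [Record.reach]
    refine Finset.measurable_fun_sum _ fun s' _ => Finset.measurable_fun_sum _ fun a _ => ?_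
    exact ((ih (by omega) s').mul (hμ h (by omega) s' a)).mul
      (X.measurable_PHat (fun τ h1 h2 => hX τ h h1 h2 (by omega)) hk s' a s)

include hX in
/-- The policies of an episode are functions of the observations of the earlier episodes. -/
theorem measurable_policies (s₁ : S) (K : ℕ) (δ η γ : ℝ) (k : ℕ) (hk : k ≤ n + 1) :
    (∀ h < H, ∀ s a, Measurable fun ω => ((X.record ω).policies s₁ H K δ η γ k).1 h s a) ∧
    (∀ h < H, ∀ s b, Measurable fun ω => ((X.record ω).policies s₁ H K δ η γ k).2 h s b) := by
  induction k with
  | zero => exact ⟨fun _ _ _ _ => measurable_const, fun _ _ _ _ => measurable_const⟩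
  | succ k ih =>
    obtain ⟨h1, h2⟩ := ih (by omega)
    constructor
    · intro h hh s a
      refine measurable_mirrorStep (w := fun ω => ((X.record ω).policies s₁ H K δ η γ k).1 h s)
        (u := fun ω a => ∑ b, (X.record ω).qBar H K δ k ((X.record ω).policies s₁ H K δ η γ k).1
          ((X.record ω).policies s₁ H K δ η γ k).2 h s a b *
          ((X.record ω).policies s₁ H K δ η γ k).2 h s b) η (fun a => h1 h hh s a) (fun a => ?_) a
      refine Finset.measurable_fun_sum _ fun b _ => Measurable.mul ?_ (h2 h hh s b)
      exact X.measurable_qStep hX K δ (by omega) _ hh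
        (fun s' => X.measurable_vBar hX K δ (by omega) h1 h2 _ _ (by omega) s') s a b
    · intro h hh s b
      refine measurable_mirrorStep (w := fun ω => ((X.record ω).policies s₁ H K δ η γ k).2 h s)
        (u := fun ω b => -((X.record ω).reach s₁ k ((X.record ω).policies s₁ H K δ η γ k).1 h s *
          ∑ a, (X.record ω).rTilde H K δ k h s a b *
            ((X.record ω).policies s₁ H K δ η γ k).1 h s a)) γ
        (fun b => h2 h hh s b) (fun b => Measurable.neg ?_) b
      refine (X.measurable_reach hX s₁ (by omega) h1 h hh.le s).mul ?_
      refine Finset.measurable_fun_sum _ fun a _ => Measurable.mul ?_ (h1 h hh s a)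
      have hX' : ∀ τ, 1 ≤ τ → τ ≤ n → X.stepSigma τ h ≤ m := fun τ h1 h2 => hX τ h h1 h2 hh
      exact ((X.measurable_rHat hX' (by omega) s a b).sub
        (X.measurable_bonusR hX' H K δ (by omega) s a b)).max measurable_const

theorem measurable_occ (G : SCGame S A B) {μ : Ω → ℕ → S → A → ℝ}
    (hμ : ∀ h < G.H, ∀ s a, Measurable fun ω => μ ω h s a) (h : ℕ) (hh : h ≤ G.H) (s : S) :
    Measurable fun ω => G.occ (μ ω) h s := by
  induction h generalizing s with
  | zero => exact measurable_const
  | succ h ih =>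
    simp only [SCGame.occ]
    refine Finset.measurable_fun_sum _ fun s' _ => Finset.measurable_fun_sum _ fun a _ => ?_
    exact ((ih (by omega) s').mul (hμ h (by omega) s' a)).mul_const _

theorem measurable_total (G : SCGame S A B) {μ : Ω → ℕ → S → A → ℝ} {ν : Ω → ℕ → S → B → ℝ}
    {f : Ω → ℕ → S → A → B → ℝ}
    (hμ : ∀ h < G.H, ∀ s a, Measurable fun ω => μ ω h s a)
    (hν : ∀ h < G.H, ∀ s b, Measurable fun ω => ν ω h s b)
    (hf : ∀ h < G.H, ∀ s a b, Measurable fun ω => f ω h s a b) :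
    Measurable fun ω => G.total (μ ω) (ν ω) (f ω) := by
  unfold SCGame.total
  refine Finset.measurable_fun_sum _ fun h hh => Finset.measurable_fun_sum _ fun s _ =>
    Finset.measurable_fun_sum _ fun a _ => Finset.measurable_fun_sum _ fun b _ => ?_
  have hh' := Finset.mem_range.1 hh
  exact (((measurable_occ G hμ h hh'.le s).mul (hμ h hh' s a)).mul (hν h hh' s b)).mul
    (hf h hh' s a b)

end MeasurabilityPolicies

/-! ### The law of an episode -/

section Law

variable {S A B Ω : Type*} [Fintype S] [Fintype A] [Fintype B]
  [DecidableEq S] [DecidableEq A] [DecidableEq B] (X : Play S A B Ω)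

theorem stepSigma_le_histState {H k h τ j : ℕ} (hτ : 1 ≤ τ)
    (h1 : τ < k ∧ j < H ∨ τ = k ∧ j < h) : X.stepSigma τ j ≤ X.histState H k h :=
  le_sup_of_le_left (le_iSup_of_le τ (le_iSup_of_le j (le_iSup_of_le ⟨hτ, h1⟩ le_rfl)))

theorem histState_le_histAct (H k h : ℕ) : X.histState H k h ≤ X.histAct H k h :=
  le_sup_of_le_left le_sup_left

theorem histState_zero_le {H k h : ℕ} (s : S) (hs : ∀ ω, X.state k 0 ω = s) :
    X.histState H k 0 ≤ X.histState H k h := by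
  refine sup_le (iSup_le fun τ => iSup_le fun j => iSup_le fun hj => ?_) ?_
  · exact X.stepSigma_le_histState hj.1 (hj.2.imp id fun h => absurd h.2 (by omega))
  · have : X.state k 0 = fun _ => s := funext hs
    rw [this, MeasurableSpace.comap_const]
    exact bot_le

theorem measurableSet_state_histState (H k h : ℕ) (s : S) :
    MeasurableSet[X.histState H k h] {ω | X.state k h ω = s} :=
  measurableSet_of_comap_le (m := X.histState H k h) (f := X.state k h) le_sup_right {s}

theorem measurableSet_act₁_histAct (H k h : ℕ) (a : A) :
    MeasurableSet[X.histAct H k h] {ω | X.act₁ k h ω = a} :=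
  measurableSet_of_comap_le (m := X.histAct H k h) (f := X.act₁ k h)
    (le_sup_of_le_left le_sup_right) {a}

theorem measurableSet_act₂_histAct (H k h : ℕ) (b : B) :
    MeasurableSet[X.histAct H k h] {ω | X.act₂ k h ω = b} :=
  measurableSet_of_comap_le (m := X.histAct H k h) (f := X.act₂ k h) le_sup_right {b}

variable {mΩ : MeasurableSpace Ω} {ℙ : Measure Ω} [IsProbabilityMeasure ℙ]
  {G : SCGame S A B} {K : ℕ} {μs : ℕ → Ω → ℕ → S → A → ℝ} {νs : ℕ → Ω → ℕ → S → B → ℝ}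

variable {X}

theorem comap_le_of_fibers {Y : Type*} [Fintype Y] {f : Ω → Y}
    (hf : ∀ y, MeasurableSet {ω | f ω = y}) : MeasurableSpace.comap f ⊤ ≤ mΩ := by
  rintro _ ⟨U, -, rfl⟩
  have : f ⁻¹' U = ⋃ y ∈ U, {ω | f ω = y} := by ext ω; simp
  rw [this]
  exact MeasurableSet.biUnion (Set.toFinite U).countable fun y _ => hf y

theorem Follows.measurable_obs (hF : X.Follows ℙ G K μs νs) (k h : ℕ) : Measurable (X.obs k h) := by
  have : X.obs k h = fun ω => ∑ s, ∑ a, ∑ b,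
      {ω | X.state k h ω = s}.indicator ({ω | X.act₁ k h ω = a}.indicator
        ({ω | X.act₂ k h ω = b}.indicator (X.R k h s a b))) ω := by
    funext ω
    simp [obs, Set.indicator_apply]
  rw [this]
  refine Finset.measurable_fun_sum _ fun s _ => Finset.measurable_fun_sum _ fun a _ =>
    Finset.measurable_fun_sum _ fun b _ => ?_
  exact (((hF.measurable_R k h s a b).indicator (hF.measurable_act₂ k h b)).indicator
    (hF.measurable_act₁ k h a)).indicator (hF.measurable_state k h s)

theorem Follows.stepSigma_le (hF : X.Follows ℙ G K μs νs) (k h : ℕ) : X.stepSigma k h ≤ mΩ :=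
  sup_le (sup_le (sup_le (sup_le (comap_le_of_fibers (hF.measurable_state k h))
    (comap_le_of_fibers (hF.measurable_act₁ k h))) (comap_le_of_fibers (hF.measurable_act₂ k h)))
    (hF.measurable_obs k h).comap_le) (comap_le_of_fibers (hF.measurable_state k (h + 1)))

theorem Follows.histState_le (hF : X.Follows ℙ G K μs νs) (k h : ℕ) : X.histState G.H k h ≤ mΩ :=
  sup_le (iSup_le fun τ => iSup_le fun j => iSup_le fun _ => hF.stepSigma_le τ j)
    (comap_le_of_fibers (hF.measurable_state k h))

theorem Follows.histAct_le (hF : X.Follows ℙ G K μs νs) (k h : ℕ) : X.histAct G.H k h ≤ mΩ :=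
  sup_le (sup_le (hF.histState_le k h) (comap_le_of_fibers (hF.measurable_act₁ k h)))
    (comap_le_of_fibers (hF.measurable_act₂ k h))

/-- If, given the earlier episodes, the state at step `h` of episode `k` is distributed as `occ`,
then state and actions at that step are distributed as `occ * μ * ν`. Conditional laws given the
earlier episodes are expressed by integrals against bounded functions `g` of these episodes. -/
theorem Follows.integral_mul_visit₃_of_state (hF : X.Follows ℙ G K μs νs) {k : ℕ}
    (hk : k ∈ Finset.Icc 1 K)
    (hμ : ∀ ω, IsPolicy (μs k ω)) (hν : ∀ ω, IsPolicy (νs k ω))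
    (hμm : ∀ h < G.H, ∀ s a, Measurable[X.histState G.H k 0] fun ω => μs k ω h s a)
    (hνm : ∀ h < G.H, ∀ s b, Measurable[X.histState G.H k 0] fun ω => νs k ω h s b)
    {h : ℕ} (hh : h < G.H)
    (ih : ∀ (s : S) (g : Ω → ℝ), Measurable[X.histState G.H k 0] g → ∀ C, (∀ ω, |g ω| ≤ C) →
      ∫ ω, g ω * {ω | X.state k h ω = s}.indicator 1 ω ∂ℙ = ∫ ω, g ω * G.occ (μs k ω) h s ∂ℙ)
    (s : S) (a : A) (b : B) (g : Ω → ℝ) (hg : Measurable[X.histState G.H k 0] g) (C : ℝ)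
    (hC : ∀ ω, |g ω| ≤ C) :
    ∫ ω, g ω * {ω | X.state k h ω = s ∧ X.act₁ k h ω = a ∧ X.act₂ k h ω = b}.indicator 1 ω ∂ℙ =
      ∫ ω, g ω * (G.occ (μs k ω) h s * μs k ω h s a * νs k ω h s b) ∂ℙ := by
  have hle := X.histState_zero_le (H := G.H) (h := h) G.s₁ (hF.state_zero k)
  have hact : MeasurableSet {ω | X.act₁ k h ω = a ∧ X.act₂ k h ω = b} :=
    (hF.measurable_act₁ k h a).inter (hF.measurable_act₂ k h b)
  have e1 : ∀ ω, g ω * {ω | X.state k h ω = s ∧ X.act₁ k h ω = a ∧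
      X.act₂ k h ω = b}.indicator 1 ω =
      (g ω * {ω | X.state k h ω = s}.indicator 1 ω) *
        {ω | X.act₁ k h ω = a ∧ X.act₂ k h ω = b}.indicator (fun _ => (1 : ℝ)) ω := by
    intro ω
    by_cases h1 : X.state k h ω = s <;> by_cases h2 : X.act₁ k h ω = a ∧ X.act₂ k h ω = b <;>
      simp [h1, h2]
  simp only [e1]
  have hgS : Measurable[X.histState G.H k h]
      fun ω => g ω * {ω | X.state k h ω = s}.indicator (1 : Ω → ℝ) ω :=
    (hg.mono hle le_rfl).mul (measurable_indicator_one (X.measurableSet_state_histState _ _ _ s))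
  rw [integral_mul_of_condExp (hF.histState_le k h)
    ((integrable_const (1 : ℝ)).indicator hact) (hF.actions k hk h hh a b) hgS
    (C := C) (fun ω => by
      rw [abs_mul]
      exact (mul_le_of_le_one_right (abs_nonneg _) (abs_indicator_one_le _ ω)).trans (hC ω))]
  have e2 : ∀ ω, g ω * {ω | X.state k h ω = s}.indicator (1 : Ω → ℝ) ω *
      (μs k ω h (X.state k h ω) a * νs k ω h (X.state k h ω) b) =
      (g ω * (μs k ω h s a * νs k ω h s b)) * {ω | X.state k h ω = s}.indicator 1 ω := by
    intro ω
    by_cases h1 : X.state k h ω = s <;> simp [h1]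
  simp only [e2]
  rw [ih s (fun ω => g ω * (μs k ω h s a * νs k ω h s b))
    (hg.mul ((hμm h hh s a).mul (hνm h hh s b))) C (fun ω => ?_)]
  · exact integral_congr_ae (Filter.Eventually.of_forall fun ω => by ring)
  · rw [abs_mul]
    refine (mul_le_of_le_one_right (abs_nonneg _) ?_).trans (hC ω)
    have h1 := (hμ ω h s).1 a
    have h2 := (hν ω h s).1 b
    rw [abs_of_nonneg (mul_nonneg h1 h2)]
    exact mul_le_one₀ (mem_Icc_of_mem_stdSimplex (hμ ω h s) a).2 h2
      (mem_Icc_of_mem_stdSimplex (hν ω h s) b).2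

/-- Given the earlier episodes, the state at step `h` of episode `k` is distributed as `occ`. -/
theorem Follows.integral_mul_state (hF : X.Follows ℙ G K μs νs) {k : ℕ}
    (hk : k ∈ Finset.Icc 1 K)
    (hμ : ∀ ω, IsPolicy (μs k ω)) (hν : ∀ ω, IsPolicy (νs k ω))
    (hμm : ∀ h < G.H, ∀ s a, Measurable[X.histState G.H k 0] fun ω => μs k ω h s a)
    (hνm : ∀ h < G.H, ∀ s b, Measurable[X.histState G.H k 0] fun ω => νs k ω h s b)
    {h : ℕ} (hh : h < G.H) (s : S) (g : Ω → ℝ) (hg : Measurable[X.histState G.H k 0] g) (C : ℝ)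
    (hC : ∀ ω, |g ω| ≤ C) :
    ∫ ω, g ω * {ω | X.state k h ω = s}.indicator 1 ω ∂ℙ = ∫ ω, g ω * G.occ (μs k ω) h s ∂ℙ := by
  induction h generalizing s g C with
  | zero =>
    refine integral_congr_ae (Filter.Eventually.of_forall fun ω => ?_)
    simp only [SCGame.occ, Set.indicator_apply, Set.mem_ofPred_eq, hF.state_zero, Pi.one_apply]
    simp only [eq_comm]
  | succ h ih =>
    have hh' : h < G.H := by omega
    have hle := X.histState_zero_le (H := G.H) (h := h) G.s₁ (hF.state_zero k)
    have hgm : Measurable g := hg.mono (hF.histState_le k 0) le_rfl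
    have h3 := hF.integral_mul_visit₃_of_state hk hμ hν hμm hνm hh' (fun s g hg C hC =>
      ih hh' s g hg C hC)
    set I : S → A → B → Ω → ℝ := fun s' a b =>
      {ω | X.state k h ω = s' ∧ X.act₁ k h ω = a ∧ X.act₂ k h ω = b}.indicator 1 with hI
    have hIm : ∀ s' a b, MeasurableSet[X.histAct G.H k h]
        {ω | X.state k h ω = s' ∧ X.act₁ k h ω = a ∧ X.act₂ k h ω = b} := fun s' a b =>
      MeasurableSet.inter
        (X.histState_le_histAct _ _ _ _ (X.measurableSet_state_histState _ _ _ s'))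
        (MeasurableSet.inter (X.measurableSet_act₁_histAct _ _ _ a)
          (X.measurableSet_act₂_histAct _ _ _ b))
    have hgI : ∀ s' a b, Measurable[X.histAct G.H k h] fun ω => g ω * I s' a b ω :=
      fun s' a b => (hg.mono (hle.trans (X.histState_le_histAct _ _ _)) le_rfl).mul
        (measurable_indicator_one (hIm s' a b))
    have hgIb : ∀ s' a b ω, |g ω * I s' a b ω| ≤ C := fun s' a b ω => by
      rw [abs_mul]
      exact (mul_le_of_le_one_right (abs_nonneg _) (abs_indicator_one_le _ ω)).trans (hC ω)
    have hnext := hF.measurable_state k (h + 1) s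
    have e1 : ∀ ω, g ω * {ω | X.state k (h + 1) ω = s}.indicator 1 ω =
        ∑ s', ∑ a, ∑ b, g ω * I s' a b ω *
          {ω | X.state k (h + 1) ω = s}.indicator (fun _ => (1 : ℝ)) ω := by
      intro ω
      simp only [← Finset.sum_mul, ← Finset.mul_sum]
      have : ∑ s', ∑ a, ∑ b, I s' a b ω = 1 := by
        simp [hI, Set.indicator_apply, ite_and]
      rw [this, mul_one]
      rfl
    have hint : ∀ s' a b, Integrable (fun ω => g ω * I s' a b ω *
        {ω | X.state k (h + 1) ω = s}.indicator (fun _ => (1 : ℝ)) ω) ℙ := fun s' a b => by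
      refine integrable_of_abs_le (C := C) (((hgI s' a b).mono (hF.histAct_le k h) le_rfl).mul
        (measurable_indicator_one hnext)) fun ω => ?_
      rw [abs_mul]
      exact (mul_le_of_le_one_right (abs_nonneg _) (abs_indicator_one_le _ ω)).trans
        (hgIb s' a b ω)
    have hocc : ∀ s' a b, Measurable fun ω =>
        G.occ (μs k ω) h s' * μs k ω h s' a * νs k ω h s' b := fun s' a b =>
      (((measurable_occ G (fun h hh s a => (hμm h hh s a).mono (hF.histState_le k 0) le_rfl)
        h hh'.le s').mul ((hμm h hh' s' a).mono (hF.histState_le k 0) le_rfl)).mul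
        ((hνm h hh' s' b).mono (hF.histState_le k 0) le_rfl))
    have hocc0 : ∀ s' a b ω, 0 ≤ G.occ (μs k ω) h s' * μs k ω h s' a * νs k ω h s' b :=
      fun s' a b ω => mul_nonneg (mul_nonneg ((G.occ_mem (hμ ω) h).1 s') ((hμ ω h s').1 a))
        ((hν ω h s').1 b)
    have hocc1 : ∀ s' a b ω, G.occ (μs k ω) h s' * μs k ω h s' a * νs k ω h s' b ≤ 1 :=
      fun s' a b ω => mul_le_one₀
        (mul_le_one₀ (mem_Icc_of_mem_stdSimplex (G.occ_mem (hμ ω) h) s').2 ((hμ ω h s').1 a)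
          (mem_Icc_of_mem_stdSimplex (hμ ω h s') a).2) ((hν ω h s').1 b)
        (mem_Icc_of_mem_stdSimplex (hν ω h s') b).2
    have hint2 : ∀ s' a b, Integrable (fun ω => G.P h s' a s *
        (g ω * (G.occ (μs k ω) h s' * μs k ω h s' a * νs k ω h s' b))) ℙ := fun s' a b => by
      refine Integrable.const_mul (integrable_of_abs_le (C := C) (hgm.mul (hocc s' a b))
        fun ω => ?_) _
      rw [Pi.mul_apply, abs_mul]
      refine (mul_le_of_le_one_right (abs_nonneg _) ?_).trans (hC ω)
      rw [abs_of_nonneg (hocc0 s' a b ω)]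
      exact hocc1 s' a b ω
    have e2 : ∀ s' a b, ∫ ω, g ω * I s' a b ω *
        {ω | X.state k (h + 1) ω = s}.indicator (fun _ => (1 : ℝ)) ω ∂ℙ =
        ∫ ω, G.P h s' a s *
          (g ω * (G.occ (μs k ω) h s' * μs k ω h s' a * νs k ω h s' b)) ∂ℙ := by
      intro s' a b
      rw [integral_mul_of_condExp (hF.histAct_le k h) ((integrable_const (1 : ℝ)).indicator hnext)
        (hF.transition k hk h hh' s) (hgI s' a b) (hgIb s' a b), integral_const_mul,
        ← h3 s' a b g hg C hC, ← integral_const_mul]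
      refine integral_congr_ae (Filter.Eventually.of_forall fun ω => ?_)
      by_cases h1 : X.state k h ω = s' ∧ X.act₁ k h ω = a ∧ X.act₂ k h ω = b
      · simp [hI, h1, mul_comm]
      · simp [hI, h1]
    simp only [e1]
    rw [integral_finsetSum _ fun s' _ => integrable_finsetSum _ fun a _ =>
      integrable_finsetSum _ fun b _ => hint s' a b]
    have e3 : ∀ ω, g ω * G.occ (μs k ω) (h + 1) s = ∑ s', ∑ a, ∑ b, G.P h s' a s *
        (g ω * (G.occ (μs k ω) h s' * μs k ω h s' a * νs k ω h s' b)) := by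
      intro ω
      simp only [← Finset.mul_sum, (hν ω h _).2, mul_one, SCGame.occ]
      rw [Finset.mul_sum]
      refine Finset.sum_congr rfl fun s' _ => ?_
      rw [Finset.mul_sum]
      exact Finset.sum_congr rfl fun a _ => by ring
    simp only [e3]
    rw [integral_finsetSum _ fun s' _ => integrable_finsetSum _ fun a _ =>
      integrable_finsetSum _ fun b _ => hint2 s' a b]
    refine Finset.sum_congr rfl fun s' _ => ?_
    rw [integral_finsetSum _ fun a _ => integrable_finsetSum _ fun b _ => hint s' a b,
      integral_finsetSum _ fun a _ => integrable_finsetSum _ fun b _ => hint2 s' a b]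
    refine Finset.sum_congr rfl fun a _ => ?_
    rw [integral_finsetSum _ fun b _ => hint s' a b, integral_finsetSum _ fun b _ => hint2 s' a b]
    exact Finset.sum_congr rfl fun b _ => e2 s' a b

end Law

end Play

/-! ### The estimates are accurate with high probability -/

namespace Play

open MeasureTheory

variable {S A B Ω : Type*} [Fintype S] [Fintype A] [Fintype B]
  [DecidableEq S] [DecidableEq A] [DecidableEq B] {X : Play S A B Ω}
  {mΩ : MeasurableSpace Ω} {ℙ : Measure Ω} [IsProbabilityMeasure ℙ]
  {G : SCGame S A B} {K : ℕ} {μs : ℕ → Ω → ℕ → S → A → ℝ} {νs : ℕ → Ω → ℕ → S → B → ℝ}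

theorem measureReal_le_card_mul {ι : Type*} {s : Finset ι} {f : ι → Set Ω} {T : Set Ω} {c : ℝ}
    (hT : ∀ ω ∈ T, ∃ i ∈ s, ω ∈ f i) (hf : ∀ i ∈ s, ℙ.real (f i) ≤ c) :
    ℙ.real T ≤ s.card * c := by
  have h1 : T ⊆ ⋃ i ∈ s, f i := fun ω hω => by
    obtain ⟨i, hi, hω'⟩ := hT ω hω
    exact Set.mem_iUnion₂.2 ⟨i, hi, hω'⟩
  calc ℙ.real T ≤ ℙ.real (⋃ i ∈ s, f i) := measureReal_mono h1 (measure_ne_top _ _)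
    _ ≤ ∑ i ∈ s, ℙ.real (f i) := measureReal_biUnion_finset_le s f
    _ ≤ s.card * c := by
        rw [← nsmul_eq_mul]; exact Finset.sum_le_card_nsmul _ _ _ hf

variable (X) in
/-- The visits of the triple `(s, a, b)` at step `h` of episode `k`. -/
def visit₃ (k h : ℕ) (s : S) (a : A) (b : B) : Set Ω :=
  {ω | X.state k h ω = s ∧ X.act₁ k h ω = a ∧ X.act₂ k h ω = b}

variable (X) in
/-- The visits of the pair `(s, a)` at step `h` of episode `k`. -/
def visit₂ (k h : ℕ) (s : S) (a : A) : Set Ω :=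
  {ω | X.state k h ω = s ∧ X.act₁ k h ω = a}

theorem stepSigma_le_histAct {H k h τ : ℕ} (hh : h < H) (hτ : 1 ≤ τ) (hτk : τ < k) :
    X.stepSigma τ h ≤ X.histAct H k h :=
  (X.stepSigma_le_histState hτ (Or.inl ⟨hτk, hh⟩)).trans (X.histState_le_histAct _ _ _)

theorem measurableSet_visit₃_histAct {H j k h : ℕ} (hh : h < H) (hj : 1 ≤ j) (hjk : j ≤ k)
    (s : S) (a : A) (b : B) : MeasurableSet[X.histAct H k h] (X.visit₃ j h s a b) := by
  rcases hjk.eq_or_lt with rfl | hlt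
  · exact MeasurableSet.inter
      (X.histState_le_histAct _ _ _ _ (X.measurableSet_state_histState _ _ _ s))
      (MeasurableSet.inter (X.measurableSet_act₁_histAct _ _ _ a)
        (X.measurableSet_act₂_histAct _ _ _ b))
  · exact X.measurableSet_visit₃ (stepSigma_le_histAct hh hj hlt) s a b

theorem measurableSet_visit₂_histAct {H j k h : ℕ} (hh : h < H) (hj : 1 ≤ j) (hjk : j ≤ k)
    (s : S) (a : A) : MeasurableSet[X.histAct H k h] (X.visit₂ j h s a) := by
  rcases hjk.eq_or_lt with rfl | hlt
  · exact MeasurableSet.inter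
      (X.histState_le_histAct _ _ _ _ (X.measurableSet_state_histState _ _ _ s))
      (X.measurableSet_act₁_histAct _ _ _ a)
  · exact X.measurableSet_visit₂ (stepSigma_le_histAct hh hj hlt) s a

theorem count₃_eq_sum (k h : ℕ) (s : S) (a : A) (b : B) (ω : Ω) :
    ((X.record ω).count₃ k h s a b : ℝ) =
      ∑ j ∈ Finset.Icc 1 k, (X.visit₃ j h s a b).indicator (1 : Ω → ℝ) ω := by
  rw [Record.count₃, Finset.card_filter, Nat.cast_sum]
  refine Finset.sum_congr rfl fun j _ => ?_
  by_cases hj : X.state j h ω = s ∧ X.act₁ j h ω = a ∧ X.act₂ j h ω = b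
  · rw [Set.indicator_of_mem (show ω ∈ X.visit₃ j h s a b from hj)]
    simp [record, hj]
  · rw [Set.indicator_of_notMem (show ω ∉ X.visit₃ j h s a b from hj)]
    simp [record, hj]

theorem count₂_eq_sum (k h : ℕ) (s : S) (a : A) (ω : Ω) :
    ((X.record ω).count₂ k h s a : ℝ) =
      ∑ j ∈ Finset.Icc 1 k, (X.visit₂ j h s a).indicator (1 : Ω → ℝ) ω := by
  rw [Record.count₂, Finset.card_filter, Nat.cast_sum]
  refine Finset.sum_congr rfl fun j _ => ?_
  by_cases hj : X.state j h ω = s ∧ X.act₁ j h ω = a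
  · rw [Set.indicator_of_mem (show ω ∈ X.visit₂ j h s a from hj)]
    simp [record, hj]
  · rw [Set.indicator_of_notMem (show ω ∉ X.visit₂ j h s a from hj)]
    simp [record, hj]

/-- Deviation of the rewards observed at a triple that is visited `n` times, for either sign `σ`. -/
theorem Follows.reward_deviation (hF : X.Follows ℙ G K μs νs) {h : ℕ} (hh : h < G.H) (s : S) (a : A)
    (b : B) (n : ℝ) {ε σ : ℝ} (hε : 0 ≤ ε) (hσ : |σ| = 1) :
    ℙ.real {ω | ∃ k ∈ Finset.Icc 1 K,
      ∑ j ∈ Finset.Icc 1 k, (X.visit₃ j h s a b).indicator (1 : Ω → ℝ) ω = n ∧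
      n * ε ≤ ∑ j ∈ Finset.Icc 1 k, (X.visit₃ j h s a b).indicator (1 : Ω → ℝ) ω *
        (σ * (X.obs j h ω - G.r h s a b))} ≤ Real.exp (-(n * ε ^ 2 / 2)) := by
  refine visits_concentration K n hε (fun j => X.visit₃ j h s a b)
    (fun j ω => σ * (X.obs j h ω - G.r h s a b)) (fun k => X.histAct G.H k h)
    (fun k => hF.histAct_le k h) (fun j k hj hjk _ => measurableSet_visit₃_histAct hh hj hjk s a b)
    (fun j k hj hjk _ => ?_) (fun k _ _ => ?_) (fun k ω => ?_) (fun k hk1 hkK g hg C hC => ?_)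
  · exact ((X.measurable_obs (stepSigma_le_histAct hh hj hjk)).sub_const _).const_mul σ
  · exact ((hF.measurable_obs k h).sub_const _).const_mul σ
  · have h1 := hF.R_mem k h (X.state k h ω) (X.act₁ k h ω) (X.act₂ k h ω) ω
    have h2 := G.r_mem h s a b
    rw [abs_mul, hσ, one_mul, abs_le]
    simp only [obs]
    constructor <;> linarith [h1.1, h1.2, h2.1, h2.2]
  · have hk : k ∈ Finset.Icc 1 K := Finset.mem_Icc.2 ⟨hk1, hkK⟩
    set I : Ω → ℝ := (X.visit₃ k h s a b).indicator 1 with hI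
    have hgI : Measurable[X.histAct G.H k h] fun ω => σ * (g ω * I ω) :=
      (hg.mul (measurable_indicator_one
        (measurableSet_visit₃_histAct hh hk1 le_rfl s a b))).const_mul σ
    have hgIb : ∀ ω, |σ * (g ω * I ω)| ≤ C := fun ω => by
      rw [abs_mul, hσ, one_mul, abs_mul]
      exact (mul_le_of_le_one_right (abs_nonneg _) (abs_indicator_one_le _ ω)).trans (hC ω)
    have hgIm : Measurable fun ω => σ * (g ω * I ω) := hgI.mono (hF.histAct_le k h) le_rfl
    have hRi : Integrable (X.R k h s a b) ℙ := integrable_of_abs_le (C := 1)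
      (hF.measurable_R k h s a b) fun ω => by
        rw [abs_of_nonneg (hF.R_mem k h s a b ω).1]; exact (hF.R_mem k h s a b ω).2
    have hmul : Integrable (fun ω => σ * (g ω * I ω) * X.R k h s a b ω) ℙ := by
      refine integrable_of_abs_le (C := C) (hgIm.mul (hF.measurable_R k h s a b)) fun ω => ?_
      rw [abs_mul]
      refine (mul_le_of_le_one_right (abs_nonneg _) ?_).trans (hgIb ω)
      rw [abs_of_nonneg (hF.R_mem k h s a b ω).1]; exact (hF.R_mem k h s a b ω).2
    have e1 : ∀ ω, g ω * I ω * (σ * (X.obs k h ω - G.r h s a b)) =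
        σ * (g ω * I ω) * X.R k h s a b ω - σ * (g ω * I ω) * G.r h s a b := by
      intro ω
      by_cases hω : ω ∈ X.visit₃ k h s a b
      · have : X.obs k h ω = X.R k h s a b ω := by
          obtain ⟨rfl, rfl, rfl⟩ := hω
          rfl
        rw [this]; ring
      · have : I ω = 0 := Set.indicator_of_notMem hω _
        rw [this]; ring
    simp only [e1]
    rw [integral_sub hmul ((integrable_of_abs_le hgIm hgIb).mul_const _), sub_eq_zero]
    exact integral_mul_of_condExp (hF.histAct_le k h) hRi (hF.reward k hk h hh s a b) hgI hgIb

/-- Deviation of the transitions into the set `U` observed at a pair that is visited `n` times. -/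
theorem Follows.transition_deviation (hF : X.Follows ℙ G K μs νs) {h : ℕ} (hh : h < G.H) (s : S)
    (a : A) (U : Finset S) (n : ℝ) {ε : ℝ} (hε : 0 ≤ ε) :
    ℙ.real {ω | ∃ k ∈ Finset.Icc 1 K,
      ∑ j ∈ Finset.Icc 1 k, (X.visit₂ j h s a).indicator (1 : Ω → ℝ) ω = n ∧
      n * ε ≤ ∑ j ∈ Finset.Icc 1 k, (X.visit₂ j h s a).indicator (1 : Ω → ℝ) ω *
        ({ω | X.state j (h + 1) ω ∈ (U : Set S)}.indicator (1 : Ω → ℝ) ω -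
          ∑ s' ∈ U, G.P h s a s')} ≤ Real.exp (-(n * ε ^ 2 / 2)) := by
  have hU : ∀ k, {ω | X.state k (h + 1) ω ∈ (U : Set S)}.indicator (1 : Ω → ℝ) =
      fun ω => ∑ s' ∈ U, {ω | X.state k (h + 1) ω = s'}.indicator (fun _ => (1 : ℝ)) ω := by
    intro k
    funext ω
    simp [Set.indicator_apply]
  have hmeas : ∀ k, Measurable ({ω | X.state k (h + 1) ω ∈ (U : Set S)}.indicator (1 : Ω → ℝ)) := by
    intro k
    rw [hU]
    exact Finset.measurable_fun_sum _ fun s' _ =>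
      measurable_indicator_one (hF.measurable_state k (h + 1) s')
  refine visits_concentration K n hε (fun j => X.visit₂ j h s a)
    (fun j ω => {ω | X.state j (h + 1) ω ∈ (U : Set S)}.indicator (1 : Ω → ℝ) ω -
          ∑ s' ∈ U, G.P h s a s') (fun k => X.histAct G.H k h)
    (fun k => hF.histAct_le k h) (fun j k hj hjk _ => measurableSet_visit₂_histAct hh hj hjk s a)
    (fun j k hj hjk _ => ?_) (fun k _ _ => ?_) (fun k ω => ?_) (fun k hk1 hkK g hg C hC => ?_)
  · exact (measurable_indicator_one
      (X.measurableSet_next (stepSigma_le_histAct hh hj hjk) (U : Set S))).sub_const _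
  · exact (hmeas k).sub_const _
  · have h1 : 0 ≤ ∑ s' ∈ U, G.P h s a s' := Finset.sum_nonneg fun s' _ => (G.P_mem h s a).1 s'
    have h2 : ∑ s' ∈ U, G.P h s a s' ≤ 1 := by
      rw [← (G.P_mem h s a).2]
      exact Finset.sum_le_univ_sum_of_nonneg (G.P_mem h s a).1
    rw [abs_le]
    rcases indicator_one_eq_zero_or_one {ω | X.state k (h + 1) ω ∈ (U : Set S)} ω with h3 | h3 <;>
      rw [h3] <;> constructor <;> linarith
  · have hk : k ∈ Finset.Icc 1 K := Finset.mem_Icc.2 ⟨hk1, hkK⟩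
    set I : Ω → ℝ := (X.visit₂ k h s a).indicator 1 with hI
    have hgI : Measurable[X.histAct G.H k h] fun ω => g ω * I ω :=
      hg.mul (measurable_indicator_one (measurableSet_visit₂_histAct hh hk1 le_rfl s a))
    have hgIb : ∀ ω, |g ω * I ω| ≤ C := fun ω => by
      rw [abs_mul]
      exact (mul_le_of_le_one_right (abs_nonneg _) (abs_indicator_one_le _ ω)).trans (hC ω)
    have hgIm : Measurable fun ω => g ω * I ω := hgI.mono (hF.histAct_le k h) le_rfl
    have hint : ∀ s', Integrable (fun ω => g ω * I ω *
        ({ω | X.state k (h + 1) ω = s'}.indicator (fun _ => (1 : ℝ)) ω)) ℙ := fun s' => by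
      refine integrable_of_abs_le (C := C) (hgIm.mul
        (measurable_indicator_one (hF.measurable_state k (h + 1) s'))) fun ω => ?_
      rw [abs_mul]
      exact (mul_le_of_le_one_right (abs_nonneg _) (abs_indicator_one_le _ ω)).trans (hgIb ω)
    have hint2 : ∀ s', Integrable (fun ω => g ω * I ω * G.P h s a s') ℙ := fun s' =>
      (integrable_of_abs_le hgIm hgIb).mul_const _
    have e1 : ∀ ω, g ω * I ω * ({ω | X.state k (h + 1) ω ∈ (U : Set S)}.indicator (1 : Ω → ℝ) ω -
        ∑ s' ∈ U, G.P h s a s') = ∑ s' ∈ U, (g ω * I ω *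
          ({ω | X.state k (h + 1) ω = s'}.indicator (fun _ => (1 : ℝ)) ω) -
          g ω * I ω * G.P h s a s') := by
      intro ω
      rw [hU, Finset.sum_sub_distrib, mul_sub, Finset.mul_sum, Finset.mul_sum]
    simp only [e1]
    have hint3 : ∀ s', Integrable (fun ω => g ω * I ω *
        ({ω | X.state k (h + 1) ω = s'}.indicator (fun _ => (1 : ℝ)) ω) -
          g ω * I ω * G.P h s a s') ℙ := fun s' => (hint s').sub (hint2 s')
    rw [integral_finsetSum _ fun s' _ => hint3 s']
    refine Finset.sum_eq_zero fun s' _ => ?_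
    rw [integral_sub (hint s') (hint2 s'), sub_eq_zero,
      integral_mul_of_condExp (hF.histAct_le k h)
        ((integrable_const (1 : ℝ)).indicator (hF.measurable_state k (h + 1) s'))
        (hF.transition k hk h hh s') hgI hgIb]
    refine integral_congr_ae (Filter.Eventually.of_forall fun ω => ?_)
    by_cases hω : ω ∈ X.visit₂ k h s a
    · obtain ⟨h1, h2⟩ := hω
      simp only [h1, h2]
    · have : I ω = 0 := Set.indicator_of_notMem hω _
      simp [this]

theorem one_le_mul_log {x c : ℝ} (hx : 2 ≤ x) (hc : 2 ≤ c) : 1 ≤ c * Real.log x := by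
  have h1 : Real.log 2 ≤ Real.log x := Real.log_le_log (by norm_num) hx
  have h2 := Real.log_two_gt_d9
  nlinarith

theorem exp_neg_mul_log_div (c : ℕ) {m δ : ℝ} (hm : 0 < m) (hδ : 0 < δ) :
    Real.exp (-(c * Real.log (m / δ))) = (δ / m) ^ c := by
  rw [← mul_neg, ← Real.log_inv, inv_div, ← Real.log_pow, Real.exp_log (by positivity)]

/-- With probability at least `1 - 2 δ` the empirical rewards are accurate. At triples not yet
visited this needs the bonus to be at least `1`, hence the exclusion of trivial games. -/
theorem Follows.rewardsAccurate (hF : X.Follows ℙ G K μs νs) {δ : ℝ} (hδ : 0 < δ) (hδ1 : δ < 1)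
    (hm : (2 : ℝ) ≤ (Fintype.card S : ℝ) * Fintype.card A * Fintype.card B * G.H * K) :
    ℙ.real {ω | ¬ (X.record ω).RewardsAccurate G K δ} ≤ 2 * δ := by
  set m : ℝ := (Fintype.card S : ℝ) * Fintype.card A * Fintype.card B * G.H * K with hmdef
  set L := Real.log (m / δ) with hL
  have hm0 : 0 < m := by linarith
  have hmδ : 2 ≤ m / δ := by rw [le_div_iff₀ hδ]; nlinarith
  have hL1 : 1 ≤ 4 * L := one_le_mul_log hmδ (by norm_num)
  set bad : ℝ → ℕ × (S × A × B) × ℕ → Set Ω := fun σ i =>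
    {ω | ∃ k ∈ Finset.Icc 1 K,
      ∑ j ∈ Finset.Icc 1 k, (X.visit₃ j i.1 i.2.1.1 i.2.1.2.1 i.2.1.2.2).indicator (1 : Ω → ℝ) ω =
        (i.2.2 : ℝ) ∧
      (i.2.2 : ℝ) * √(4 * L / i.2.2) ≤ ∑ j ∈ Finset.Icc 1 k,
        (X.visit₃ j i.1 i.2.1.1 i.2.1.2.1 i.2.1.2.2).indicator (1 : Ω → ℝ) ω *
        (σ * (X.obs j i.1 ω - G.r i.1 i.2.1.1 i.2.1.2.1 i.2.1.2.2))} with hbad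
  set idx := Finset.range G.H ×ˢ (Finset.univ : Finset (S × A × B)) ×ˢ Finset.Icc 1 K with hidx
  have hcard : (idx.card : ℝ) = m := by
    rw [hidx, Finset.card_product, Finset.card_product, Finset.card_range, Finset.card_univ,
      Fintype.card_prod, Fintype.card_prod, Nat.card_Icc, Nat.add_sub_cancel, hmdef]
    push_cast; ring
  have hprob : ∀ σ : ℝ, |σ| = 1 → ∀ i ∈ idx, ℙ.real (bad σ i) ≤ (δ / m) ^ 2 := by
    rintro σ hσ ⟨h, ⟨s, a, b⟩, n⟩ hi
    simp only [hidx, Finset.mem_product, Finset.mem_range, Finset.mem_univ, true_and,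
      Finset.mem_Icc] at hi
    refine (hF.reward_deviation hi.1 s a b n (Real.sqrt_nonneg _) hσ).trans (le_of_eq ?_)
    have hn : (0 : ℝ) < n := by exact_mod_cast hi.2.1
    rw [Real.sq_sqrt (by positivity), ← exp_neg_mul_log_div 2 hm0 hδ]
    congr 2
    field_simp
    norm_num
    exact hL
  set bad2 : Set Ω := {ω | ∃ i ∈ idx, ω ∈ bad 1 i ∪ bad (-1) i} with hbad2
  have hsub : {ω | ¬ (X.record ω).RewardsAccurate G K δ} ⊆ bad2 := by
    intro ω hω
    by_contra hgood
    refine hω fun k hk h hh s a b => ?_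
    have hk' := Finset.mem_Icc.1 hk
    have hk0 : k ≠ 0 := by omega
    have hnum : ∑ τ ∈ Finset.Icc 1 k, (if (X.record ω).state τ h = s ∧ (X.record ω).act₁ τ h = a ∧
        (X.record ω).act₂ τ h = b then (X.record ω).rew τ h else 0) =
        ∑ j ∈ Finset.Icc 1 k, (X.visit₃ j h s a b).indicator (1 : Ω → ℝ) ω * X.obs j h ω := by
      refine Finset.sum_congr rfl fun j _ => ?_
      by_cases hj : X.state j h ω = s ∧ X.act₁ j h ω = a ∧ X.act₂ j h ω = b
      · rw [Set.indicator_of_mem (show ω ∈ X.visit₃ j h s a b from hj)]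
        simp [record, hj]
      · rw [Set.indicator_of_notMem (show ω ∉ X.visit₃ j h s a b from hj)]
        simp [record, hj]
    rw [Record.rHat, Record.bonusR, if_neg hk0, hnum]
    have hcs := X.count₃_eq_sum k h s a b ω
    rcases Nat.eq_zero_or_pos ((X.record ω).count₃ k h s a b) with h0 | hpos
    · rw [h0, Nat.cast_zero] at hcs
      have hz : ∀ j ∈ Finset.Icc 1 k, (X.visit₃ j h s a b).indicator (1 : Ω → ℝ) ω = 0 :=
        (Finset.sum_eq_zero_iff_of_nonneg fun j _ =>
          Set.indicator_nonneg (fun _ _ => zero_le_one) ω).1 hcs.symm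
      rw [Finset.sum_eq_zero fun j hj => by rw [hz j hj, zero_mul], h0]
      have hr := G.r_mem h s a b
      rw [zero_div, zero_sub, abs_neg, abs_of_nonneg hr.1, Nat.cast_zero,
        max_eq_right zero_le_one, div_one]
      exact hr.2.trans (Real.one_le_sqrt.2 hL1)
    · set n := (X.record ω).count₃ k h s a b with hn
      have hnk : n ≤ K := by
        refine (Finset.card_filter_le _ _).trans ?_
        rw [Nat.card_Icc]; omega
      have hi : (h, (s, a, b), n) ∈ idx := by
        simp only [hidx, Finset.mem_product, Finset.mem_range, Finset.mem_univ, true_and,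
          Finset.mem_Icc]
        exact ⟨hh, hpos, hnk⟩
      have hn1 : (1 : ℝ) ≤ n := by exact_mod_cast hpos
      have hn0 : (0 : ℝ) < n := by linarith
      rw [max_eq_left hn1]
      set Rsum := ∑ j ∈ Finset.Icc 1 k, (X.visit₃ j h s a b).indicator (1 : Ω → ℝ) ω * X.obs j h ω
        with hRsum
      have hdev : ∀ σ : ℝ, ∑ j ∈ Finset.Icc 1 k, (X.visit₃ j h s a b).indicator (1 : Ω → ℝ) ω *
          (σ * (X.obs j h ω - G.r h s a b)) = σ * (Rsum - n * G.r h s a b) := by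
        intro σ
        rw [hcs, hRsum, Finset.sum_mul, ← Finset.sum_sub_distrib, Finset.mul_sum]
        exact Finset.sum_congr rfl fun j _ => by ring
      have hσ : ∀ σ : ℝ, ω ∉ bad σ (h, (s, a, b), n) →
          σ * (Rsum - n * G.r h s a b) < n * √(4 * L / n) := by
        intro σ hσ
        by_contra hcon
        exact hσ ⟨k, hk, hcs.symm, by rw [hdev]; exact not_lt.1 hcon⟩
      have hnb : ω ∉ bad 1 (h, (s, a, b), n) ∪ bad (-1) (h, (s, a, b), n) := fun hb =>
        hgood ⟨_, hi, hb⟩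
      rw [Set.mem_union, not_or] at hnb
      have h1 := hσ 1 hnb.1
      have h2 := hσ (-1) hnb.2
      have e : Rsum / n - G.r h s a b = (Rsum - n * G.r h s a b) / n := by field_simp
      rw [e, abs_div, abs_of_pos hn0, div_le_iff₀ hn0, abs_le]
      constructor <;> linarith
  refine (measureReal_mono hsub).trans ((measureReal_le_card_mul (s := idx)
    (f := fun i => bad 1 i ∪ bad (-1) i) (c := 2 * (δ / m) ^ 2) (fun ω hω => hω) ?_).trans ?_)
  · intro i hi
    refine (measureReal_union_le _ _).trans ?_
    linarith [hprob 1 (by norm_num) i hi, hprob (-1) (by norm_num) i hi]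
  · rw [hcard]
    have : m * (2 * (δ / m) ^ 2) = 2 * δ * (δ / m) := by field_simp
    rw [this]
    refine mul_le_of_le_one_right (by positivity) ?_
    rw [div_le_one hm0]; linarith

/-- With probability at least `1 - 2 δ` the empirical transition model is accurate on all sets of
states. -/
theorem Follows.transitionsAccurate (hF : X.Follows ℙ G K μs νs) (hK : 1 ≤ K) [Nonempty A] {δ : ℝ}
    (hδ : 0 < δ) (hδ1 : δ < 1) :
    ℙ.real {ω | ¬ (X.record ω).TransitionsAccurate G K δ} ≤ 2 * δ := by
  set m : ℝ := (Fintype.card S : ℝ) * Fintype.card A * G.H * K with hmdef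
  set L := Real.log (m / δ) with hL
  have hSpos : 1 ≤ Fintype.card S := Fintype.card_pos_iff.2 ⟨G.s₁⟩
  have hS1 : (1 : ℝ) ≤ Fintype.card S := by exact_mod_cast hSpos
  have hA1 : (1 : ℝ) ≤ Fintype.card A := by exact_mod_cast Fintype.card_pos
  have hH1 : (1 : ℝ) ≤ G.H := by exact_mod_cast G.H_pos
  have hK1 : (1 : ℝ) ≤ K := by exact_mod_cast hK
  have hHpos : (0 : ℝ) < G.H := by linarith
  have hmS : (Fintype.card S : ℝ) ≤ m := by
    rw [hmdef, mul_assoc, mul_assoc]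
    exact le_mul_of_one_le_right (by linarith)
      (one_le_mul_of_one_le_of_one_le hA1 (one_le_mul_of_one_le_of_one_le hH1 hK1))
  have hmH : (G.H : ℝ) ≤ m := by
    have : m = G.H * (Fintype.card S * Fintype.card A * K) := by rw [hmdef]; ring
    rw [this]
    exact le_mul_of_one_le_right (by linarith)
      (one_le_mul_of_one_le_of_one_le (one_le_mul_of_one_le_of_one_le hS1 hA1) hK1)
  have hm0 : 0 < m := by linarith
  have hL0 : 0 ≤ L := Real.log_nonneg (by rw [le_div_iff₀ hδ]; linarith)
  set bad : ℕ × (S × A) × ℕ × Finset S → Set Ω := fun i =>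
    {ω | ∃ k ∈ Finset.Icc 1 K,
      ∑ j ∈ Finset.Icc 1 k, (X.visit₂ j i.1 i.2.1.1 i.2.1.2).indicator (1 : Ω → ℝ) ω =
        (i.2.2.1 : ℝ) ∧
      (i.2.2.1 : ℝ) * √(2 * Fintype.card S * L / i.2.2.1) ≤ ∑ j ∈ Finset.Icc 1 k,
        (X.visit₂ j i.1 i.2.1.1 i.2.1.2).indicator (1 : Ω → ℝ) ω *
        ({ω | X.state j (i.1 + 1) ω ∈ (i.2.2.2 : Set S)}.indicator (1 : Ω → ℝ) ω -
          ∑ s' ∈ i.2.2.2, G.P i.1 i.2.1.1 i.2.1.2 s')} with hbad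
  set idx := Finset.range G.H ×ˢ (Finset.univ : Finset (S × A)) ×ˢ Finset.Icc 1 K ×ˢ
    (Finset.univ : Finset (Finset S)) with hidx
  have hcard : (idx.card : ℝ) = m * 2 ^ Fintype.card S := by
    rw [hidx, Finset.card_product, Finset.card_product, Finset.card_product, Finset.card_range,
      Finset.card_univ, Fintype.card_prod, Nat.card_Icc, Nat.add_sub_cancel, Finset.card_univ,
      Fintype.card_finset, hmdef]
    push_cast; ring
  have hprob : ∀ i ∈ idx, ℙ.real (bad i) ≤ (δ / m) ^ Fintype.card S := by
    rintro ⟨h, ⟨s, a⟩, n, U⟩ hi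
    simp only [hidx, Finset.mem_product, Finset.mem_range, Finset.mem_univ, true_and, and_true,
      Finset.mem_Icc] at hi
    refine (hF.transition_deviation hi.1 s a U n (Real.sqrt_nonneg _)).trans (le_of_eq ?_)
    have hn : (0 : ℝ) < n := by exact_mod_cast hi.2.1
    rw [Real.sq_sqrt (by positivity), ← exp_neg_mul_log_div _ hm0 hδ]
    congr 2
    field_simp
    exact hL
  refine (measureReal_le_card_mul (s := idx) (f := bad) (fun ω hω => ?_) hprob).trans ?_
  · by_contra hgood
    refine hω fun k hk h hh s a => ?_
    have hk' := Finset.mem_Icc.1 hk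
    have hk0 : k ≠ 0 := by omega
    have hbonus : ∀ N : ℝ, 0 < N → √(2 * (G.H : ℝ) ^ 2 * Fintype.card S * L / N) / G.H =
        √(2 * Fintype.card S * L / N) := by
      intro N hN
      have : 2 * (G.H : ℝ) ^ 2 * Fintype.card S * L / N =
          (G.H : ℝ) ^ 2 * (2 * Fintype.card S * L / N) := by ring
      rw [this, Real.sqrt_mul (by positivity), Real.sqrt_sq hHpos.le,
        mul_div_cancel_left₀ _ hHpos.ne']
    have hsumP : ∀ U : Finset S, ∑ s' ∈ U, (X.record ω).PHat k h s a s' =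
        (∑ j ∈ Finset.Icc 1 k, (X.visit₂ j h s a).indicator (1 : Ω → ℝ) ω *
          {ω | X.state j (h + 1) ω ∈ (U : Set S)}.indicator (1 : Ω → ℝ) ω) /
          max ((X.record ω).count₂ k h s a : ℝ) 1 := by
      intro U
      simp only [Record.PHat, if_neg hk0]
      rw [← Finset.sum_div]
      congr 1
      simp only [Finset.card_filter, Nat.cast_sum]
      rw [Finset.sum_comm]
      refine Finset.sum_congr rfl fun j _ => ?_
      by_cases hj : X.state j h ω = s ∧ X.act₁ j h ω = a
      · rw [Set.indicator_of_mem (show ω ∈ X.visit₂ j h s a from hj)]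
        simp [record, hj, Set.indicator_apply]
      · rw [Set.indicator_of_notMem (show ω ∉ X.visit₂ j h s a from hj), zero_mul]
        refine Finset.sum_eq_zero fun s' _ => ?_
        rw [if_neg (fun hcon => hj ⟨hcon.1, hcon.2.1⟩), Nat.cast_zero]
    have hP0 : ∀ U : Finset S, 0 ≤ ∑ s' ∈ U, G.P h s a s' := fun U =>
      Finset.sum_nonneg fun s' _ => (G.P_mem h s a).1 s'
    have hP1 : ∀ U : Finset S, ∑ s' ∈ U, G.P h s a s' ≤ 1 := by
      intro U
      rw [← (G.P_mem h s a).2]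
      exact Finset.sum_le_univ_sum_of_nonneg (G.P_mem h s a).1
    have hcs := X.count₂_eq_sum k h s a ω
    rw [Record.bonusP, if_neg hk0, hbonus _ (by positivity)]
    rcases Nat.eq_zero_or_pos ((X.record ω).count₂ k h s a) with h0 | hpos
    · intro U
      rw [h0, Nat.cast_zero] at hcs
      have hz : ∀ j ∈ Finset.Icc 1 k, (X.visit₂ j h s a).indicator (1 : Ω → ℝ) ω = 0 :=
        (Finset.sum_eq_zero_iff_of_nonneg fun j _ =>
          Set.indicator_nonneg (fun _ _ => zero_le_one) ω).1 hcs.symm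
      rw [Finset.sum_sub_distrib, hsumP, Finset.sum_eq_zero fun j hj => by rw [hz j hj, zero_mul],
        zero_div, zero_sub, abs_neg, abs_of_nonneg (hP0 U), h0, Nat.cast_zero,
        max_eq_right zero_le_one, div_one]
      refine (hP1 U).trans (Real.one_le_sqrt.2 (one_le_mul_log ?_ (by linarith)))
      -- a step that is not the last exists only if `H ≥ 2`
      have hH2 : (2 : ℝ) ≤ G.H := by exact_mod_cast (by omega : 2 ≤ G.H)
      rw [le_div_iff₀ hδ]; nlinarith
    · set n := (X.record ω).count₂ k h s a with hn
      have hnk : n ≤ K := by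
        refine (Finset.card_filter_le _ _).trans ?_
        rw [Nat.card_Icc]; omega
      have hn1 : (1 : ℝ) ≤ n := by exact_mod_cast hpos
      have hn0 : (0 : ℝ) < n := by linarith
      rw [max_eq_left hn1] at hsumP ⊢
      have hupper : ∀ U : Finset S, ∑ s' ∈ U, ((X.record ω).PHat k h s a s' - G.P h s a s') ≤
          √(2 * Fintype.card S * L / n) := by
        intro U
        have hi : (h, (s, a), n, U) ∈ idx := by
          simp only [hidx, Finset.mem_product, Finset.mem_range, Finset.mem_univ, true_and,
            and_true, Finset.mem_Icc]
          exact ⟨by omega, hpos, hnk⟩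
        by_contra hcon
        refine hgood ⟨_, hi, k, hk, hcs.symm, ?_⟩
        rw [not_le, Finset.sum_sub_distrib, hsumP] at hcon
        simp only [mul_sub, Finset.sum_sub_distrib]
        rw [← Finset.sum_mul, ← hcs]
        rw [lt_sub_iff_add_lt, lt_div_iff₀ hn0] at hcon
        linarith
      -- the lower bound on `U` is the upper bound on its complement, as both models have mass `1`
      have htot : ∑ s', ((X.record ω).PHat k h s a s' - G.P h s a s') = 0 := by
        rw [Finset.sum_sub_distrib, (X.record ω).sum_PHat hk'.1, if_neg (by omega),
          (G.P_mem h s a).2, sub_self]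
      intro U
      refine abs_le.2 ⟨?_, hupper U⟩
      have h1 := hupper Uᶜ
      have h2 := Finset.sum_add_sum_compl U
        fun s' => (X.record ω).PHat k h s a s' - G.P h s a s'
      rw [htot] at h2
      linarith
  · rw [hcard]
    obtain ⟨c, hc⟩ : ∃ c, Fintype.card S = c + 1 := ⟨Fintype.card S - 1, by omega⟩
    have e : m * 2 ^ Fintype.card S * (δ / m) ^ Fintype.card S = 2 * δ * (2 * δ / m) ^ c := by
      rw [hc, pow_succ, pow_succ, mul_div_assoc, mul_pow]; field_simp
    rw [e]
    refine mul_le_of_le_one_right (by positivity) ?_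
    -- `2 δ / m ≤ 1` because `m ≥ |S| ≥ 2`, unless `|S| = 1`, where the power is trivial
    rcases Nat.eq_zero_or_pos c with rfl | hc0
    · simp
    · refine pow_le_one₀ (by positivity) ?_
      have : (2 : ℝ) ≤ Fintype.card S := by exact_mod_cast (by omega : 2 ≤ Fintype.card S)
      rw [div_le_one hm0]; linarith

/-! ### The expected bonuses are bounded by the realized ones -/

/-- With probability at least `1 - δ` the expected bonuses under the policies played are at most
twice the bonuses met along the play, up to a term that does not grow like `√K`. -/
theorem Follows.sum_total_priorBonus [Nonempty A] [Nonempty B] {δ' η γ : ℝ}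
    (hF : X.Follows ℙ G K
      (fun k ω => ((X.record ω).policies G.s₁ G.H K δ' η γ k).1)
      (fun k ω => ((X.record ω).policies G.s₁ G.H K δ' η γ k).2)) {δ M : ℝ} (hδ : 0 < δ)
    (hM : 0 < M) (hbonus : ∀ k h s a b ω, (X.record ω).priorBonus G.H K δ' k h s a b ≤ M) :
    ℙ.real {ω | 2 * ∑ k ∈ Finset.Icc 1 K, ∑ h ∈ Finset.range G.H,
        (X.record ω).priorBonus G.H K δ' k h (X.state k h ω) (X.act₁ k h ω) (X.act₂ k h ω) +
          2 * (G.H * M) * Real.log (1 / δ) ≤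
      ∑ k ∈ Finset.Icc 1 K, G.total ((X.record ω).policies G.s₁ G.H K δ' η γ k).1
        ((X.record ω).policies G.s₁ G.H K δ' η γ k).2
        ((X.record ω).priorBonus G.H K δ' k)} ≤ δ := by
  have hHpos : (0 : ℝ) < G.H := by exact_mod_cast G.H_pos
  have hHM : 0 < G.H * M := by positivity
  set β : ℕ → ℕ → S → A → B → Ω → ℝ := fun k h s a b ω =>
    (X.record ω).priorBonus G.H K δ' k h s a b with hβ
  set μs : ℕ → Ω → ℕ → S → A → ℝ := fun k ω => ((X.record ω).policies G.s₁ G.H K δ' η γ k).1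
    with hμs
  set νs : ℕ → Ω → ℕ → S → B → ℝ := fun k ω => ((X.record ω).policies G.s₁ G.H K δ' η γ k).2
    with hνs
  have hβ0 : ∀ k h s a b ω, 0 ≤ β k h s a b ω := fun k h s a b ω =>
    (X.record ω).priorBonus_nonneg _ _ _ _ _ _ _ _
  have hμ : ∀ k ω, IsPolicy (μs k ω) := fun k ω => ((X.record ω).policies_mem _ _ _ _ _ _ k).1.1
  have hν : ∀ k ω, IsPolicy (νs k ω) := fun k ω => ((X.record ω).policies_mem _ _ _ _ _ _ k).2.1
  have hpast : ∀ k, ∀ τ j, 1 ≤ τ → τ ≤ k - 1 → j < G.H →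
      X.stepSigma τ j ≤ X.histState G.H k 0 := fun k τ j h1 h2 h3 =>
    X.stepSigma_le_histState h1 (Or.inl ⟨by omega, h3⟩)
  have hpol : ∀ j k, 1 ≤ j → j ≤ k →
      (∀ h < G.H, ∀ s a, Measurable[X.histState G.H k 0] fun ω => μs j ω h s a) ∧
      (∀ h < G.H, ∀ s b, Measurable[X.histState G.H k 0] fun ω => νs j ω h s b) := fun j k hj hjk =>
    X.measurable_policies (hpast k) G.s₁ K δ' η γ j (by omega)
  have hβm : ∀ j k, 1 ≤ j → j ≤ k → ∀ h < G.H, ∀ s a b,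
      Measurable[X.histState G.H k 0] (β j h s a b) := fun j k hj hjk h hh s a b =>
    X.measurable_priorBonus (fun τ h1 h2 => hpast k τ h h1 h2 hh) G.H K δ' (by omega) s a b
  set Y : ℕ → Ω → ℝ := fun k ω => (∑ h ∈ Finset.range G.H,
    β k h (X.state k h ω) (X.act₁ k h ω) (X.act₂ k h ω) ω) / (G.H * M) with hY
  set m : ℕ → Ω → ℝ := fun k ω =>
    G.total (μs k ω) (νs k ω) (fun h s a b => β k h s a b ω) / (G.H * M) with hm
  have hYsum : ∀ k ω, Y k ω = (∑ h ∈ Finset.range G.H, ∑ s, ∑ a, ∑ b,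
      β k h s a b ω * (X.visit₃ k h s a b).indicator 1 ω) / (G.H * M) := by
    intro k ω
    simp only [hY]
    congr 1
    refine Finset.sum_congr rfl fun h _ => ?_
    simp [Set.indicator_apply, visit₃, ite_and]
  have hYmeas : ∀ j (m₀ : MeasurableSpace Ω), (∀ h < G.H, ∀ s a b, Measurable[m₀] (β j h s a b)) →
      (∀ h < G.H, ∀ s a b, MeasurableSet[m₀] (X.visit₃ j h s a b)) → Measurable[m₀] (Y j) := by
    intro j m₀ h1 h2
    have : Y j = fun ω => (∑ h ∈ Finset.range G.H, ∑ s, ∑ a, ∑ b,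
      β j h s a b ω * (X.visit₃ j h s a b).indicator 1 ω) / (G.H * M) := funext (hYsum j)
    rw [this]
    refine Measurable.div_const (Finset.measurable_fun_sum _ fun h hh =>
      Finset.measurable_fun_sum _ fun s _ => Finset.measurable_fun_sum _ fun a _ =>
      Finset.measurable_fun_sum _ fun b _ => ?_) _
    have hh' := Finset.mem_range.1 hh
    exact (h1 h hh' s a b).mul (measurable_indicator_one (h2 h hh' s a b))
  have hvisit : ∀ k h s a b, MeasurableSet (X.visit₃ k h s a b) := fun k h s a b =>
    (hF.measurable_state k h s).inter ((hF.measurable_act₁ k h a).inter (hF.measurable_act₂ k h b))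
  have hconst : ∀ k ω, G.total (μs k ω) (νs k ω) (fun _ _ _ _ => M) = G.H * M := by
    intro k ω
    rw [G.total_eq_of_right_const (hν k ω) (fun _ _ _ => M)]
    simp only [← Finset.sum_mul, ← Finset.mul_sum, ((hμ k ω) _ _).2, mul_one,
      (G.occ_mem (hμ k ω) _).2, Finset.sum_const, Finset.card_range, nsmul_eq_mul, one_mul]
  refine le_trans (measureReal_mono ?_) (sum_mean_concentration K hδ m Y
    (fun k => X.histState G.H k 0) (fun k => hF.histState_le k 0) (fun j k hj hjk _ => ?_)
    (fun j k hj hjk _ => ?_) (fun k hk _ => ?_) (fun k ω => ⟨?_, ?_⟩) (C := 1) (fun k ω => ?_)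
    (fun k ω => ?_) (fun k hk1 hkK g hg C hC => ?_))
  · intro ω hω
    simp only [Set.mem_ofPred_eq, hY, hm, ← Finset.sum_div] at hω ⊢
    rw [le_div_iff₀ hHM, add_mul, mul_assoc, div_mul_cancel₀ _ hHM.ne']
    linarith
  · exact (measurable_total G (hpol j k hj hjk).1 (hpol j k hj hjk).2
      (fun h hh s a b => hβm j k hj hjk h hh s a b)).div_const _
  · exact hYmeas j _ (fun h hh s a b => hβm j k hj hjk.le h hh s a b) fun h hh s a b =>
      X.measurableSet_visit₃ (X.stepSigma_le_histState hj (Or.inl ⟨hjk, hh⟩)) s a b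
  · exact hYmeas k _ (fun h hh s a b => (hβm k k hk le_rfl h hh s a b).mono
      (hF.histState_le k 0) le_rfl) fun h _ s a b => hvisit k h s a b
  · exact div_nonneg (Finset.sum_nonneg fun h _ => hβ0 _ _ _ _ _ _) hHM.le
  · simp only [hY]
    rw [div_le_one hHM]
    calc _ ≤ ∑ h ∈ Finset.range G.H, M := Finset.sum_le_sum fun h _ => hbonus _ _ _ _ _ _
      _ = G.H * M := by simp
  · exact div_nonneg (G.total_nonneg (hμ k ω) (hν k ω) fun h _ s a b => hβ0 _ _ _ _ _ _) hHM.le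
  · simp only [hm]
    rw [div_le_one hHM, ← hconst k ω]
    exact G.total_mono (hμ k ω) (hν k ω) fun h _ s a b => hbonus _ _ _ _ _ _
  · have hk : k ∈ Finset.Icc 1 K := Finset.mem_Icc.2 ⟨hk1, hkK⟩
    have hp := hpol k k hk1 le_rfl
    have hgβ : ∀ h < G.H, ∀ s a b, Measurable[X.histState G.H k 0]
        fun ω => g ω * β k h s a b ω := fun h hh s a b => hg.mul (hβm k k hk1 le_rfl h hh s a b)
    have hgβb : ∀ h s a b ω, |g ω * β k h s a b ω| ≤ C * M := fun h s a b ω => by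
      rw [abs_mul, abs_of_nonneg (hβ0 k h s a b ω)]
      exact mul_le_mul (hC ω) (hbonus k h s a b ω) (hβ0 k h s a b ω) ((abs_nonneg _).trans (hC ω))
    have hlaw := fun h (hh : h < G.H) s a b => hF.integral_mul_visit₃_of_state hk (hμ k) (hν k)
      hp.1 hp.2 hh (fun s g hg C hC => hF.integral_mul_state hk (hμ k) (hν k) hp.1 hp.2 hh s g hg
        C hC) s a b _ (hgβ h hh s a b) _ (hgβb h s a b)
    have e1 : ∀ ω, g ω * Y k ω = (∑ h ∈ Finset.range G.H, ∑ s, ∑ a, ∑ b,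
        g ω * β k h s a b ω * (X.visit₃ k h s a b).indicator 1 ω) / (G.H * M) := by
      intro ω
      rw [hYsum, mul_div_assoc']
      simp only [Finset.mul_sum, mul_assoc]
    have e2 : ∀ ω, g ω * m k ω = (∑ h ∈ Finset.range G.H, ∑ s, ∑ a, ∑ b,
        g ω * β k h s a b ω * (G.occ (μs k ω) h s * μs k ω h s a * νs k ω h s b)) /
          (G.H * M) := by
      intro ω
      simp only [hm, SCGame.total]
      rw [mul_div_assoc']
      simp only [Finset.mul_sum]
      congr 1
      refine Finset.sum_congr rfl fun h _ => Finset.sum_congr rfl fun s _ =>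
        Finset.sum_congr rfl fun a _ => Finset.sum_congr rfl fun b _ => by ring
    have i1 : ∀ h < G.H, ∀ s a b, Integrable
        (fun ω => g ω * β k h s a b ω * (X.visit₃ k h s a b).indicator 1 ω) ℙ := by
      intro h hh s a b
      refine integrable_of_abs_le (C := C * M) (((hgβ h hh s a b).mono (hF.histState_le k 0)
        le_rfl).mul (measurable_indicator_one (hvisit k h s a b))) fun ω => ?_
      rw [abs_mul]
      exact (mul_le_of_le_one_right (abs_nonneg _) (abs_indicator_one_le _ ω)).trans
        (hgβb h s a b ω)
    have i2 : ∀ h < G.H, ∀ s a b, Integrable (fun ω => g ω * β k h s a b ω *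
        (G.occ (μs k ω) h s * μs k ω h s a * νs k ω h s b)) ℙ := by
      intro h hh s a b
      refine integrable_of_abs_le (C := C * M) (Measurable.mono ((hgβ h hh s a b).mul
        (((measurable_occ G hp.1 h hh.le s).mul (hp.1 h hh s a)).mul (hp.2 h hh s b)))
        (hF.histState_le k 0) le_rfl) fun ω => ?_
      have o := mem_Icc_of_mem_stdSimplex (G.occ_mem (hμ k ω) h) s
      have u := mem_Icc_of_mem_stdSimplex (hμ k ω h s) a
      have v := mem_Icc_of_mem_stdSimplex (hν k ω h s) b
      rw [abs_mul]
      refine (mul_le_of_le_one_right (abs_nonneg _) ?_).trans (hgβb h s a b ω)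
      rw [abs_of_nonneg (mul_nonneg (mul_nonneg o.1 u.1) v.1)]
      exact mul_le_one₀ (mul_le_one₀ o.2 u.1 u.2) v.1 v.2
    simp only [e1, e2]
    rw [integral_div, integral_div]
    congr 1
    have hswap : ∀ F : ℕ → S → A → B → Ω → ℝ, (∀ h < G.H, ∀ s a b, Integrable (F h s a b) ℙ) →
        ∫ ω, ∑ h ∈ Finset.range G.H, ∑ s, ∑ a, ∑ b, F h s a b ω ∂ℙ =
          ∑ h ∈ Finset.range G.H, ∑ s, ∑ a, ∑ b, ∫ ω, F h s a b ω ∂ℙ := by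
      intro F hFi
      rw [integral_finsetSum _ fun h hh => integrable_finsetSum _ fun s _ =>
        integrable_finsetSum _ fun a _ => integrable_finsetSum _ fun b _ =>
        hFi h (Finset.mem_range.1 hh) s a b]
      refine Finset.sum_congr rfl fun h hh => ?_
      have hi := hFi h (Finset.mem_range.1 hh)
      rw [integral_finsetSum _ fun s _ => integrable_finsetSum _ fun a _ =>
        integrable_finsetSum _ fun b _ => hi s a b]
      refine Finset.sum_congr rfl fun s _ => ?_
      rw [integral_finsetSum _ fun a _ => integrable_finsetSum _ fun b _ => hi s a b]
      refine Finset.sum_congr rfl fun a _ => ?_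
      rw [integral_finsetSum _ fun b _ => hi s a b]
    rw [hswap _ i1, hswap _ i2]
    refine Finset.sum_congr rfl fun h hh => Finset.sum_congr rfl fun s _ =>
      Finset.sum_congr rfl fun a _ => Finset.sum_congr rfl fun b _ => ?_
    exact hlaw h (Finset.mem_range.1 hh) s a b

end Play

/-! ### The bound on the gap -/

theorem IsPolicy.eq_of_subsingleton {S X : Type*} [Fintype X] [Subsingleton X]
    {π π' : ℕ → S → X → ℝ} (h : IsPolicy π) (h' : IsPolicy π') : π = π' := by
  have key : ∀ {π : ℕ → S → X → ℝ}, IsPolicy π → ∀ j s x, π j s x = 1 := by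
    intro π h j s x
    rw [← (h j s).2]
    exact (Fintype.sum_subsingleton _ x).symm
  funext j s x
  rw [key h, key h']

theorem SCGame.gap_nonpos_of_subsingleton {S A B : Type*} [Fintype S] [Fintype A] [Fintype B]
    [DecidableEq S] [Subsingleton A] [Subsingleton B] (G : SCGame S A B) (K : ℕ)
    {μs : ℕ → ℕ → S → A → ℝ} {νs : ℕ → ℕ → S → B → ℝ} (hμ : ∀ k, IsPolicy (μs k))
    (hν : ∀ k, IsPolicy (νs k)) : G.gap K μs νs ≤ 0 := by
  have hne1 : Nonempty {μ : ℕ → S → A → ℝ // IsPolicy μ} := ⟨⟨_, hμ 0⟩⟩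
  have hne2 : Nonempty {ν : ℕ → S → B → ℝ // IsPolicy ν} := ⟨⟨_, hν 0⟩⟩
  have h1 : G.regret₁ K μs νs ≤ 0 := ciSup_le fun μ => by
    refine (Finset.sum_eq_zero fun k _ => ?_).le
    rw [μ.2.eq_of_subsingleton (hμ k), sub_self]
  have h2 : G.regret₂ K μs νs ≤ 0 := ciSup_le fun ν => by
    refine (Finset.sum_eq_zero fun k _ => ?_).le
    rw [ν.2.eq_of_subsingleton (hν k), sub_self]
  rw [SCGame.gap]
  linarith

/-- The contributions to the gap, added up. Here `L`, `L'` are the logarithms in the two bonuses,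
and `a`, `b`, `d` stand for `log |A|`, `log |B|`, `log (1 / δ)`. The lower bound on `L`, slightly
below `log 2`, is used to bound `√L` and `L √L` by multiples of `L ^ 2`. -/
theorem gap_bound_arith {S A B H K L L' a b d : ℝ} (hS : 1 ≤ S) (hA : 1 ≤ A) (hB : 1 ≤ B)
    (hH : 1 ≤ H) (hK : 1 ≤ K) (hL : 0.69 ≤ L) (hL'L : L' ≤ L)
    (haL : a ≤ L) (hbL : b ≤ L) (hdL : d ≤ L) :
    H * (3 / 2 * √(K * H ^ 2 * a)) + H * (3 / 2 * √(S * K * b)) +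
      4 * (2 * (H * (√(4 * L) * (3 * √(S * A * B * K)) +
        √(2 * H ^ 2 * S * L') * (3 * √(S * A * K)))) +
        2 * (H * (√(4 * L) + √(2 * H ^ 2 * S * L'))) * d) ≤
    150 * L ^ 2 * ((√(S ^ 2 * A * H ^ 3) + √(S * A * B * H)) * √(K * H)) := by
  have hH0 : 0 ≤ H := by linarith
  have hSA : 1 ≤ S * A := one_le_mul_of_one_le_of_one_le hS hA
  have hSAK : 1 ≤ S * A * K := one_le_mul_of_one_le_of_one_le hSA hK
  have hS2A : 1 ≤ S ^ 2 * A := one_le_mul_of_one_le_of_one_le (one_le_pow₀ hS) hA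
  have hAB : 1 ≤ A * B := one_le_mul_of_one_le_of_one_le hA hB
  have hSABK : 1 ≤ S * A * B * K :=
    one_le_mul_of_one_le_of_one_le (one_le_mul_of_one_le_of_one_le hSA hB) hK
  set x := √L with hx
  set p := √(S ^ 2 * A * H ^ 3) * √(K * H) with hp
  set q := √(S * A * B * H) * √(K * H) with hq
  have hL0 : 0 ≤ L := by linarith
  have hxx : x ^ 2 = L := Real.sq_sqrt hL0
  have hx0 : 0 ≤ x := Real.sqrt_nonneg _
  have hp0 : 0 ≤ p := by positivity
  have hq0 : 0 ≤ q := by positivity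
  have hHsqrt : ∀ y, H * √y = √(H ^ 2 * y) := fun y => by
    rw [Real.sqrt_mul (by positivity), Real.sqrt_sq hH0]
  have hxp : x * p = √(L * (K * H ^ 4 * (S ^ 2 * A))) := by
    rw [hx, hp, ← Real.sqrt_mul (by positivity), ← Real.sqrt_mul hL0]
    congr 1; ring
  have hxq : x * q = √(L * (S * K * H ^ 2 * (A * B))) := by
    rw [hx, hq, ← Real.sqrt_mul (by positivity), ← Real.sqrt_mul hL0]
    congr 1; ring
  have h2 : ∀ y, 2 * √y = √(4 * y) := fun y => by
    rw [Real.sqrt_mul (by norm_num), show (4 : ℝ) = 2 ^ 2 by norm_num, Real.sqrt_sq (by norm_num)]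
  have t1 : H * √(K * H ^ 2 * a) ≤ x * p := by
    rw [hHsqrt, hxp]
    refine Real.sqrt_le_sqrt ?_
    have e1 : K * H ^ 4 * a ≤ K * H ^ 4 * L := mul_le_mul_of_nonneg_left haL (by positivity)
    have e2 : L * (K * H ^ 4) * 1 ≤ L * (K * H ^ 4) * (S ^ 2 * A) :=
      mul_le_mul_of_nonneg_left hS2A (by positivity)
    linarith
  have t2 : H * √(S * K * b) ≤ x * q := by
    rw [hHsqrt, hxq]
    refine Real.sqrt_le_sqrt ?_
    have e1 : S * K * H ^ 2 * b ≤ S * K * H ^ 2 * L :=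
      mul_le_mul_of_nonneg_left hbL (by positivity)
    have e2 : L * (S * K * H ^ 2) * 1 ≤ L * (S * K * H ^ 2) * (A * B) :=
      mul_le_mul_of_nonneg_left hAB (by positivity)
    linarith
  have t3 : H * (√(4 * L) * √(S * A * B * K)) = 2 * (x * q) := by
    rw [← Real.sqrt_mul (by positivity), hHsqrt, hxq, h2]
    congr 1; ring
  have t4 : H * (√(2 * H ^ 2 * S * L') * √(S * A * K)) ≤ 2 * (x * p) := by
    rw [← Real.sqrt_mul' _ (by positivity), hHsqrt, hxp, h2]
    refine Real.sqrt_le_sqrt ?_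
    have e1 : 2 * (K * H ^ 4 * (S ^ 2 * A)) * L' ≤ 2 * (K * H ^ 4 * (S ^ 2 * A)) * L :=
      mul_le_mul_of_nonneg_left hL'L (by positivity)
    have e2 : 0 ≤ 2 * (K * H ^ 4 * (S ^ 2 * A)) * L := by positivity
    linarith
  have t5 : H * √(4 * L) ≤ 2 * (x * q) := by
    rw [← t3]
    refine mul_le_mul_of_nonneg_left ?_ hH0
    exact le_mul_of_one_le_right (Real.sqrt_nonneg _) (Real.one_le_sqrt.2 hSABK)
  have t6 : H * √(2 * H ^ 2 * S * L') ≤ 2 * (x * p) := by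
    refine le_trans (mul_le_mul_of_nonneg_left ?_ hH0) t4
    exact le_mul_of_one_le_right (Real.sqrt_nonneg _) (Real.one_le_sqrt.2 hSAK)
  have t7 : H * (√(4 * L) + √(2 * H ^ 2 * S * L')) * d ≤ 2 * (x * L) * (p + q) := by
    calc _ ≤ H * (√(4 * L) + √(2 * H ^ 2 * S * L')) * L :=
          mul_le_mul_of_nonneg_left hdL (by positivity)
      _ ≤ (2 * (x * q) + 2 * (x * p)) * L :=
          mul_le_mul_of_nonneg_right (by rw [mul_add]; linarith) hL0
      _ = _ := by ring
  have hx8 : 0.8 ≤ x := Real.le_sqrt_of_sq_le (by norm_num; linarith)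
  have c1 : x * L ≤ 2 * L ^ 2 := by rw [← hxx]; nlinarith [pow_nonneg hx0 3]
  have c2 : x ≤ 2 * L ^ 2 := by
    have : (0.5 : ℝ) ≤ x ^ 3 := le_trans (by norm_num) (pow_le_pow_left₀ (by norm_num) hx8 3)
    rw [← hxx]; nlinarith
  have c3 := mul_le_mul_of_nonneg_right c1 (add_nonneg hp0 hq0)
  have c4 := mul_le_mul_of_nonneg_right c2 (add_nonneg hp0 hq0)
  have c5 : 0 ≤ L ^ 2 * (p + q) := by positivity
  have hfin : (√(S ^ 2 * A * H ^ 3) + √(S * A * B * H)) * √(K * H) = p + q := by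
    rw [hp, hq]; ring
  have hxp0 : 0 ≤ x * p := by positivity
  have hxq0 : 0 ≤ x * q := by positivity
  rw [hfin]
  have expand : H * (3 / 2 * √(K * H ^ 2 * a)) + H * (3 / 2 * √(S * K * b)) +
      4 * (2 * (H * (√(4 * L) * (3 * √(S * A * B * K)) +
        √(2 * H ^ 2 * S * L') * (3 * √(S * A * K)))) +
        2 * (H * (√(4 * L) + √(2 * H ^ 2 * S * L'))) * d) =
      3 / 2 * (H * √(K * H ^ 2 * a)) + 3 / 2 * (H * √(S * K * b)) +
        24 * (H * (√(4 * L) * √(S * A * B * K))) +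
        24 * (H * (√(2 * H ^ 2 * S * L') * √(S * A * K))) +
        8 * (H * (√(4 * L) + √(2 * H ^ 2 * S * L')) * d) := by ring
  rw [expand, t3]
  have e : x * (p + q) = x * p + x * q := by ring
  linarith

theorem corollary2 :
    ∃ c : ℝ, 0 < c ∧ ∃ p : ℕ,
      ∀ (S A B : Type*) [Fintype S] [Fintype A] [Fintype B]
        [DecidableEq S] [DecidableEq A] [DecidableEq B] [Nonempty A] [Nonempty B]
        (G : SCGame S A B) (K : ℕ) (_ : 1 ≤ K) (δ : ℝ) (_ : 0 < δ) (_ : δ < 1)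
        (η γ : ℝ)
        (_ : η = √(Real.log (Fintype.card A) / ((K : ℝ) * (G.H : ℝ) ^ 2)))
        (_ : γ = √((Fintype.card S : ℝ) * Real.log (Fintype.card B) / (K : ℝ)))
        (Ω : Type*) [MeasurableSpace Ω] (ℙ : MeasureTheory.Measure Ω)
        [MeasureTheory.IsProbabilityMeasure ℙ] (X : Play S A B Ω)
        (_ : X.Follows ℙ G K
          (fun k ω => ((X.record ω).policies G.s₁ G.H K δ η γ k).1)
          (fun k ω => ((X.record ω).policies G.s₁ G.H K δ η γ k).2)),
        1 - 5 * δ ≤ ℙ.real {ω |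
          G.gap K
            (fun k => ((X.record ω).policies G.s₁ G.H K δ η γ k).1)
            (fun k => ((X.record ω).policies G.s₁ G.H K δ η γ k).2) ≤
          c * Real.log ((Fintype.card S : ℝ) * Fintype.card A * Fintype.card B * G.H * K / δ) ^ p *
            ((√((Fintype.card S : ℝ) ^ 2 * Fintype.card A * (G.H : ℝ) ^ 3) +
              √((Fintype.card S : ℝ) * Fintype.card A * Fintype.card B * (G.H : ℝ))) *
              √((K : ℝ) * (G.H : ℝ)))} := by
  refine ⟨150, by norm_num, 2, ?_⟩
  intro S A B _ _ _ _ _ _ _ _ G K hK δ hδ hδ1 η γ hη hγ Ω _ ℙ _ X hF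
  set s : ℝ := (Fintype.card S : ℝ) with hs
  set a : ℝ := (Fintype.card A : ℝ) with ha
  set b : ℝ := (Fintype.card B : ℝ) with hb
  set H : ℝ := (G.H : ℝ) with hH
  set good : Set Ω := {ω | G.gap K
      (fun k => ((X.record ω).policies G.s₁ G.H K δ η γ k).1)
      (fun k => ((X.record ω).policies G.s₁ G.H K δ η γ k).2) ≤
    150 * Real.log (s * a * b * H * K / δ) ^ 2 *
      ((√(s ^ 2 * a * H ^ 3) + √(s * a * b * H)) * √((K : ℝ) * H))} with hgood
  have hs1 : 1 ≤ s := by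
    rw [hs]; exact_mod_cast Fintype.card_pos_iff.2 ⟨G.s₁⟩
  have ha1 : 1 ≤ a := by rw [ha]; exact_mod_cast Fintype.card_pos
  have hb1 : 1 ≤ b := by rw [hb]; exact_mod_cast Fintype.card_pos
  have hH1 : 1 ≤ H := by rw [hH]; exact_mod_cast G.H_pos
  have hK1 : (1 : ℝ) ≤ K := by exact_mod_cast hK
  by_cases htriv : Fintype.card A * Fintype.card B = 1
  · have hA : Subsingleton A :=
      Fintype.card_le_one_iff_subsingleton.1 (Nat.eq_one_of_mul_eq_one_right htriv).le
    have hB : Subsingleton B :=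
      Fintype.card_le_one_iff_subsingleton.1 (Nat.eq_one_of_mul_eq_one_left htriv).le
    have huniv : good = Set.univ := by
      refine Set.eq_univ_of_forall fun ω => ?_
      refine (G.gap_nonpos_of_subsingleton K
        (fun k => ((X.record ω).policies_mem _ _ _ _ _ _ k).1.1)
        (fun k => ((X.record ω).policies_mem _ _ _ _ _ _ k).2.1)).trans ?_
      positivity
    rw [huniv, MeasureTheory.probReal_univ]
    linarith
  have hab : 2 ≤ a * b := by
    rw [ha, hb]
    have h1 : 0 < Fintype.card A * Fintype.card B := Nat.mul_pos Fintype.card_pos Fintype.card_pos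
    exact_mod_cast (by omega : 2 ≤ Fintype.card A * Fintype.card B)
  set m : ℝ := s * a * b * H * K with hm
  have hsH : 1 ≤ s * H * K :=
    one_le_mul_of_one_le_of_one_le (one_le_mul_of_one_le_of_one_le hs1 hH1) hK1
  have hmab : m = a * b * (s * H * K) := by rw [hm]; ring
  have hm2 : 2 ≤ m := by
    rw [hmab]
    exact hab.trans (le_mul_of_one_le_right (by linarith) hsH)
  have ham : a ≤ m := by
    rw [hmab, mul_assoc]
    exact le_mul_of_one_le_right (by linarith) (one_le_mul_of_one_le_of_one_le hb1 hsH)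
  have hbm : b ≤ m := by
    rw [hmab, mul_comm a b, mul_assoc]
    exact le_mul_of_one_le_right (by linarith) (one_le_mul_of_one_le_of_one_le ha1 hsH)
  have hm' : 1 ≤ s * a * H * K := by
    have := one_le_mul_of_one_le_of_one_le ha1 hsH
    linarith
  have hm'm : s * a * H * K ≤ m := by
    have : m = s * a * H * K * b := by rw [hm]; ring
    rw [this]
    exact le_mul_of_one_le_right (by linarith) hb1
  have hlog : ∀ y, 0 < y → y ≤ m / δ → Real.log y ≤ Real.log (m / δ) := fun y h1 h2 =>
    Real.log_le_log h1 h2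
  have hdiv : ∀ y, 0 ≤ y → y ≤ y / δ := fun y hy => by
    rw [le_div_iff₀ hδ]; nlinarith
  have hmδ : m ≤ m / δ := hdiv m (by linarith)
  have hL : 0.69 ≤ Real.log (m / δ) := by
    have h1 := hlog 2 (by norm_num) (hm2.trans hmδ)
    have h2 := Real.log_two_gt_d9
    norm_num at h1 h2 ⊢
    linarith
  have hL'0 : 0 ≤ Real.log (s * a * H * K / δ) :=
    Real.log_nonneg (hm'.trans (hdiv _ (by linarith)))
  have hL'L : Real.log (s * a * H * K / δ) ≤ Real.log (m / δ) :=
    hlog _ (by positivity) (div_le_div_of_nonneg_right hm'm hδ.le)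
  have hdL : Real.log (1 / δ) ≤ Real.log (m / δ) :=
    hlog _ (by positivity) (div_le_div_of_nonneg_right (by linarith) hδ.le)
  set M : ℝ := √(4 * Real.log (m / δ)) + √(2 * H ^ 2 * s * Real.log (s * a * H * K / δ)) with hM
  have hM0 : 0 < M := by
    have : 0 < √(4 * Real.log (m / δ)) := Real.sqrt_pos.2 (by linarith)
    positivity
  have hbonus : ∀ k h σ α β ω, (X.record ω).priorBonus G.H K δ k h σ α β ≤ M := by
    intro k h σ α β ω
    have hle : ∀ {y n : ℝ}, 0 ≤ y → √(y / max n 1) ≤ √y := fun hy =>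
      Real.sqrt_le_sqrt (div_le_self hy (le_max_right _ _))
    exact add_le_add (hle (by linarith)) (hle (by positivity))
  set bad₁ : Set Ω := {ω | ¬ (X.record ω).RewardsAccurate G K δ} with hbad₁
  set bad₂ : Set Ω := {ω | ¬ (X.record ω).TransitionsAccurate G K δ} with hbad₂
  set bad₃ : Set Ω := {ω | 2 * ∑ k ∈ Finset.Icc 1 K, ∑ h ∈ Finset.range G.H,
        (X.record ω).priorBonus G.H K δ k h (X.state k h ω) (X.act₁ k h ω) (X.act₂ k h ω) +
          2 * (G.H * M) * Real.log (1 / δ) ≤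
      ∑ k ∈ Finset.Icc 1 K, G.total ((X.record ω).policies G.s₁ G.H K δ η γ k).1
        ((X.record ω).policies G.s₁ G.H K δ η γ k).2
        ((X.record ω).priorBonus G.H K δ k)} with hbad₃
  have hp₁ : ℙ.real bad₁ ≤ 2 * δ := hF.rewardsAccurate hδ hδ1 hm2
  have hp₂ : ℙ.real bad₂ ≤ 2 * δ := hF.transitionsAccurate hK hδ hδ1
  have hp₃ : ℙ.real bad₃ ≤ δ := hF.sum_total_priorBonus hδ hM0 hbonus
  have hcover : Set.univ ⊆ good ∪ (bad₁ ∪ bad₂ ∪ bad₃) := by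
    intro ω _
    by_contra hω
    simp only [Set.mem_union, not_or] at hω
    obtain ⟨hg, ⟨h1, h2⟩, h3⟩ := hω
    refine hg ?_
    have hR : (X.record ω).RewardsAccurate G K δ := not_not.1 h1
    have hP : (X.record ω).TransitionsAccurate G K δ := not_not.1 h2
    rw [hbad₃, Set.mem_ofPred_eq, not_le] at h3
    have hgap := (X.record ω).gap_le_of_accurate G hK hη hγ hR hP
    have hreal := (X.record ω).sum_priorBonus_le G.H K δ (by linarith [hL]) hL'0
    have harith := gap_bound_arith hs1 ha1 hb1 hH1 hK1 hL hL'L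
      (hlog a (by linarith) (ham.trans hmδ)) (hlog b (by linarith) (hbm.trans hmδ)) hdL
    refine hgap.trans (le_trans ?_ harith)
    have hreal' : ∑ k ∈ Finset.Icc 1 K, ∑ h ∈ Finset.range G.H,
        (X.record ω).priorBonus G.H K δ k h (X.state k h ω) (X.act₁ k h ω) (X.act₂ k h ω) ≤ _ :=
      hreal
    linarith
  have h1 : (1 : ℝ) ≤ ℙ.real (good ∪ (bad₁ ∪ bad₂ ∪ bad₃)) := by
    rw [← MeasureTheory.probReal_univ (μ := ℙ)]
    exact MeasureTheory.measureReal_mono hcover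
  have h2 := MeasureTheory.measureReal_union_le (μ := ℙ) good (bad₁ ∪ bad₂ ∪ bad₃)
  have h3 := MeasureTheory.measureReal_union_le (μ := ℙ) (bad₁ ∪ bad₂) bad₃
  have h4 := MeasureTheory.measureReal_union_le (μ := ℙ) bad₁ bad₂
  linarith
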